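/- **The table.** Let $h,l,k_f>0$ with $k_f<2$ and $-\sqrt2<k_d<0$. Let $\Omega\subset\mathbb R^2$ be the closed region enclosed by the following curve, travelled counterclockwise: - a focusing (outward bulging) minor circular arc $\partial_f$ of curvature $k_f$ from $(0,0)$ to $(1,0)$; - the three sides $(1,0)\to(1+l,0)\to(1+l,h)\to(1,h)$ of the right strip; - three dispersing (inward bulging) minor circular arcs of curvature $k_d$ over the unit chords $(1,h)\to(1,h+1)\to(0,h+1)\to(0,h)$, whose union is $\partial_d$; - the three sides $(0,h)\to(-l,h)\to(-l,0)\to(0,0)$ of the left strip. The six flat sides form $\partial_s$. Curvature $k$ is positive at focusing and negative at dispersing points. For $s$ on a curved piece, let $D_\beta(s)$ be the closed disc of radius $1/|\beta k(s)|$ tangent to the boundary at $s$, on the side of $\Omega$ if $\beta>0$ and on the opposite side if $\beta<0$. Assume - (C1) for all $s'\in\partial_d$, $s''\in\partial_f$, the intersection of the straight line through $s'$ and $s''$ with $D_{-2}(s')$ is contained in $D_4(s'')$; - (C2) $l\ge 1/k_f$. **The map.** Let $\mathcal M$ be the set of $x=(s,\alpha)$, where $s$ is the (counterclockwise) arclength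 coordinate of a point of $\partial_f\cup\partial_d$ and $\alpha\in[-\pi/2,\pi/2]$ is the angle, oriented clockwise, from the inner normal at $s$ to the outgoing velocity. Let $\mu$ be the probability measure $c\cos\alpha\,ds\,d\alpha$ on $\mathcal M$. Let $M$ be the first-return map to $\mathcal M$ of the unit speed billiard flow in $\Omega$ (elastic reflection), so that collisions with $\partial_s$ are not counted; $M$ is left undefined where a vertex is hit or a tangential collision occurs. Write $M^{-1}x=(s_{-1},\alpha_{-1})$. **The cones.** For a tangent vector $v=(ds,d\alpha)\ne0$ at $x=(s,\alpha)$, let $f^+(v)\in\mathbb R\cup\{\infty\}$ be the signed focal distance of the outgoing family of rays determined by $v$: $f^+(v)=\cos\alpha/\bigl(k(s)-\tfrac{d\alpha}{ds}\bigr)$ if $ds\neq0$ (with value $\infty$ if the denominator vanishes) and $f^+(v)=0$ if $ds=0$. Consider the closed cones (each containing $0$) - $C_0(x)=\{v: -\cos\alpha/|k(s)|\le f^+(v)\le0\}$ (focusing in $D_{-2}(s)$); - $C_1(x)=\{v: -\infty\le f^+(v)\le0\}$ (focusing in the external half-plane, parallel families $f^+=\infty$ included); - $C_2(x)=\{v: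 \cos\alpha/(2|k(s)|)\le f^+(v)\le\cos\alpha/|k(s)|\}$ (focusing in $D_2(s)\setminus \mathrm{int}\,D_4(s)$). Define $C(x)=C_0(x)$ if $s\in\partial_d$. If $s\in\partial_f$, let $C(x)=C_1(x)$ when $s_{-1}\in\partial_d$ and there is no collision with $\partial_s$ between $s_{-1}$ and $s$; let $C(x)=C_2(x)$ when $s_{-1}\in\partial_f$, or when $s_{-1}\in\partial_d$ and there is at least one collision with $\partial_s$ between $s_{-1}$ and $s$. **Theorem 4.1.** The cone bundle $C$ is an eventually strictly invariant measurable cone bundle for $M$. That is: 1. for $\mu$-a.e. $x$, $C(x)=\{av_1+bv_2: ab\ge0\}$ with $v_1,v_2$ linearly independent and depending measurably on $x$; 2. for $\mu$-a.e. $x$, $M$ is defined and differentiable at $x$, and $(DM)_xC(x)\subseteq C(Mx)$; 3. for $\mu$-a.e. $x$ there is an integer $n\ge1$ such that $M^n$ is defined and differentiable at $x$ and $(DM^n)_x$ maps $C(x)\setminus\{0\}$ into the interior of $C(M^nx)$. -/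

import Mathlib

open MeasureTheory Set Filter Topology ComplexConjugate

noncomputable section

namespace Billiard

/-- The four geometric constants of the table. The plane is `ℂ`. The vertices of the table are
`0, 1, 1 + l, 1 + l + ih, 1 + ih, 1 + i(h + 1), i(h + 1), ih, -l + ih, -l`, in counterclockwise
order. -/
structure Table where
  /-- length of each strip -/
  l : ℝ
  /-- height of each strip -/
  h : ℝ
  /-- curvature of the focusing arc -/
  kf : ℝ
  /-- (negative) curvature of the dispersing arcs -/
  kd : ℝ

/-- The curved boundary components: `bottom` is the focusing one, the others are dispersing. -/
inductive Arc where
  | bottom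
  | right
  | top
  | left

instance : MeasurableSpace Arc := ⊤

/-- The six flat boundary components (three sides of each of the two strips). -/
inductive Wall where
  | rightBottom
  | rightEnd
  | rightTop
  | leftTop
  | leftEnd
  | leftBottom

namespace Table

variable (T : Table)

/-! ### The boundary -/

/-- First endpoint of a curved component, in counterclockwise order. -/
def arcStart : Arc → ℂ
  | .bottom => 0
  | .right => 1 + T.h * Complex.I
  | .top => 1 + (T.h + 1) * Complex.I
  | .left => (T.h + 1) * Complex.I

/-- The vector from the first to the last endpoint of a curved component; all four have length
one. -/
def arcChord : Arc → ℂ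
  | .bottom => 1
  | .right => Complex.I
  | .top => -1
  | .left => -Complex.I

/-- Curvature of the component: positive when focusing, negative when dispersing. -/
def curv : Arc → ℝ
  | .bottom => T.kf
  | .right => T.kd
  | .top => T.kd
  | .left => T.kd

/-- Length of the (minor) circular arc of curvature `|k|` over a chord of length one. -/
def arcLen (i : Arc) : ℝ := 2 * Real.arcsin (|T.curv i| / 2) / |T.curv i|

/-- Unit tangent vector (counterclockwise) at the point of arclength coordinate `s`. -/
def tangent (i : Arc) (s : ℝ) : ℂ :=
  arcChord i * Complex.exp ((T.curv i * (s - T.arcLen i / 2) : ℝ) * Complex.I)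

/-- Inner unit normal vector at the point of arclength coordinate `s`. -/
def normal (i : Arc) (s : ℝ) : ℂ := Complex.I * T.tangent i s

/-- The point of arclength coordinate `s ∈ [0, arcLen i]` on the component `i`: it starts at
`arcStart i`, and its derivative is `tangent i`. -/
def arcPoint (i : Arc) (s : ℝ) : ℂ :=
  T.arcStart i + (T.tangent i s - T.tangent i 0) / (T.curv i * Complex.I)

/-- Endpoints of the flat components, in counterclockwise order. -/
def wallStart : Wall → ℂ
  | .rightBottom => 1
  | .rightEnd => 1 + T.l
  | .rightTop => 1 + T.l + T.h * Complex.I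
  | .leftTop => T.h * Complex.I
  | .leftEnd => -T.l + T.h * Complex.I
  | .leftBottom => -T.l

/-- Endpoints of the flat components, in counterclockwise order. -/
def wallStop : Wall → ℂ
  | .rightBottom => 1 + T.l
  | .rightEnd => 1 + T.l + T.h * Complex.I
  | .rightTop => 1 + T.h * Complex.I
  | .leftTop => -T.l + T.h * Complex.I
  | .leftEnd => -T.l
  | .leftBottom => 0

/-- Unit tangent vector (counterclockwise) of a flat component. -/
def wallTangent : Wall → ℂ
  | .rightBottom => 1
  | .rightEnd => Complex.I
  | .rightTop => -1
  | .leftTop => -1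
  | .leftEnd => -Complex.I
  | .leftBottom => 1

/-- The boundary of the table: a closed curve made of four circular arcs and six segments. -/
def boundary : Set ℂ :=
  (⋃ i : Arc, T.arcPoint i '' Icc 0 (T.arcLen i)) ∪
    ⋃ w : Wall, segment ℝ (T.wallStart w) (T.wallStop w)

/-- For `β ≠ 0`, the closed disc of radius `1 / |β k|` tangent to the boundary at the point of
coordinate `s`, on the internal side if `β > 0` and on the external side if `β < 0`. -/
def disc (β : ℝ) (i : Arc) (s : ℝ) : Set ℂ :=
  Metric.closedBall (T.arcPoint i s + ((1 / (β * |T.curv i|) : ℝ) : ℂ) * T.normal i s)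
    (1 / |β * T.curv i|)

/-- The intersection of the line through `p` and `q` with a set. -/
def lineInter (p q : ℂ) (D : Set ℂ) : Set ℂ := (line[ℝ, p, q] : Set ℂ) ∩ D

/-- For `s'` on a dispersing arc and `s''` on the focusing arc, the line through
the two points meets `D₋₂(s')` inside `D₄(s'')`. -/
def ConditionC1 : Prop :=
  ∀ i : Arc, i ≠ .bottom → ∀ s' ∈ Icc 0 (T.arcLen i), ∀ s'' ∈ Icc 0 (T.arcLen .bottom),
    lineInter (T.arcPoint i s') (T.arcPoint .bottom s'') (T.disc (-2) i s') ⊆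
      T.disc 4 .bottom s''

/-- The strips are at least as long as the radius of the focusing arc. -/
def ConditionC2 : Prop := 1 / T.kf ≤ T.l

/-- Standing assumptions on the parameters. (`kf < 2` is what is needed for a circular arc of
curvature `kf` over a chord of length one, smaller than a semicircle, to exist.) -/
structure Admissible : Prop where
  h_pos : 0 < T.h
  kf_pos : 0 < T.kf
  kf_lt : T.kf < 2
  kd_gt : -Real.sqrt 2 < T.kd
  kd_neg : T.kd < 0
  c1 : T.ConditionC1
  c2 : T.ConditionC2

end Table

/-! ### Phase space -/

/-- Coordinates `(i, (s, α))` of line elements based on the curved boundary components: the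
component `i`, the arclength coordinate `s` on it, and the angle `α`, oriented clockwise, from the
inner normal to the velocity. -/
abbrev Phase : Type := Arc × (ℝ × ℝ)

/-- Specular reflection of a velocity in a line with unit direction vector `τ`. -/
def reflect (τ u : ℂ) : ℂ := τ ^ 2 * conj u

namespace Table

variable (T : Table)

/-- The line elements based on the curved boundary, vertices and tangential velocities (a null
set) being removed. -/
def phaseSpace : Set Phase :=
  {x | x.2.1 ∈ Ioo 0 (T.arcLen x.1) ∧ x.2.2 ∈ Ioo (-(Real.pi / 2)) (Real.pi / 2)}

/-- Base point of a line element. -/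
def pos (x : Phase) : ℂ := T.arcPoint x.1 x.2.1

/-- Outgoing velocity of a line element: the inner normal, turned clockwise by `α`. -/
def vel (x : Phase) : ℂ :=
  T.normal x.1 x.2.1 * Complex.exp (((-x.2.2 : ℝ) : ℂ) * Complex.I)

/-- The measure `cos α ds dα` on the phase space, before normalization. -/
def rawMeasure : Measure Phase :=
  (((Measure.count : Measure Arc).prod (volume : Measure (ℝ × ℝ))).restrict
    T.phaseSpace).withDensity fun x => ENNReal.ofReal (Real.cos x.2.2)

/-- The probability measure `c cos α ds dα` on the phase space. -/
def measure : Measure Phase := (T.rawMeasure univ)⁻¹ • T.rawMeasure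

/-! ### Dynamics -/

/-- The particle leaving `q` with velocity `u` hits the boundary for the first time at time `t`. -/
def FirstHit (q u : ℂ) (t : ℝ) : Prop :=
  0 < t ∧ q + t * u ∈ T.boundary ∧ ∀ r ∈ Ioo 0 t, q + r * u ∉ T.boundary

/-- The particle with position and velocity `z` has its next collision in the relative interior of
a flat component, and `z'` are its position and velocity right after it. -/
def FlatBounce (z z' : ℂ × ℂ) : Prop :=
  ∃ (t : ℝ) (w : Wall), T.FirstHit z.1 z.2 t ∧
    z.1 + t * z.2 ∈ openSegment ℝ (T.wallStart w) (T.wallStop w) ∧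
    z' = (z.1 + t * z.2, reflect (wallTangent w) z.2)

/-- `z'` is reached from `z` by `n` consecutive collisions with flat components. -/
inductive FlatPath : ℕ → ℂ × ℂ → ℂ × ℂ → Prop
  | zero (z : ℂ × ℂ) : FlatPath 0 z z
  | succ {n : ℕ} {z z' z'' : ℂ × ℂ} :
      FlatPath n z z' → T.FlatBounce z' z'' → FlatPath (n + 1) z z''

/-- `y` is the line element of the next collision of `x` with the curved boundary, and exactly `n`
collisions with the flat boundary take place in between. Neither a vertex is hit nor is any
collision tangential. -/
def Returns (x : Phase) (n : ℕ) (y : Phase) : Prop :=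
  x ∈ T.phaseSpace ∧ y ∈ T.phaseSpace ∧
    ∃ (q u : ℂ) (t : ℝ), T.FlatPath n (T.pos x, T.vel x) (q, u) ∧ T.FirstHit q u t ∧
      q + t * u = T.pos y ∧ reflect (T.tangent y.1 y.2.1) u = T.vel y

/-- The domain of the first-return map. -/
def returnDomain : Set Phase := {x | ∃ n y, T.Returns x n y}

open Classical in
/-- The first-return map to the curved boundary (with the dummy value `x` outside its domain). -/
def returnMap (x : Phase) : Phase :=
  if hx : ∃ y, ∃ n, T.Returns x n y then hx.choose else x

/-- The domain of the `n`-th iterate of the first-return map. -/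
def iterDomain (n : ℕ) : Set Phase := {x | ∀ m < n, T.returnMap^[m] x ∈ T.returnDomain}

/-! ### Cones -/

open Classical in
/-- The signed focal distance `f⁺` in `ℝ ∪ {∞}` of the postcollisional family of rays
determined by the tangent vector `v = (ds, dα)` at `x`. -/
def focal (x : Phase) (v : ℝ × ℝ) : OnePoint ℝ :=
  if v.1 = 0 then ((0 : ℝ) : OnePoint ℝ)
  else if T.curv x.1 - v.2 / v.1 = 0 then OnePoint.infty
  else ((Real.cos x.2.2 / (T.curv x.1 - v.2 / v.1) : ℝ) : OnePoint ℝ)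

/-- Families of rays focusing in `D₋₂`. -/
def cone0 (x : Phase) : Set (ℝ × ℝ) :=
  {v | v = 0 ∨ ∃ f : ℝ, T.focal x v = f ∧ -(Real.cos x.2.2 / |T.curv x.1|) ≤ f ∧ f ≤ 0}

/-- Families of rays focusing in the external half-plane: the divergent families, together with
their limit, the parallel ones (`f⁺ = ∞`), so that this is a closed cone. -/
def cone1 (x : Phase) : Set (ℝ × ℝ) :=
  {v | v = 0 ∨ T.focal x v = OnePoint.infty ∨ ∃ f : ℝ, T.focal x v = f ∧ f ≤ 0}

/-- Families of rays focusing in `D₂` minus the interior of `D₄`. -/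
def cone2 (x : Phase) : Set (ℝ × ℝ) :=
  {v | v = 0 ∨ ∃ f : ℝ, T.focal x v = f ∧
    Real.cos x.2.2 / (2 * |T.curv x.1|) ≤ f ∧ f ≤ Real.cos x.2.2 / |T.curv x.1|}

open Classical in
/-- The cone bundle. On dispersing arcs it is `C₀`. On the focusing arc it is `C₁` if the previous
curved collision was on a dispersing arc with no collision with the flat boundary in between, and
`C₂` if the previous curved collision was on the focusing arc, or was on a dispersing arc with at
least one collision with the flat boundary in between. -/
def coneBundle (x : Phase) : Set (ℝ × ℝ) :=
  if x.1 ≠ .bottom then T.cone0 x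
  else if ∃ y : Phase, y.1 ≠ .bottom ∧ T.Returns y 0 x then T.cone1 x
  else T.cone2 x

end Table

/-- The cone with boundaries `v₁, v₂`. -/
def coneOf (v₁ v₂ : ℝ × ℝ) : Set (ℝ × ℝ) := {v | ∃ a b : ℝ, 0 ≤ a * b ∧ v = a • v₁ + b • v₂}

/-- `C x` is, for almost every `x`, a cone with linearly independent boundaries depending
measurably on `x`. -/
def IsMeasurableConeBundle (μ : Measure Phase) (C : Phase → Set (ℝ × ℝ)) : Prop :=
  ∃ v₁ v₂ : Phase → ℝ × ℝ, Measurable v₁ ∧ Measurable v₂ ∧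
    ∀ᵐ x ∂μ, LinearIndependent ℝ ![v₁ x, v₂ x] ∧ C x = coneOf (v₁ x) (v₂ x)

/-- `A` is the differential at `x`, in the coordinates `(s, α)`, of the map `F` of the phase space:
near `x` the image stays on one boundary component, and `A` is the derivative there. -/
def HasDifferential (F : Phase → Phase) (x : Phase) (A : ℝ × ℝ →L[ℝ] ℝ × ℝ) : Prop :=
  (∀ᶠ p in 𝓝 x.2, (F (x.1, p)).1 = (F x).1) ∧ HasFDerivAt (fun p => (F (x.1, p)).2) A x.2

namespace Table

variable (T : Table)

/-- Invariance of a cone bundle under the differential of the first-return map `M`, almost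
everywhere; in particular `M` is defined and differentiable almost everywhere. -/
def IsInvariant (C : Phase → Set (ℝ × ℝ)) : Prop :=
  ∀ᵐ x ∂T.measure, x ∈ T.returnDomain ∧ ∃ A : ℝ × ℝ →L[ℝ] ℝ × ℝ,
    HasDifferential T.returnMap x A ∧ ∀ v ∈ C x, A v ∈ C (T.returnMap x)

/-- Eventual strict invariance: the bundle is a measurable cone bundle, it is invariant, and for
almost every `x` some iterate `Mⁿ`, `n ≥ 1`, is defined and differentiable at `x` and its
differential maps the nonzero vectors of `C x` to the interior of the cone at `Mⁿ x`. -/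
structure EventuallyStrictlyInvariant (C : Phase → Set (ℝ × ℝ)) : Prop where
  measurable : IsMeasurableConeBundle T.measure C
  invariant : T.IsInvariant C
  eventually_strict : ∀ᵐ x ∂T.measure, ∃ n : ℕ, 1 ≤ n ∧ x ∈ T.iterDomain n ∧
    ∃ A : ℝ × ℝ →L[ℝ] ℝ × ℝ, HasDifferential (T.returnMap^[n]) x A ∧
      ∀ v ∈ C x, v ≠ 0 → A v ∈ interior (C (T.returnMap^[n] x))

end Table

end Billiard

end

/-!
A family of rays at a line element `x` is described by its width `ξ = cos α ds` and its angular
width `η = k ds - dα`; it focuses at distance `ξ / η`. After a flight of length `d`, at curvature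
`k₁` and angle `α₁`, the width is `J = d η - ξ` and the angular width of the reflected family is
`2 k₁ J / cos α₁ - η`, up to a common sign. Flat collisions only change this sign: unfolding the
table in the sides of the rectangle made of the strips turns them into free flight
(`Admissible.returns_stable`). The three cones are given by quadratic forms in the tangent vector
(`mem_cone0_iff`, `mem_cone1_iff`, `mem_cone2_iff`), and in coordinates adapted to the cone at the
start of a flight the form of the cone at its end has coefficients of one sign
(`Admissible.map_cone`). The inputs are

* a direct flight between the focusing and a dispersing arc is so short, by the condition on `D₋₂`
  and `D₄`, that `d + cos α' / |k'| ≤ cos α'' / (2 kf)` (`Admissible.c1_up`, `Admissible.c1_down`);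
* a flight with a flat collision goes through a strip and back, so that `d > 2 l ≥ 2 / kf`;
* a direct flight on the focusing arc is a chord, with `kf d = 2 cos α` and `α₁ = α`.

The image of the cone is in the interior of the next one, unless the flight starts and ends on the
focusing arc, or is a direct one with equality in the first inequality. Equality confines the ray to
a null set (`Admissible.negligible_tight`). A flight between points of the focusing arc is strict
too if it has a flat collision and starts from `C₂`. Since the cone is `C₂` after any flight from the
focusing arc to itself, an orbit without a strict step would follow chords of this arc forever. That
is impossible, because these chords advance by a constant nonzero angle (`Admissible.no_infinite_chords`).

Almost every line element has an infinite future. A trajectory that never returns to an arc would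
bounce in the rectangle forever; by Dirichlet's theorem it would come back close to the point where
it entered, and leave through the opening (`Admissible.no_infinite_path`). Trajectories that run
into a vertex or are tangent to an arc are, after unfolding, rays through one of countably many
points or tangent to one of countably many circles; for all but countably many base points only
finitely many directions are possible (`Admissible.negligible_singular`). Such null sets pull back to null sets,
since by time reversal the inverse of the return map is differentiable
(`Admissible.negligible_preimage`).
-/

noncomputable section

namespace Billiard

namespace Table

variable {T : Table}

/-! ### Circular arcs in chord coordinates -/

theorem Admissible.curv_ne (hT : T.Admissible) (i : Arc) : T.curv i ≠ 0 := by
  cases i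
  · exact hT.kf_pos.ne'
  all_goals exact hT.kd_neg.ne

theorem Admissible.abs_kd_sq_lt (hT : T.Admissible) : T.kd ^ 2 < 2 := by
  have h1 := hT.kd_gt
  have h2 := hT.kd_neg
  have h3 : Real.sqrt 2 ^ 2 = 2 := Real.sq_sqrt (by norm_num)
  have h4 := Real.sqrt_nonneg 2
  nlinarith

theorem Admissible.curv_sq_lt (hT : T.Admissible) (i : Arc) : T.curv i ^ 2 < 4 := by
  have h1 := hT.abs_kd_sq_lt
  have h2 := hT.kf_pos
  have h3 := hT.kf_lt
  cases i <;> simp only [curv] <;> nlinarith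

theorem Admissible.curv_pos_or (hT : T.Admissible) (i : Arc) :
    (i = .bottom ∧ 0 < T.curv i) ∨ (i ≠ .bottom ∧ T.curv i < 0) := by
  have h1 := hT.kd_neg
  have h2 := hT.kf_pos
  cases i <;> simp [curv, h1, h2]

theorem norm_arcChord (i : Arc) : ‖arcChord i‖ = 1 := by cases i <;> simp [arcChord]

/-- Half of the opening angle of a curved component. -/
def halfAngle (T : Table) (i : Arc) : ℝ := Real.arcsin (|T.curv i| / 2)

/-- The angle from the chord of the component `i` to its tangent at the coordinate `s`. -/
def turn (T : Table) (i : Arc) (s : ℝ) : ℝ := T.curv i * (s - T.arcLen i / 2)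

theorem tangent_eq (i : Arc) (s : ℝ) :
    T.tangent i s = arcChord i * Complex.exp ((T.turn i s : ℝ) * Complex.I) := rfl

theorem norm_tangent (i : Arc) (s : ℝ) : ‖T.tangent i s‖ = 1 := by
  rw [tangent_eq, norm_mul, norm_arcChord, Complex.norm_exp_ofReal_mul_I, one_mul]

theorem norm_normal (i : Arc) (s : ℝ) : ‖T.normal i s‖ = 1 := by
  rw [normal, norm_mul, norm_tangent, Complex.norm_I, one_mul]

theorem Admissible.half_lt_one (hT : T.Admissible) (i : Arc) : |T.curv i| / 2 < 1 := by
  have := hT.curv_sq_lt i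
  have h2 : |T.curv i| < 2 := abs_lt_of_sq_lt_sq (by linarith) (by norm_num)
  linarith

theorem Admissible.halfAngle_pos (hT : T.Admissible) (i : Arc) : 0 < T.halfAngle i := by
  have := hT.curv_ne i
  exact Real.arcsin_pos.2 (by positivity)

theorem Admissible.halfAngle_lt (hT : T.Admissible) (i : Arc) : T.halfAngle i < Real.pi / 2 :=
  Real.arcsin_lt_pi_div_two.2 (hT.half_lt_one i)

theorem Admissible.sin_halfAngle (hT : T.Admissible) (i : Arc) :
    Real.sin (T.halfAngle i) = |T.curv i| / 2 :=
  Real.sin_arcsin (by have := abs_nonneg (T.curv i); linarith) (hT.half_lt_one i).le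

theorem Admissible.cos_halfAngle_pos (hT : T.Admissible) (i : Arc) :
    0 < Real.cos (T.halfAngle i) :=
  Real.cos_pos_of_mem_Ioo ⟨by have := hT.halfAngle_pos i; have := Real.pi_pos; linarith,
    hT.halfAngle_lt i⟩

theorem Admissible.abs_curv_mul_arcLen (hT : T.Admissible) (i : Arc) :
    |T.curv i| * T.arcLen i = 2 * T.halfAngle i := by
  have := hT.curv_ne i
  unfold arcLen halfAngle
  field_simp

theorem abs_turn (i : Arc) (s : ℝ) :
    |T.turn i s| = |T.curv i| * |s - T.arcLen i / 2| := abs_mul _ _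

theorem Admissible.abs_turn_le_iff (hT : T.Admissible) (i : Arc) (s : ℝ) :
    |T.turn i s| ≤ T.halfAngle i ↔ s ∈ Icc 0 (T.arcLen i) := by
  have h1 : T.halfAngle i = |T.curv i| * (T.arcLen i / 2) := by
    have := hT.abs_curv_mul_arcLen i; linarith
  rw [abs_turn, h1, mul_le_mul_iff_right₀ (abs_pos.2 (hT.curv_ne i)), abs_le, mem_Icc]
  constructor <;> rintro ⟨h, h'⟩ <;> constructor <;> linarith

theorem Admissible.abs_turn_lt_iff (hT : T.Admissible) (i : Arc) (s : ℝ) :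
    |T.turn i s| < T.halfAngle i ↔ s ∈ Ioo 0 (T.arcLen i) := by
  have h1 : T.halfAngle i = |T.curv i| * (T.arcLen i / 2) := by
    have := hT.abs_curv_mul_arcLen i; linarith
  rw [abs_turn, h1, mul_lt_mul_iff_right₀ (abs_pos.2 (hT.curv_ne i)), abs_lt, mem_Ioo]
  constructor <;> rintro ⟨h, h'⟩ <;> constructor <;> linarith

/-- Coordinate on the plane that sends the chord of the component `i` to `[0, 1]`. -/
def chordCoord (T : Table) (i : Arc) (z : ℂ) : ℂ := (z - T.arcStart i) * conj (arcChord i)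

theorem chordCoord_re (i : Arc) (z : ℂ) : (T.chordCoord i z).re =
    match i with
    | .bottom => z.re
    | .right => z.im - T.h
    | .top => 1 - z.re
    | .left => T.h + 1 - z.im := by
  cases i <;> simp [chordCoord, arcStart, arcChord]

theorem chordCoord_im (i : Arc) (z : ℂ) : (T.chordCoord i z).im =
    match i with
    | .bottom => z.im
    | .right => 1 - z.re
    | .top => T.h + 1 - z.im
    | .left => z.re := by
  cases i <;> simp [chordCoord, arcStart, arcChord]

/-- Signed height of the centre of the circle carrying the component `i` above its chord, the
positive side being the one of the table. -/
def centerHeight (T : Table) (i : Arc) : ℝ := Real.cos (T.halfAngle i) / T.curv i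

/-- Centre of the circle carrying the component `i`. -/
def center (T : Table) (i : Arc) : ℂ :=
  T.arcStart i + arcChord i * (1 / 2 + T.centerHeight i * Complex.I)

theorem Admissible.sin_turn_zero (hT : T.Admissible) (i : Arc) :
    Real.sin (T.turn i 0) = - (T.curv i / 2) ∧
      Real.cos (T.turn i 0) = Real.cos (T.halfAngle i) := by
  have h := hT.abs_curv_mul_arcLen i
  have hs := hT.sin_halfAngle i
  rcases lt_or_gt_of_ne (hT.curv_ne i) with hk | hk
  · have : T.turn i 0 = T.halfAngle i := by
      unfold turn; rw [abs_of_neg hk] at h; linarith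
    rw [this, hs, abs_of_neg hk]; constructor <;> ring
  · have : T.turn i 0 = -T.halfAngle i := by
      unfold turn; rw [abs_of_pos hk] at h; linarith
    rw [this, Real.sin_neg, Real.cos_neg, hs, abs_of_pos hk]; exact ⟨rfl, rfl⟩

theorem tangent_re_im (i : Arc) (s : ℝ) : T.tangent i s =
    arcChord i * (Real.cos (T.turn i s) + Real.sin (T.turn i s) * Complex.I) := by
  rw [tangent_eq, Complex.exp_mul_I, ← Complex.ofReal_cos, ← Complex.ofReal_sin]

theorem Admissible.arcPoint_eq (hT : T.Admissible) (i : Arc) (s : ℝ) :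
    T.arcPoint i s = T.center i - T.normal i s / T.curv i := by
  have hk : (T.curv i : ℂ) ≠ 0 := by exact_mod_cast hT.curv_ne i
  obtain ⟨h1, h2⟩ := hT.sin_turn_zero i
  have hI := Complex.I_sq
  unfold arcPoint center normal centerHeight
  rw [tangent_re_im i 0, h1, h2]
  push_cast
  field_simp
  linear_combination (2 * T.tangent i s - arcChord i * (2 * Complex.cos (T.halfAngle i))) * hI

theorem Admissible.chordCoord_arcPoint (hT : T.Admissible) (i : Arc) (s : ℝ) :
    (T.chordCoord i (T.arcPoint i s)).re = 1 / 2 + Real.sin (T.turn i s) / T.curv i ∧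
    (T.chordCoord i (T.arcPoint i s)).im =
      (Real.cos (T.halfAngle i) - Real.cos (T.turn i s)) / T.curv i := by
  have hk := hT.curv_ne i
  have hk' : (T.curv i : ℂ) ≠ 0 := by exact_mod_cast hk
  have hc : arcChord i * conj (arcChord i) = 1 := by
    rw [Complex.mul_conj, Complex.normSq_eq_norm_sq, norm_arcChord]; simp
  have hI := Complex.I_sq
  have : T.chordCoord i (T.arcPoint i s) =
      ((1 / 2 + Real.sin (T.turn i s) / T.curv i : ℝ) : ℂ) +
       (((Real.cos (T.halfAngle i) - Real.cos (T.turn i s)) / T.curv i : ℝ) : ℂ) * Complex.I := by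
    rw [hT.arcPoint_eq, chordCoord, center, normal, tangent_re_im, centerHeight]
    push_cast
    field_simp
    linear_combination (Complex.I * 2 * Complex.cos (T.halfAngle i) + T.curv i - Complex.I * 2 *
      (Complex.cos (T.turn i s) + Complex.sin (T.turn i s) * Complex.I)) * hc
       - 2 * Complex.sin (T.turn i s) * hI
  have key : ∀ a b : ℝ, ((a : ℂ) + b * Complex.I).re = a ∧ ((a : ℂ) + b * Complex.I).im = b := by
    simp
  rw [this]
  exact key _ _

/-- The power of a point with respect to the circle carrying the component `i`, in the coordinates
adapted to the chord. -/
def circlePow (T : Table) (i : Arc) (z : ℂ) : ℝ :=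
  (T.chordCoord i z).re ^ 2 - (T.chordCoord i z).re + (T.chordCoord i z).im ^ 2
    - 2 * T.centerHeight i * (T.chordCoord i z).im

theorem Admissible.centerHeight_sq (hT : T.Admissible) (i : Arc) :
    T.centerHeight i ^ 2 + 1 / 4 = 1 / T.curv i ^ 2 := by
  have hk := hT.curv_ne i
  have h1 := hT.sin_halfAngle i
  have h2 := Real.sin_sq_add_cos_sq (T.halfAngle i)
  have h3 := sq_abs (T.curv i)
  unfold centerHeight
  rw [h1] at h2
  field_simp
  nlinarith

theorem Admissible.circlePow_eq (hT : T.Admissible) (i : Arc) (z : ℂ) :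
    T.circlePow i z = Complex.normSq (z - T.center i) - 1 / T.curv i ^ 2 := by
  have h := hT.centerHeight_sq i
  have hc : conj (arcChord i) * arcChord i = 1 := by
    rw [mul_comm, Complex.mul_conj, Complex.normSq_eq_norm_sq, norm_arcChord]; simp
  have h1 : Complex.normSq (z - T.center i) =
      Complex.normSq (T.chordCoord i z - (1 / 2 + T.centerHeight i * Complex.I)) := by
    have : T.chordCoord i z - (1 / 2 + T.centerHeight i * Complex.I) =
        (z - T.center i) * conj (arcChord i) := by
      unfold chordCoord center
      linear_combination (1 / 2 + T.centerHeight i * Complex.I) * hc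
    rw [this, Complex.normSq_mul, Complex.normSq_conj, Complex.normSq_eq_norm_sq (arcChord i),
      norm_arcChord]; ring
  rw [h1, Complex.normSq_apply, circlePow]
  rw [← h]
  simp
  ring

theorem Admissible.circlePow_arcPoint (hT : T.Admissible) (i : Arc) (s : ℝ) :
    T.circlePow i (T.arcPoint i s) = 0 := by
  rw [hT.circlePow_eq, hT.arcPoint_eq]
  have hk := hT.curv_ne i
  simp [Complex.normSq_eq_norm_sq, norm_normal]

theorem Admissible.arcPoint_mem (hT : T.Admissible) {i : Arc} {s : ℝ}
    (hs : s ∈ Icc 0 (T.arcLen i)) :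
    T.curv i * (T.chordCoord i (T.arcPoint i s)).im ≤ 0 := by
  have hk := hT.curv_ne i
  rw [(hT.chordCoord_arcPoint i s).2, mul_div_cancel₀ _ hk]
  rw [← hT.abs_turn_le_iff] at hs
  have := Real.cos_le_cos_of_nonneg_of_le_pi (abs_nonneg (T.turn i s))
    (by have := hT.halfAngle_lt i; have := Real.pi_pos; linarith) hs
  rw [Real.cos_abs] at this
  linarith

theorem Admissible.arcPoint_mem_strict (hT : T.Admissible) {i : Arc} {s : ℝ}
    (hs : s ∈ Ioo 0 (T.arcLen i)) :
    T.curv i * (T.chordCoord i (T.arcPoint i s)).im < 0 := by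
  have hk := hT.curv_ne i
  rw [(hT.chordCoord_arcPoint i s).2, mul_div_cancel₀ _ hk]
  rw [← hT.abs_turn_lt_iff] at hs
  have := Real.cos_lt_cos_of_nonneg_of_le_pi (abs_nonneg (T.turn i s))
    (by have := hT.halfAngle_lt i; have := Real.pi_pos; linarith) hs
  rw [Real.cos_abs] at this
  linarith

/-- A point of the circle carrying the component `i`, on the outer side of the chord, lies on the
component. -/
theorem Admissible.exists_arcPoint (hT : T.Admissible) {i : Arc} {z : ℂ}
    (h0 : T.circlePow i z = 0) (h1 : T.curv i * (T.chordCoord i z).im ≤ 0) :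
    ∃ s ∈ Icc 0 (T.arcLen i), T.arcPoint i s = z := by
  have hk := hT.curv_ne i
  have hkc : (T.curv i : ℂ) ≠ 0 := by exact_mod_cast hk
  have hc : conj (arcChord i) * arcChord i = 1 := by
    rw [mul_comm, Complex.mul_conj, Complex.normSq_eq_norm_sq, norm_arcChord]; simp
  set v : ℂ := Complex.I * T.curv i * (T.chordCoord i z - (1 / 2 + T.centerHeight i * Complex.I))
    with hv
  have hzc : T.chordCoord i z - (1 / 2 + T.centerHeight i * Complex.I) =
        (z - T.center i) * conj (arcChord i) := by
      unfold chordCoord center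
      linear_combination (1 / 2 + T.centerHeight i * Complex.I) * hc
  have hnv : ‖v‖ = 1 := by
    rw [hT.circlePow_eq, sub_eq_zero, Complex.normSq_eq_norm_sq] at h0
    have : ‖v‖ ^ 2 = 1 := by
      rw [hv, hzc]
      simp only [norm_mul, Complex.norm_I, RCLike.norm_conj, norm_arcChord, mul_one, one_mul,
        mul_pow, h0, Complex.norm_real, Real.norm_eq_abs, sq_abs]
      field_simp
    exact (pow_eq_one_iff_of_nonneg (norm_nonneg v) two_ne_zero).1 this
  have hexp : Complex.exp (v.arg * Complex.I) = v := by
    have := Complex.norm_mul_exp_arg_mul_I v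
    rwa [hnv, Complex.ofReal_one, one_mul] at this
  have hre : v.re = Real.cos (T.halfAngle i) - T.curv i * (T.chordCoord i z).im := by
    have h2 : T.centerHeight i * T.curv i = Real.cos (T.halfAngle i) := div_mul_cancel₀ _ hk
    rw [hv, ← h2]
    simp
    ring
  have hcos : Real.cos v.arg = v.re := by
    rw [Complex.cos_arg (by intro h; rw [h] at hnv; simp at hnv), hnv, div_one]
  have harg : |v.arg| ≤ T.halfAngle i := by
    by_contra hlt
    push Not at hlt
    have := Real.cos_lt_cos_of_nonneg_of_le_pi (hT.halfAngle_pos i).le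
      (Complex.abs_arg_le_pi v) hlt
    rw [Real.cos_abs, hcos, hre] at this
    linarith
  have hturn : T.turn i (T.arcLen i / 2 + v.arg / T.curv i) = v.arg := by
    unfold turn; field_simp; ring
  refine ⟨T.arcLen i / 2 + v.arg / T.curv i, ?_, ?_⟩
  · rw [← hT.abs_turn_le_iff, hturn]; exact harg
  · rw [hT.arcPoint_eq, normal, tangent_eq, hturn, hexp, hv, hzc]
    field_simp
    linear_combination (T.center i - z) * Complex.I ^ 2 * hc + (T.center i - z) * Complex.I_sq

/-! The circles carrying the four arcs, as seen from the table. -/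

theorem Admissible.centerHeight_bottom (hT : T.Admissible) : 0 < T.centerHeight .bottom :=
  div_pos (hT.cos_halfAngle_pos _) hT.kf_pos

/-- The bound on the curvature of the dispersing arcs makes them less than a quarter of a
circle. -/
theorem Admissible.centerHeight_lt (hT : T.Admissible) {i : Arc} (hi : i ≠ .bottom) :
    T.centerHeight i < -1 / 2 := by
  have hk : T.curv i = T.kd := by cases i <;> simp_all [curv]
  have h1 : T.centerHeight i < 0 :=
    div_neg_of_pos_of_neg (hT.cos_halfAngle_pos _) (by rw [hk]; exact hT.kd_neg)
  have h2 := hT.centerHeight_sq i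
  have h3 : 1 / 2 < 1 / T.curv i ^ 2 := by
    have := hT.kd_neg
    rw [hk]
    exact one_div_lt_one_div_of_lt (by nlinarith) hT.abs_kd_sq_lt
  nlinarith

/-- The part of the disc carrying a dispersing arc that lies on the inner side of the chord is
contained in an isosceles right triangle over the chord. -/
theorem Admissible.triangle (hT : T.Admissible) {i : Arc} (hi : i ≠ .bottom) {z : ℂ}
    (h0 : T.circlePow i z ≤ 0) (h1 : 0 < (T.chordCoord i z).im) :
    (T.chordCoord i z).im < (T.chordCoord i z).re ∧
      (T.chordCoord i z).im < 1 - (T.chordCoord i z).re := by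
  have ha := hT.centerHeight_lt hi
  unfold circlePow at h0
  set x := (T.chordCoord i z).re
  set y := (T.chordCoord i z).im
  have h2 : y ^ 2 + y < x * (1 - x) := by nlinarith
  constructor
  · by_contra hn
    nlinarith [sq_nonneg x, sq_nonneg (x-y)]
  · by_contra hn
    nlinarith [sq_nonneg (1-x), sq_nonneg (1-x-y)]

/-! ### The interior of the table -/

theorem Admissible.l_pos (hT : T.Admissible) : 0 < T.l :=
  lt_of_lt_of_le (one_div_pos.2 hT.kf_pos) hT.c2

/-- Length of a flat component. -/
def wallLen (T : Table) : Wall → ℝ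
  | .rightBottom => T.l
  | .rightEnd => T.h
  | .rightTop => T.l
  | .leftTop => T.l
  | .leftEnd => T.h
  | .leftBottom => T.l

/-- Coordinate on the plane that sends the flat component `w` to `[0, wallLen w]`, the table being
in the upper half-plane near the image. -/
def wallCoord (T : Table) (w : Wall) (z : ℂ) : ℂ := (z - T.wallStart w) * conj (wallTangent w)

theorem wallCoord_re (w : Wall) (z : ℂ) : (T.wallCoord w z).re =
    match w with
    | .rightBottom => z.re - 1
    | .rightEnd => z.im
    | .rightTop => 1 + T.l - z.re
    | .leftTop => - z.re
    | .leftEnd => T.h - z.im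
    | .leftBottom => z.re + T.l := by
  cases w <;> simp [wallCoord, wallStart, wallTangent]

theorem wallCoord_im (w : Wall) (z : ℂ) : (T.wallCoord w z).im =
    match w with
    | .rightBottom => z.im
    | .rightEnd => 1 + T.l - z.re
    | .rightTop => T.h - z.im
    | .leftTop => T.h - z.im
    | .leftEnd => z.re + T.l
    | .leftBottom => z.im := by
  cases w <;> simp [wallCoord, wallStart, wallTangent]

theorem norm_wallTangent (w : Wall) : ‖wallTangent w‖ = 1 := by cases w <;> simp [wallTangent]

theorem conj_mul_wallTangent (w : Wall) : conj (wallTangent w) * wallTangent w = 1 := by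
  rw [mul_comm, Complex.mul_conj, Complex.normSq_eq_norm_sq, norm_wallTangent]; simp

theorem wallStop_eq (w : Wall) : T.wallStop w - T.wallStart w = T.wallLen w * wallTangent w := by
  cases w <;> simp [wallStop, wallStart, wallLen, wallTangent]

theorem Admissible.wallLen_pos (hT : T.Admissible) (w : Wall) : 0 < T.wallLen w := by
  cases w <;> simp [wallLen, hT.h_pos, hT.l_pos]

theorem eq_wallStart_add (w : Wall) (z : ℂ) :
    z = T.wallStart w + T.wallCoord w z * wallTangent w := by
  have := conj_mul_wallTangent w
  unfold wallCoord
  linear_combination (T.wallStart w - z) * this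

theorem wallCoord_add_mul (w : Wall) (a : ℂ) :
    T.wallCoord w (T.wallStart w + a * wallTangent w) = a := by
  have := conj_mul_wallTangent w
  unfold wallCoord
  linear_combination a * this

theorem Admissible.mem_segment_iff (hT : T.Admissible) (w : Wall) (z : ℂ) :
    z ∈ segment ℝ (T.wallStart w) (T.wallStop w) ↔
      (T.wallCoord w z).im = 0 ∧ (T.wallCoord w z).re ∈ Icc 0 (T.wallLen w) := by
  have hl := hT.wallLen_pos w
  rw [segment_eq_image', mem_image, wallStop_eq]
  constructor
  · rintro ⟨t, ht, rfl⟩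
    have : T.wallCoord w (T.wallStart w + t • (T.wallLen w * wallTangent w)) =
        ((t * T.wallLen w : ℝ) : ℂ) := by
      rw [← wallCoord_add_mul w ((t * T.wallLen w : ℝ) : ℂ)]
      push_cast
      rw [Complex.real_smul, mul_assoc]
    rw [this]
    refine ⟨Complex.ofReal_im _, ?_⟩
    rw [Complex.ofReal_re]
    exact ⟨mul_nonneg ht.1 hl.le, mul_le_of_le_one_left hl.le ht.2⟩
  · rintro ⟨h1, h2, h3⟩
    refine ⟨(T.wallCoord w z).re / T.wallLen w, ⟨div_nonneg h2 hl.le, (div_le_one hl).2 h3⟩, ?_⟩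
    conv_rhs => rw [eq_wallStart_add (T := T) w z]
    have : T.wallCoord w z = ((T.wallCoord w z).re : ℂ) := by
      apply Complex.ext <;> simp [h1]
    have hl' : (T.wallLen w : ℂ) ≠ 0 := by exact_mod_cast hl.ne'
    rw [Complex.real_smul, this]
    push_cast
    simp only [Complex.ofReal_re]
    field_simp

theorem Admissible.mem_openSegment_iff (hT : T.Admissible) (w : Wall) (z : ℂ) :
    z ∈ openSegment ℝ (T.wallStart w) (T.wallStop w) ↔
      (T.wallCoord w z).im = 0 ∧ (T.wallCoord w z).re ∈ Ioo 0 (T.wallLen w) := by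
  have hl := hT.wallLen_pos w
  rw [openSegment_eq_image', mem_image, wallStop_eq]
  constructor
  · rintro ⟨t, ht, rfl⟩
    have : T.wallCoord w (T.wallStart w + t • (T.wallLen w * wallTangent w)) =
        ((t * T.wallLen w : ℝ) : ℂ) := by
      rw [← wallCoord_add_mul w ((t * T.wallLen w : ℝ) : ℂ)]
      push_cast
      rw [Complex.real_smul, mul_assoc]
    rw [this]
    refine ⟨Complex.ofReal_im _, ?_⟩
    rw [Complex.ofReal_re]
    exact ⟨mul_pos ht.1 hl, mul_lt_of_lt_one_left hl ht.2⟩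
  · rintro ⟨h1, h2, h3⟩
    refine ⟨(T.wallCoord w z).re / T.wallLen w, ⟨div_pos h2 hl, (div_lt_one hl).2 h3⟩, ?_⟩
    conv_rhs => rw [eq_wallStart_add (T := T) w z]
    have : T.wallCoord w z = ((T.wallCoord w z).re : ℂ) := by
      apply Complex.ext <;> simp [h1]
    have hl' : (T.wallLen w : ℂ) ≠ 0 := by exact_mod_cast hl.ne'
    rw [Complex.real_smul, this]
    push_cast
    simp only [Complex.ofReal_re]
    field_simp

/-- A point of a flat component lies in one of the closed strips. -/
theorem Admissible.wall_bounds (hT : T.Admissible) {w : Wall} {z : ℂ}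
    (hz : z ∈ segment ℝ (T.wallStart w) (T.wallStop w)) :
    0 ≤ z.im ∧ z.im ≤ T.h ∧ -T.l ≤ z.re ∧ z.re ≤ 1 + T.l ∧ (z.re ≤ 0 ∨ 1 ≤ z.re) ∧
      (z.im = 0 ∨ z.im = T.h ∨ z.re = -T.l ∨ z.re = 1 + T.l) := by
  have hh := hT.h_pos
  have hl := hT.l_pos
  rw [hT.mem_segment_iff, wallCoord_re, wallCoord_im] at hz
  cases w <;> obtain ⟨h1, h2, h3⟩ := hz <;> simp only [wallLen] at h1 h2 h3 <;>
    grind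

/-- A point of the focusing arc. -/
theorem Admissible.bottom_bounds (hT : T.Admissible) {s : ℝ} (hs : s ∈ Icc 0 (T.arcLen .bottom)) :
    (T.arcPoint .bottom s).im ≤ 0 ∧ 0 ≤ (T.arcPoint .bottom s).re ∧
      (T.arcPoint .bottom s).re ≤ 1 := by
  have h1 := hT.arcPoint_mem hs
  have h2 := hT.circlePow_arcPoint .bottom s
  have h3 := hT.centerHeight_bottom
  have h4 := hT.kf_pos
  simp only [circlePow, chordCoord_re, chordCoord_im, curv] at h1 h2
  have h5 : (T.arcPoint .bottom s).im ≤ 0 := by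
    by_contra hn; nlinarith
  refine ⟨h5, ?_, ?_⟩ <;> by_contra hn <;> nlinarith [mul_nonneg h3.le (neg_nonneg.2 h5)]

theorem Admissible.bottom_bounds_strict (hT : T.Admissible) {s : ℝ}
    (hs : s ∈ Ioo 0 (T.arcLen .bottom)) :
    (T.arcPoint .bottom s).im < 0 ∧ 0 < (T.arcPoint .bottom s).re ∧
      (T.arcPoint .bottom s).re < 1 := by
  have h1 := hT.arcPoint_mem_strict hs
  have h2 := hT.circlePow_arcPoint .bottom s
  have h3 := hT.centerHeight_bottom
  have h4 := hT.kf_pos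
  simp only [circlePow, chordCoord_re, chordCoord_im, curv] at h1 h2
  have h5 : (T.arcPoint .bottom s).im < 0 := by
    by_contra hn; nlinarith
  refine ⟨h5, ?_, ?_⟩ <;> by_contra hn <;> nlinarith [mul_pos h3 (neg_pos.2 h5)]

/-- A point in the relative interior of a dispersing arc. -/
theorem Admissible.chord_bounds_strict (hT : T.Admissible) {i : Arc} (hi : i ≠ .bottom) {s : ℝ}
    (hs : s ∈ Ioo 0 (T.arcLen i)) :
    0 < (T.chordCoord i (T.arcPoint i s)).im ∧
    (T.chordCoord i (T.arcPoint i s)).im < (T.chordCoord i (T.arcPoint i s)).re ∧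
    (T.chordCoord i (T.arcPoint i s)).im < 1 - (T.chordCoord i (T.arcPoint i s)).re := by
  have h1 := hT.arcPoint_mem_strict hs
  have hk : T.curv i < 0 := by
    rcases hT.curv_pos_or i with ⟨h, -⟩ | ⟨-, h⟩
    exacts [absurd h hi, h]
  have h2 : 0 < (T.chordCoord i (T.arcPoint i s)).im := by
    by_contra hn; nlinarith
  exact ⟨h2, hT.triangle hi (hT.circlePow_arcPoint i s).le h2⟩

theorem Admissible.disp_bounds_strict (hT : T.Admissible) {i : Arc} (hi : i ≠ .bottom) {s : ℝ}
    (hs : s ∈ Ioo 0 (T.arcLen i)) :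
    T.h < (T.arcPoint i s).im ∧ (T.arcPoint i s).im < T.h + 1 ∧ 0 < (T.arcPoint i s).re ∧
      (T.arcPoint i s).re < 1 := by
  have h := hT.chord_bounds_strict hi hs
  rw [chordCoord_re, chordCoord_im] at h
  cases i
  · exact absurd rfl hi
  all_goals
    simp only at h
    refine ⟨?_, ?_, ?_, ?_⟩ <;> linarith

theorem Admissible.disp_bounds (hT : T.Admissible) {i : Arc} (hi : i ≠ .bottom) {s : ℝ}
    (hs : s ∈ Icc 0 (T.arcLen i)) : T.h ≤ (T.arcPoint i s).im := by
  have h1 := hT.arcPoint_mem hs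
  have hk : T.curv i < 0 := by
    rcases hT.curv_pos_or i with ⟨h, -⟩ | ⟨-, h⟩
    exacts [absurd h hi, h]
  have h2 : 0 ≤ (T.chordCoord i (T.arcPoint i s)).im := by
    by_contra hn; nlinarith
  have h3 := hT.circlePow_arcPoint i s
  rcases h2.eq_or_lt with h0 | h0
  · rw [circlePow, ← h0] at h3
    have h4 : 0 ≤ (T.chordCoord i (T.arcPoint i s)).re := by nlinarith
    have h5 : (T.chordCoord i (T.arcPoint i s)).re ≤ 1 := by nlinarith
    rw [chordCoord_re] at h4 h5
    rw [chordCoord_im] at h0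
    cases i <;> simp only [ne_eq, not_true_eq_false] at h4 h5 h0 hi <;> linarith
  · have := hT.triangle hi h3.le h0
    rw [chordCoord_re, chordCoord_im] at this
    cases i <;> simp only [ne_eq, not_true_eq_false] at this hi <;> rw [chordCoord_im] at h0 <;>
      simp only at h0 <;> linarith

/-- The interior of the table: the open lens over the focusing arc, the open rectangle made of the
two strips and the region between them, and the open region enclosed by the dispersing arcs, the
first and the last one being glued to the rectangle along their chords. -/
def inside (T : Table) : Set ℂ :=
  {z | (z.im ≤ 0 ∧ T.circlePow .bottom z < 0) ∨
    (0 < z.im ∧ z.im < T.h ∧ -T.l < z.re ∧ z.re < 1 + T.l) ∨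
    (T.h ≤ z.im ∧ z.im < T.h + 1 ∧ 0 < z.re ∧ z.re < 1 ∧ ∀ i ≠ Arc.bottom, 0 < T.circlePow i z)}

theorem Admissible.lens_bounds (hT : T.Admissible) {z : ℂ} (h1 : z.im ≤ 0)
    (h2 : T.circlePow .bottom z < 0) : 0 < z.re ∧ z.re < 1 := by
  have h3 := hT.centerHeight_bottom
  simp only [circlePow, chordCoord_re, chordCoord_im] at h2
  constructor <;> by_contra hn <;> nlinarith [mul_nonneg h3.le (neg_nonneg.2 h1)]

theorem Admissible.circlePow_pos_of_im_eq (hT : T.Admissible) {i : Arc} (hi : i ≠ .bottom) {z : ℂ}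
    (h1 : z.im = T.h) (h2 : 0 < z.re) (h3 : z.re < 1) : 0 < T.circlePow i z := by
  by_contra hn
  have hc : 0 < (T.chordCoord i z).im := by
    rw [chordCoord_im]
    cases i <;> simp only [ne_eq, not_true_eq_false] at hi ⊢ <;> linarith
  have := hT.triangle hi (not_lt.1 hn) hc
  rw [chordCoord_re, chordCoord_im] at this
  cases i <;> simp only [ne_eq, not_true_eq_false] at hi this <;> linarith

theorem continuous_chordCoord (i : Arc) : Continuous (T.chordCoord i) := by
  unfold chordCoord; fun_prop

theorem continuous_circlePow (i : Arc) : Continuous (T.circlePow i) := by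
  have := T.continuous_chordCoord i
  unfold circlePow
  fun_prop

theorem continuous_wallCoord (w : Wall) : Continuous (T.wallCoord w) := by
  unfold wallCoord; fun_prop

instance : Finite Arc :=
  Finite.of_injective (fun i : Arc => match i with
    | .bottom => (0 : Fin 4) | .right => 1 | .top => 2 | .left => 3)
    (by intro a b; cases a <;> cases b <;> simp)

instance : Finite Wall :=
  Finite.of_injective (fun w : Wall => match w with
    | .rightBottom => (0 : Fin 6) | .rightEnd => 1 | .rightTop => 2 | .leftTop => 3
    | .leftEnd => 4 | .leftBottom => 5)
    (by intro a b; cases a <;> cases b <;> simp)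

theorem Admissible.isOpen_inside (hT : T.Admissible) : IsOpen T.inside := by
  have hh := hT.h_pos
  have hl := hT.l_pos
  have c1 : Continuous fun z : ℂ => z.im := Complex.continuous_im
  have c2 : Continuous fun z : ℂ => z.re := Complex.continuous_re
  have c3 := fun i => T.continuous_circlePow i
  rw [isOpen_iff_eventually]
  rintro z (⟨h1, h2⟩ | ⟨h1, h2, h3, h4⟩ | ⟨h1, h2, h3, h4, h5⟩)
  · obtain ⟨h3, h4⟩ := hT.lens_bounds h1 h2
    filter_upwards [c1.continuousAt.eventually_lt_const (show z.im < T.h by linarith),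
      c2.continuousAt.eventually_lt_const (show z.re < 1 + T.l by linarith),
      c2.continuousAt.eventually_const_lt (show -T.l < z.re by linarith),
      (c3 .bottom).continuousAt.eventually_lt_const h2] with z' a1 a2 a3 a4
    rcases le_or_gt z'.im 0 with h | h
    · exact Or.inl ⟨h, a4⟩
    · exact Or.inr (Or.inl ⟨h, a1, a3, a2⟩)
  · filter_upwards [c1.continuousAt.eventually_lt_const h2,
      c1.continuousAt.eventually_const_lt h1,
      c2.continuousAt.eventually_lt_const h4,
      c2.continuousAt.eventually_const_lt h3] with z' a1 a2 a3 a4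
    exact Or.inr (Or.inl ⟨a2, a1, a4, a3⟩)
  · have h6 : ∀ᶠ z' in 𝓝 z, ∀ i : Arc, i ≠ .bottom → 0 < T.circlePow i z' := by
      rw [eventually_all]
      intro i
      by_cases hi : i = .bottom
      · simp [hi]
      · filter_upwards [(c3 i).continuousAt.eventually_const_lt (h5 i hi)] with z' hz' _ using hz'
    filter_upwards [c1.continuousAt.eventually_lt_const h2,
      c1.continuousAt.eventually_const_lt (show 0 < z.im by linarith),
      c2.continuousAt.eventually_lt_const h4,
      c2.continuousAt.eventually_const_lt h3, h6] with z' a1 a2 a3 a4 a5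
    rcases lt_or_ge z'.im T.h with h | h
    · exact Or.inr (Or.inl ⟨a2, h, by linarith, by linarith⟩)
    · exact Or.inr (Or.inr ⟨h, a1, a4, a3, a5⟩)

theorem mem_boundary_iff (z : ℂ) : z ∈ T.boundary ↔
    (∃ i, ∃ s ∈ Icc 0 (T.arcLen i), T.arcPoint i s = z) ∨
      ∃ w, z ∈ segment ℝ (T.wallStart w) (T.wallStop w) := by
  simp [boundary]

theorem Admissible.inside_disjoint (hT : T.Admissible) {z : ℂ} (hz : z ∈ T.inside) :
    z ∉ T.boundary := by
  have hh := hT.h_pos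
  rw [mem_boundary_iff]
  rintro (⟨i, s, hs, rfl⟩ | ⟨w, hw⟩)
  · by_cases hi : i = .bottom
    · subst hi
      have h1 := hT.bottom_bounds hs
      have h2 := hT.circlePow_arcPoint .bottom s
      rcases hz with ⟨-, h⟩ | ⟨h, -⟩ | ⟨h, -⟩ <;> linarith
    · have h1 := hT.disp_bounds hi hs
      have h2 := hT.circlePow_arcPoint i s
      rcases hz with ⟨h, -⟩ | ⟨-, h, -⟩ | ⟨-, -, -, -, h⟩
      · linarith
      · linarith
      · exact (h i hi).ne' h2
  · obtain ⟨h1, h2, h3, h4, h5, h6⟩ := hT.wall_bounds hw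
    rcases hz with ⟨h, h'⟩ | ⟨a1, a2, a3, a4⟩ | ⟨a1, a2, a3, a4, -⟩
    · have := hT.lens_bounds h h'
      rcases h5 with h5 | h5 <;> linarith
    · rcases h6 with h | h | h | h <;> linarith
    · rcases h5 with h5 | h5 <;> linarith

/-- A limit of interior points is in the interior or on the boundary: equality in one of the
inequalities that define the interior gives a boundary point, or a point of one of the two chords
along which the pieces of the interior are glued. -/
theorem Admissible.closure_inside (hT : T.Admissible) {z : ℂ} (hz : z ∈ closure T.inside) :
    z ∈ T.inside ∨ z ∈ T.boundary := by
  have hh := hT.h_pos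
  have hl := hT.l_pos
  have c1 : Continuous fun z : ℂ => z.im := Complex.continuous_im
  have c2 : Continuous fun z : ℂ => z.re := Complex.continuous_re
  have c3 := fun i => T.continuous_circlePow i
  have hsub : closure T.inside ⊆ {z | z.im ≤ 0 ∧ T.circlePow .bottom z ≤ 0} ∪
      ({z | 0 ≤ z.im ∧ z.im ≤ T.h ∧ -T.l ≤ z.re ∧ z.re ≤ 1 + T.l} ∪
      {z | T.h ≤ z.im ∧ z.im ≤ T.h + 1 ∧ 0 ≤ z.re ∧ z.re ≤ 1 ∧
        ∀ i, i ≠ Arc.bottom → 0 ≤ T.circlePow i z}) := by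
    apply closure_minimal
    · rintro z (⟨h1, h2⟩ | ⟨h1, h2, h3, h4⟩ | ⟨h1, h2, h3, h4, h5⟩)
      · exact Or.inl ⟨h1, h2.le⟩
      · exact Or.inr (Or.inl ⟨h1.le, h2.le, h3.le, h4.le⟩)
      · exact Or.inr (Or.inr ⟨h1, h2.le, h3.le, h4.le, fun i hi => (h5 i hi).le⟩)
    · refine ((isClosed_le c1 continuous_const).inter
        (isClosed_le (c3 _) continuous_const)).union (IsClosed.union ?_ ?_)
      · exact (isClosed_le continuous_const c1).inter ((isClosed_le c1 continuous_const).inter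
          ((isClosed_le continuous_const c2).inter (isClosed_le c2 continuous_const)))
      · refine (isClosed_le continuous_const c1).inter ((isClosed_le c1 continuous_const).inter
          ((isClosed_le continuous_const c2).inter ((isClosed_le c2 continuous_const).inter ?_)))
        have : {z | ∀ i, i ≠ Arc.bottom → 0 ≤ T.circlePow i z} =
            ⋂ i, ⋂ (_ : i ≠ Arc.bottom), {z | 0 ≤ T.circlePow i z} := by ext; simp
        show IsClosed {z | ∀ i, i ≠ Arc.bottom → 0 ≤ T.circlePow i z}
        exact this ▸ isClosed_iInter fun i => isClosed_iInter fun _ =>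
          isClosed_le continuous_const (c3 i)
  have arc : ∀ i, T.circlePow i z = 0 → T.curv i * (T.chordCoord i z).im ≤ 0 →
      z ∈ T.inside ∨ z ∈ T.boundary := fun i h h' =>
    Or.inr ((mem_boundary_iff z).2 (Or.inl ⟨i, hT.exists_arcPoint h h'⟩))
  have wall : ∀ w, (T.wallCoord w z).im = 0 → (T.wallCoord w z).re ∈ Icc 0 (T.wallLen w) →
      z ∈ T.inside ∨ z ∈ T.boundary := fun w h h' =>
    Or.inr ((mem_boundary_iff z).2 (Or.inr ⟨w, (hT.mem_segment_iff w z).2 ⟨h, h'⟩⟩))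
  simp only [wallCoord_re, wallCoord_im] at wall
  rcases hsub hz with ⟨h1, h2⟩ | ⟨h1, h2, h3, h4⟩ | ⟨h1, h2, h3, h4, h5⟩
  · rcases h2.lt_or_eq with h2 | h2
    · exact Or.inl (Or.inl ⟨h1, h2⟩)
    · refine arc .bottom h2 ?_
      rw [chordCoord_im]
      exact mul_nonpos_of_nonneg_of_nonpos hT.kf_pos.le h1
  · rcases h1.eq_or_lt with h1 | h1
    · rcases le_or_gt z.re 0 with h | h
      · exact wall .leftBottom h1.symm ⟨by linarith, by simp only [wallLen]; linarith⟩
      rcases le_or_gt 1 z.re with h' | h'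
      · exact wall .rightBottom h1.symm ⟨by linarith, by simp only [wallLen]; linarith⟩
      · refine Or.inl (Or.inl ⟨h1.symm.le, ?_⟩)
        simp only [circlePow, chordCoord_re, chordCoord_im, ← h1]
        nlinarith
    rcases h2.eq_or_lt with h2 | h2
    · rcases le_or_gt z.re 0 with h | h
      · exact wall .leftTop (by simp [h2]) ⟨by linarith, by simp only [wallLen]; linarith⟩
      rcases le_or_gt 1 z.re with h' | h'
      · exact wall .rightTop (by simp [h2]) ⟨by linarith, by simp only [wallLen]; linarith⟩
      · exact Or.inl (Or.inr (Or.inr ⟨h2.ge, by linarith, h, h',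
          fun i hi => hT.circlePow_pos_of_im_eq hi h2 h h'⟩))
    rcases h3.eq_or_lt with h3 | h3
    · exact wall .leftEnd (by simp [← h3]) ⟨by linarith, by simp only [wallLen]; linarith⟩
    rcases h4.eq_or_lt with h4 | h4
    · exact wall .rightEnd (by simp [h4]) ⟨by linarith, by simp only [wallLen]; linarith⟩
    · exact Or.inl (Or.inr (Or.inl ⟨h1, h2, h3, h4⟩))
  · have hci : ∀ i, i ≠ Arc.bottom → 0 ≤ (T.chordCoord i z).im ∧ 0 ≤ (T.chordCoord i z).re ∧
        (T.chordCoord i z).re ≤ 1 := by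
      intro i hi
      rw [chordCoord_im, chordCoord_re]
      cases i <;> simp only [ne_eq, not_true_eq_false] at hi ⊢ <;>
        refine ⟨?_, ?_, ?_⟩ <;> linarith
    by_cases hall : ∀ i, i ≠ Arc.bottom → 0 < T.circlePow i z
    · have hci' : ∀ i, i ≠ Arc.bottom → 0 < (T.chordCoord i z).im := by
        intro i hi
        obtain ⟨a1, a2, a3⟩ := hci i hi
        rcases a1.eq_or_lt with h | h
        · have := hall i hi
          rw [circlePow, ← h] at this
          nlinarith
        · exact h
      have b1 := hci' .right (by simp)
      have b2 := hci' .top (by simp)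
      have b3 := hci' .left (by simp)
      rw [chordCoord_im] at b1 b2 b3
      simp only at b1 b2 b3
      exact Or.inl (Or.inr (Or.inr ⟨h1, by linarith, by linarith, by linarith, hall⟩))
    · push Not at hall
      obtain ⟨i, hi, h⟩ := hall
      refine arc i (le_antisymm h (h5 i hi)) ?_
      have hk : T.curv i < 0 := by
        rcases hT.curv_pos_or i with ⟨h, -⟩ | ⟨-, h⟩
        exacts [absurd h hi, h]
      exact mul_nonpos_of_nonpos_of_nonneg hk.le (hci i hi).1

theorem Admissible.isBounded_inside (hT : T.Admissible) : Bornology.IsBounded T.inside := by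
  have hh := hT.h_pos
  have hl := hT.l_pos
  have ha := hT.centerHeight_bottom
  have hsub : T.inside ⊆ Icc (-T.l) (1 + T.l) ×ℂ Icc (-(1 + 2 * T.centerHeight .bottom)) (T.h + 1) := by
    rintro z (⟨h1, h2⟩ | ⟨h1, h2, h3, h4⟩ | ⟨h1, h2, h3, h4, h5⟩)
    · have := hT.lens_bounds h1 h2
      simp only [circlePow, chordCoord_re, chordCoord_im] at h2
      refine ⟨⟨by linarith, by linarith⟩, ⟨?_, by linarith⟩⟩
      show _ ≤ z.im
      by_contra hn
      nlinarith
    · exact ⟨⟨h3.le, h4.le⟩, ⟨by linarith, by linarith⟩⟩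
    · exact ⟨⟨by linarith, by linarith⟩, ⟨by linarith, by linarith⟩⟩
  exact ((Metric.isBounded_Icc _ _).reProdIm (Metric.isBounded_Icc _ _)).subset hsub

theorem continuous_turn (i : Arc) : Continuous (T.turn i) := by unfold turn; fun_prop

theorem continuous_tangent (i : Arc) : Continuous (T.tangent i) := by
  have := T.continuous_turn i
  have h : T.tangent i = fun s => arcChord i * Complex.exp ((T.turn i s : ℝ) * Complex.I) := rfl
  rw [h]; fun_prop

theorem continuous_normal (i : Arc) : Continuous (T.normal i) :=
  continuous_const.mul (T.continuous_tangent i)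

theorem continuous_arcPoint (i : Arc) : Continuous (T.arcPoint i) := by
  have h : T.arcPoint i = fun s => T.arcStart i + (T.tangent i s - T.tangent i 0) /
    (T.curv i * Complex.I) := rfl
  have := T.continuous_tangent i
  rw [h]; fun_prop

theorem isClosed_boundary (T : Table) : IsClosed T.boundary := by
  refine (isClosed_iUnion_of_finite fun i => ?_).union (isClosed_iUnion_of_finite fun w => ?_)
  · exact (isCompact_Icc.image (T.continuous_arcPoint i)).isClosed
  · rw [segment_eq_image']
    exact (isCompact_Icc.image (by fun_prop)).isClosed

/-! ### The interior near a boundary point -/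

/-- The dispersing arcs do not enter each other's discs: on the table, these discs are contained in
triangles with disjoint interiors, one for each arc. -/
theorem Admissible.circlePow_other (hT : T.Admissible) {i j : Arc} (hi : i ≠ .bottom)
    (hj : j ≠ .bottom) (hij : j ≠ i) {s : ℝ} (hs : s ∈ Ioo 0 (T.arcLen i)) :
    0 < T.circlePow j (T.arcPoint i s) := by
  by_contra hn
  have h1 := hT.chord_bounds_strict hi hs
  have h2 := hT.disp_bounds_strict hi hs
  have hc : 0 < (T.chordCoord j (T.arcPoint i s)).im := by
    rw [chordCoord_im]
    cases j <;> simp only [ne_eq, not_true_eq_false] at hj ⊢ <;> linarith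
  have h3 := hT.triangle hj (not_lt.1 hn) hc
  rw [chordCoord_re, chordCoord_im] at h1 h3
  cases i <;> cases j <;> simp only [ne_eq, not_true_eq_false] at hi hj hij h1 h3 <;> linarith

/-- Near the relative interior of a curved component, the interior of the table is one side of the
circle. -/
theorem Admissible.inside_near_arc (hT : T.Admissible) {i : Arc} {s : ℝ}
    (hs : s ∈ Ioo 0 (T.arcLen i)) :
    ∀ᶠ z in 𝓝 (T.arcPoint i s), z ∈ T.inside ↔ T.curv i * T.circlePow i z < 0 := by
  have hh := hT.h_pos
  have c1 : Continuous fun z : ℂ => z.im := Complex.continuous_im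
  have c2 : Continuous fun z : ℂ => z.re := Complex.continuous_re
  by_cases hi : i = .bottom
  · subst hi
    have hb := hT.bottom_bounds_strict hs
    filter_upwards [c1.continuousAt.eventually_lt_const hb.1] with z hz
    have hk : 0 < T.curv .bottom := hT.kf_pos
    have hiff : T.curv .bottom * T.circlePow .bottom z < 0 ↔ T.circlePow .bottom z < 0 :=
      ⟨fun h => by by_contra hn; nlinarith, fun h => mul_neg_of_pos_of_neg hk h⟩
    rw [hiff]
    constructor
    · rintro (⟨-, h⟩ | ⟨h, -⟩ | ⟨h, -⟩)
      · exact h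
      · linarith
      · linarith
    · exact fun h => Or.inl ⟨hz.le, h⟩
  · have hb := hT.disp_bounds_strict hi hs
    have hk : T.curv i < 0 := by
      rcases hT.curv_pos_or i with ⟨h, -⟩ | ⟨-, h⟩
      exacts [absurd h hi, h]
    have h6 : ∀ᶠ z' in 𝓝 (T.arcPoint i s), ∀ j : Arc, j ≠ .bottom → j ≠ i →
        0 < T.circlePow j z' := by
      rw [eventually_all]
      intro j
      by_cases hj : j ≠ .bottom ∧ j ≠ i
      · filter_upwards [(T.continuous_circlePow j).continuousAt.eventually_const_lt
          (hT.circlePow_other hi hj.1 hj.2 hs)] with z' hz' _ _ using hz'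
      · exact Eventually.of_forall fun z h1 h2 => absurd ⟨h1, h2⟩ hj
    filter_upwards [c1.continuousAt.eventually_const_lt hb.1,
      c1.continuousAt.eventually_lt_const hb.2.1, c2.continuousAt.eventually_const_lt hb.2.2.1,
      c2.continuousAt.eventually_lt_const hb.2.2.2, h6] with z a1 a2 a3 a4 a5
    constructor
    · rintro (⟨h, -⟩ | ⟨-, h, -⟩ | ⟨-, -, -, -, h⟩)
      · linarith
      · linarith
      · exact mul_neg_of_neg_of_pos hk (h i hi)
    · intro h
      refine Or.inr (Or.inr ⟨a1.le, a2, a3, a4, fun j hj => ?_⟩)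
      by_cases hji : j = i
      · subst hji; by_contra hn; nlinarith
      · exact a5 j hj hji

/-- Near the relative interior of a flat component, the interior of the table is a half-plane. -/
theorem Admissible.inside_near_wall (hT : T.Admissible) {w : Wall} {q : ℂ}
    (hq : q ∈ openSegment ℝ (T.wallStart w) (T.wallStop w)) :
    ∀ᶠ z in 𝓝 q, z ∈ T.inside ↔ 0 < (T.wallCoord w z).im := by
  have hh := hT.h_pos
  have hl := hT.l_pos
  have c1 : Continuous fun z => (T.wallCoord w z).im :=
    Complex.continuous_im.comp (T.continuous_wallCoord w)
  have c2 : Continuous fun z => (T.wallCoord w z).re :=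
    Complex.continuous_re.comp (T.continuous_wallCoord w)
  rw [hT.mem_openSegment_iff] at hq
  obtain ⟨h1, h2, h3⟩ := hq
  filter_upwards [c1.continuousAt.eventually_const_lt (show -T.h < (T.wallCoord w q).im by linarith),
    c1.continuousAt.eventually_lt_const (show (T.wallCoord w q).im < T.h by linarith),
    c1.continuousAt.eventually_const_lt (show -T.l < (T.wallCoord w q).im by linarith),
    c1.continuousAt.eventually_lt_const (show (T.wallCoord w q).im < T.l by linarith),
    c2.continuousAt.eventually_const_lt h2, c2.continuousAt.eventually_lt_const h3]
    with z a1 a2 a3 a4 a5 a6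
  clear h1 h2 h3
  rw [wallCoord_im] at a1 a2 a3 a4 ⊢
  rw [wallCoord_re] at a5 a6
  constructor
  · rintro (⟨h, h'⟩ | ⟨b1, b2, b3, b4⟩ | ⟨b1, b2, b3, b4, -⟩)
    · have := hT.lens_bounds h h'
      cases w <;> simp only [wallLen] at a1 a2 a3 a4 a5 a6 ⊢ <;> linarith
    · cases w <;> simp only at a1 a2 a3 a4 a5 ⊢ <;> linarith
    · cases w <;> simp only [wallLen] at a1 a2 a3 a4 a5 a6 ⊢ <;> linarith
  · intro h
    refine Or.inr (Or.inl ?_)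
    cases w <;> simp only [wallLen] at a1 a2 a3 a4 a5 a6 h <;>
      refine ⟨?_, ?_, ?_, ?_⟩ <;> linarith

/-! ### Rays leaving the boundary -/

theorem Admissible.circlePow_ray (hT : T.Admissible) (i : Arc) (s r : ℝ) (u : ℂ) :
    T.curv i * T.circlePow i (T.arcPoint i s + r * u) =
      r * (T.curv i * r * Complex.normSq u - 2 * (u * conj (T.normal i s)).re) := by
  have hk := hT.curv_ne i
  have hn : Complex.normSq (T.normal i s) = 1 := by
    rw [Complex.normSq_eq_norm_sq, norm_normal]; norm_num
  have h : T.arcPoint i s + r * u - T.center i = r * u - T.normal i s / T.curv i := by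
    rw [hT.arcPoint_eq]; ring
  rw [hT.circlePow_eq, h, Complex.normSq_sub, Complex.normSq_div, Complex.normSq_mul,
    Complex.normSq_ofReal, Complex.normSq_ofReal, hn, map_div₀, Complex.conj_ofReal,
    ← mul_div_assoc, Complex.div_ofReal_re, mul_assoc (r : ℂ), Complex.re_ofReal_mul]
  field_simp
  ring

/-- Rays leaving a curved component inwards run in the interior for a short time, locally uniformly
in the ray. -/
theorem Admissible.arc_inward (hT : T.Admissible) {P : Type*} [TopologicalSpace P] {p₀ : P}
    {i : Arc} {s : P → ℝ} {u : P → ℂ} (hs : ContinuousAt s p₀) (hu : ContinuousAt u p₀)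
    (h0 : s p₀ ∈ Ioo 0 (T.arcLen i)) (h : 0 < (u p₀ * conj (T.normal i (s p₀))).re) :
    ∀ᶠ x : P × ℝ in 𝓝 p₀ ×ˢ 𝓝[>] 0, T.arcPoint i (s x.1) + x.2 * u x.1 ∈ T.inside := by
  have hle : 𝓝 p₀ ×ˢ 𝓝[>] (0 : ℝ) ≤ 𝓝 (p₀, (0 : ℝ)) := by
    rw [nhds_prod_eq]; exact Filter.prod_mono le_rfl nhdsWithin_le_nhds
  have hs' : ContinuousAt (fun x : P × ℝ => s x.1) (p₀, 0) :=
    ContinuousAt.comp (f := Prod.fst) (x := (p₀, (0 : ℝ))) hs continuousAt_fst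
  have hu' : ContinuousAt (fun x : P × ℝ => u x.1) (p₀, 0) :=
    ContinuousAt.comp (f := Prod.fst) (x := (p₀, (0 : ℝ))) hu continuousAt_fst
  have hn' : ContinuousAt (fun x : P × ℝ => T.normal i (s x.1)) (p₀, 0) :=
    (T.continuous_normal i).continuousAt.comp hs'
  have hp' : ContinuousAt (fun x : P × ℝ => T.arcPoint i (s x.1) + x.2 * u x.1) (p₀, 0) :=
    ((T.continuous_arcPoint i).continuousAt.comp hs').add
      ((Complex.continuous_ofReal.comp continuous_snd).continuousAt.mul hu')
  have h1 : ∀ᶠ x : P × ℝ in 𝓝 p₀ ×ˢ 𝓝[>] 0, (T.arcPoint i (s x.1) + x.2 * u x.1 ∈ T.inside ↔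
      T.curv i * T.circlePow i (T.arcPoint i (s x.1) + x.2 * u x.1) < 0) := by
    have := hT.inside_near_arc h0
    have h2 : Tendsto (fun x : P × ℝ => T.arcPoint i (s x.1) + x.2 * u x.1) (𝓝 (p₀, 0))
        (𝓝 (T.arcPoint i (s p₀))) := by
      have := hp'.tendsto
      simpa using this
    exact (h2.mono_left hle).eventually this
  have hc : ContinuousAt (fun x : P × ℝ => T.curv i * x.2 * Complex.normSq (u x.1)
      - 2 * (u x.1 * conj (T.normal i (s x.1))).re) (p₀, 0) := by
    refine ((continuous_const.mul continuous_snd).continuousAt.mul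
      (Complex.continuous_normSq.continuousAt.comp hu')).sub (continuousAt_const.mul ?_)
    exact Complex.continuous_re.continuousAt.comp
      (hu'.mul (Complex.continuous_conj.continuousAt.comp hn'))
  have h3 := hle (hc.eventually_lt_const (show _ < (0 : ℝ) by simp only [mul_zero, zero_mul]; linarith))
  have h4 : ∀ᶠ x : P × ℝ in 𝓝 p₀ ×ˢ 𝓝[>] 0, 0 < x.2 :=
    Filter.tendsto_snd.eventually self_mem_nhdsWithin
  filter_upwards [h1, h3, h4] with x a1 a3 a4
  rw [a1, hT.circlePow_ray]
  exact mul_neg_of_pos_of_neg a4 a3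

theorem Admissible.arc_outward (hT : T.Admissible) {i : Arc} {s : ℝ} {u : ℂ}
    (h0 : s ∈ Ioo 0 (T.arcLen i)) (h : (u * conj (T.normal i s)).re < 0) :
    ∀ᶠ r : ℝ in 𝓝[>] 0, T.arcPoint i s + r * u ∉ T.inside := by
  have hp : Continuous fun r : ℝ => T.arcPoint i s + r * u := by fun_prop
  have h1 : ∀ᶠ r : ℝ in 𝓝[>] 0, (T.arcPoint i s + r * u ∈ T.inside ↔
      T.curv i * T.circlePow i (T.arcPoint i s + r * u) < 0) := by
    have h2 : Tendsto (fun r : ℝ => T.arcPoint i s + r * u) (𝓝 0) (𝓝 (T.arcPoint i s)) := by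
      simpa using hp.tendsto 0
    exact (h2.mono_left nhdsWithin_le_nhds).eventually (hT.inside_near_arc h0)
  have hc : Continuous fun r : ℝ => T.curv i * r * Complex.normSq u
      - 2 * (u * conj (T.normal i s)).re := by fun_prop
  have h3 : ∀ᶠ r : ℝ in 𝓝[>] 0, 0 < T.curv i * r * Complex.normSq u
      - 2 * (u * conj (T.normal i s)).re :=
    nhdsWithin_le_nhds (hc.continuousAt.eventually_const_lt (by simp only [mul_zero, zero_mul]; linarith))
  filter_upwards [h1, h3, self_mem_nhdsWithin] with r a1 a3 a4
  rw [a1, hT.circlePow_ray, not_lt]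
  exact (mul_pos a4 a3).le

theorem wallCoord_ray (w : Wall) (q u : ℂ) (r : ℝ) :
    (T.wallCoord w (q + r * u)).im = (T.wallCoord w q).im + r * (u * conj (wallTangent w)).im := by
  rw [← Complex.im_ofReal_mul, ← Complex.add_im]
  unfold wallCoord
  congr 1; ring

/-- Rays leaving a flat component inwards run in the interior for a short time, locally uniformly
in the ray. -/
theorem Admissible.wall_inward (hT : T.Admissible) {P : Type*} [TopologicalSpace P] {p₀ : P}
    {w : Wall} {q u : P → ℂ} (hq : ContinuousAt q p₀) (hu : ContinuousAt u p₀)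
    (h0 : ∀ᶠ p in 𝓝 p₀, q p ∈ openSegment ℝ (T.wallStart w) (T.wallStop w))
    (h : 0 < (u p₀ * conj (wallTangent w)).im) :
    ∀ᶠ x : P × ℝ in 𝓝 p₀ ×ˢ 𝓝[>] 0, q x.1 + x.2 * u x.1 ∈ T.inside := by
  have hle : 𝓝 p₀ ×ˢ 𝓝[>] (0 : ℝ) ≤ 𝓝 (p₀, (0 : ℝ)) := by
    rw [nhds_prod_eq]; exact Filter.prod_mono le_rfl nhdsWithin_le_nhds
  have hq' : ContinuousAt (fun x : P × ℝ => q x.1) (p₀, 0) :=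
    ContinuousAt.comp (f := Prod.fst) (x := (p₀, (0 : ℝ))) hq continuousAt_fst
  have hu' : ContinuousAt (fun x : P × ℝ => u x.1) (p₀, 0) :=
    ContinuousAt.comp (f := Prod.fst) (x := (p₀, (0 : ℝ))) hu continuousAt_fst
  have hp' : ContinuousAt (fun x : P × ℝ => q x.1 + x.2 * u x.1) (p₀, 0) :=
    hq'.add ((Complex.continuous_ofReal.comp continuous_snd).continuousAt.mul hu')
  have h1 : ∀ᶠ x : P × ℝ in 𝓝 p₀ ×ˢ 𝓝[>] 0, (q x.1 + x.2 * u x.1 ∈ T.inside ↔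
      0 < (T.wallCoord w (q x.1 + x.2 * u x.1)).im) := by
    have h2 : Tendsto (fun x : P × ℝ => q x.1 + x.2 * u x.1) (𝓝 (p₀, 0)) (𝓝 (q p₀)) := by
      simpa using hp'.tendsto
    exact (h2.mono_left hle).eventually (hT.inside_near_wall h0.self_of_nhds)
  have hc : ContinuousAt (fun x : P × ℝ => (u x.1 * conj (wallTangent w)).im) (p₀, 0) :=
    Complex.continuous_im.continuousAt.comp (hu'.mul continuousAt_const)
  have h3 := hle (hc.eventually_const_lt h)
  have h4 : ∀ᶠ x : P × ℝ in 𝓝 p₀ ×ˢ 𝓝[>] 0, 0 < x.2 :=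
    Filter.tendsto_snd.eventually self_mem_nhdsWithin
  have h5 : ∀ᶠ x : P × ℝ in 𝓝 p₀ ×ˢ 𝓝[>] 0,
      q x.1 ∈ openSegment ℝ (T.wallStart w) (T.wallStop w) := Filter.tendsto_fst.eventually h0
  filter_upwards [h1, h3, h4, h5] with x a1 a3 a4 a5
  rw [a1, wallCoord_ray, ((hT.mem_openSegment_iff w _).1 a5).1, zero_add]
  exact mul_pos a4 a3

theorem Admissible.wall_outward (hT : T.Admissible) {w : Wall} {q u : ℂ}
    (h0 : q ∈ openSegment ℝ (T.wallStart w) (T.wallStop w))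
    (h : (u * conj (wallTangent w)).im ≤ 0) :
    ∀ᶠ r : ℝ in 𝓝[>] 0, q + r * u ∉ T.inside := by
  have hp : Continuous fun r : ℝ => q + r * u := by fun_prop
  have h2 : Tendsto (fun r : ℝ => q + r * u) (𝓝 0) (𝓝 q) := by
    simpa using hp.tendsto 0
  have h1 := (h2.mono_left (nhdsWithin_le_nhds (s := Ioi 0))).eventually (hT.inside_near_wall h0)
  filter_upwards [h1, self_mem_nhdsWithin] with r a1 a4
  rw [a1, wallCoord_ray, ((hT.mem_openSegment_iff w _).1 h0).1, zero_add, not_lt]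
  exact mul_nonpos_of_nonneg_of_nonpos (le_of_lt a4) h

/-! ### The first hit -/

/-- The ray from `q` in direction `u` starts in the interior of the table. -/
def Outgoing (T : Table) (q u : ℂ) : Prop := ∀ᶠ r : ℝ in 𝓝[>] 0, q + r * u ∈ T.inside

theorem FirstHit.unique {q u : ℂ} {t t' : ℝ} (h : T.FirstHit q u t) (h' : T.FirstHit q u t') :
    t = t' := by
  rcases lt_trichotomy t t' with hl | hl | hl
  · exact absurd h.2.1 (h'.2.2 t ⟨h.1, hl⟩)
  · exact hl
  · exact absurd h'.2.1 (h.2.2 t' ⟨h'.1, hl⟩)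

theorem Admissible.stays_of_disjoint (hT : T.Admissible) {q u : ℂ} (ho : T.Outgoing q u)
    {S : Set ℝ} (hS : IsPreconnected S) (hS0 : S ∈ 𝓝[>] (0 : ℝ))
    (hb : ∀ r ∈ S, q + r * u ∉ T.boundary) : ∀ r ∈ S, q + r * u ∈ T.inside := by
  have hc : Continuous fun r : ℝ => q + r * u := by fun_prop
  have hopen : IsOpen {r : ℝ | q + r * u ∈ T.inside} := hT.isOpen_inside.preimage hc
  have hne : (S ∩ {r : ℝ | q + r * u ∈ T.inside}).Nonempty := by
    have : ∀ᶠ r : ℝ in 𝓝[>] 0, r ∈ S ∩ {r : ℝ | q + r * u ∈ T.inside} := by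
      filter_upwards [ho, hS0] with r h1 h2 using ⟨h2, h1⟩
    exact this.exists
  refine hS.subset_of_closure_inter_subset hopen hne ?_
  rintro r ⟨hr1, hr2⟩
  have hr3 : q + r * u ∈ closure T.inside :=
    closure_mono (image_preimage_subset _ _)
      (image_closure_subset_closure_image hc (mem_image_of_mem _ hr1))
  exact (hT.closure_inside hr3).resolve_right (hb r hr2)

/-- Up to its first hit a ray that starts in the interior stays there. -/
theorem Admissible.stays (hT : T.Admissible) {q u : ℂ} (ho : T.Outgoing q u) {t : ℝ}
    (ht : T.FirstHit q u t) : ∀ r ∈ Ioo 0 t, q + r * u ∈ T.inside :=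
  hT.stays_of_disjoint ho isPreconnected_Ioo (Ioo_mem_nhdsGT ht.1) ht.2.2

theorem Admissible.exists_firstHit (hT : T.Admissible) {q u : ℂ} (ho : T.Outgoing q u)
    (hu : u ≠ 0) : ∃ t, T.FirstHit q u t := by
  have hc : Continuous fun r : ℝ => q + r * u := by fun_prop
  obtain ⟨ε, hε, hin⟩ := (mem_nhdsGT_iff_exists_Ioo_subset).1 ho
  have hex : ∃ t : ℝ, 0 < t ∧ q + t * u ∈ T.boundary := by
    by_contra hn
    push Not at hn
    have hall := hT.stays_of_disjoint ho isPreconnected_Ioi self_mem_nhdsWithin hn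
    obtain ⟨R, hR⟩ := hT.isBounded_inside.subset_closedBall q
    have hu' : 0 < ‖u‖ := norm_pos_iff.2 hu
    have h1 := hR (hall ((|R| + 1) / ‖u‖) (by simp only [mem_Ioi]; positivity))
    rw [Metric.mem_closedBall, dist_eq_norm, add_sub_cancel_left, norm_mul, Complex.norm_real,
      Real.norm_eq_abs, abs_of_pos (by positivity), div_mul_cancel₀ _ hu'.ne'] at h1
    linarith [le_abs_self R]
  obtain ⟨t₀, ht₀, hb₀⟩ := hex
  set B : Set ℝ := {t | ε ≤ t ∧ q + t * u ∈ T.boundary} with hB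
  have hlow : ∀ t : ℝ, 0 < t → q + t * u ∈ T.boundary → ε ≤ t := fun t h1 h2 => by
    by_contra hlt
    exact hT.inside_disjoint (hin ⟨h1, not_le.1 hlt⟩) h2
  have hBc : IsClosed B :=
    (isClosed_le continuous_const continuous_id).inter (T.isClosed_boundary.preimage hc)
  have hBb : BddBelow B := ⟨ε, fun t ht => ht.1⟩
  have hmem := hBc.csInf_mem ⟨t₀, hlow t₀ ht₀ hb₀, hb₀⟩ hBb
  refine ⟨sInf B, lt_of_lt_of_le hε hmem.1, hmem.2, fun r hr hrb => ?_⟩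
  exact absurd (csInf_le hBb ⟨hlow r hr.1 hrb, hrb⟩) (not_le.2 hr.2)

/-- A hit seen backwards in time: the particle comes from the interior. -/
theorem Admissible.outgoing_rev (hT : T.Admissible) {q u : ℂ} (ho : T.Outgoing q u) {t : ℝ}
    (ht : T.FirstHit q u t) : T.Outgoing (q + t * u) (-u) := by
  filter_upwards [Ioo_mem_nhdsGT ht.1] with r hr
  have := hT.stays ho ht (t - r) ⟨by linarith [hr.2], by linarith [hr.1]⟩
  convert this using 1
  push_cast
  ring

theorem Outgoing.not_eventually {q u : ℂ} (ho : T.Outgoing q u)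
    (h : ∀ᶠ r : ℝ in 𝓝[>] 0, q + r * u ∉ T.inside) : False := by
  obtain ⟨r, h1, h2⟩ := (Filter.Eventually.and ho h).exists
  exact h2 h1

/-- Collisions with the relative interior of a flat component are transversal. -/
theorem Admissible.wall_hit (hT : T.Admissible) {q u : ℂ} (ho : T.Outgoing q u) {t : ℝ}
    (ht : T.FirstHit q u t) {w : Wall}
    (hw : q + t * u ∈ openSegment ℝ (T.wallStart w) (T.wallStop w)) :
    (u * conj (wallTangent w)).im < 0 := by
  by_contra hn
  refine (hT.outgoing_rev ho ht).not_eventually (hT.wall_outward hw ?_)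
  rw [neg_mul, Complex.neg_im]
  linarith

theorem reflect_mul_conj (w : Wall) (u : ℂ) :
    (reflect (wallTangent w) u * conj (wallTangent w)).im = -(u * conj (wallTangent w)).im := by
  cases w <;> simp [reflect, wallTangent]

theorem Admissible.outgoing_reflect (hT : T.Admissible) {q u : ℂ} (ho : T.Outgoing q u) {t : ℝ}
    (ht : T.FirstHit q u t) {w : Wall}
    (hw : q + t * u ∈ openSegment ℝ (T.wallStart w) (T.wallStop w)) :
    T.Outgoing (q + t * u) (reflect (wallTangent w) u) := by
  have h := hT.wall_inward (P := Unit) (p₀ := ()) (q := fun _ => q + t * u)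
    (u := fun _ => reflect (wallTangent w) u) continuousAt_const continuousAt_const
    (Eventually.of_forall fun _ => hw)
    (by rw [reflect_mul_conj]; linarith [hT.wall_hit ho ht hw])
  have h2 : Tendsto (fun r : ℝ => ((), r)) (𝓝[>] 0) (𝓝 () ×ˢ 𝓝[>] (0 : ℝ)) :=
    Filter.Tendsto.prodMk tendsto_const_nhds tendsto_id
  exact h2.eventually h

theorem Admissible.arc_hit (hT : T.Admissible) {q u : ℂ} (ho : T.Outgoing q u) {t : ℝ}
    (ht : T.FirstHit q u t) {i : Arc} {s : ℝ} (hs : s ∈ Ioo 0 (T.arcLen i))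
    (h : q + t * u = T.arcPoint i s) : (u * conj (T.normal i s)).re ≤ 0 := by
  by_contra hn
  have h2 := hT.outgoing_rev ho ht
  rw [h] at h2
  refine h2.not_eventually (hT.arc_outward hs ?_)
  rw [neg_mul, Complex.neg_re]
  linarith

/-! ### Line elements -/

theorem vel_eq (x : Phase) : T.vel x =
    T.tangent x.1 x.2.1 * (Real.sin x.2.2 + Real.cos x.2.2 * Complex.I) := by
  rw [vel, normal, Complex.exp_mul_I, ← Complex.ofReal_cos, ← Complex.ofReal_sin, Real.cos_neg,
    Real.sin_neg]
  push_cast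
  linear_combination -T.tangent x.1 x.2.1 * Complex.sin x.2.2 * Complex.I_sq

theorem norm_vel (x : Phase) : ‖T.vel x‖ = 1 := by
  rw [vel, norm_mul, norm_normal, Complex.norm_exp_ofReal_mul_I, one_mul]

theorem tangent_mul_conj (i : Arc) (s : ℝ) : T.tangent i s * conj (T.tangent i s) = 1 := by
  rw [Complex.mul_conj, Complex.normSq_eq_norm_sq, norm_tangent]; simp

theorem vel_mul_conj_normal (x : Phase) :
    T.vel x * conj (T.normal x.1 x.2.1) = Real.cos x.2.2 - Real.sin x.2.2 * Complex.I := by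
  have := T.tangent_mul_conj x.1 x.2.1
  rw [vel_eq, normal, map_mul, Complex.conj_I]
  push_cast
  linear_combination (-Complex.I * (Complex.sin x.2.2 + Complex.cos x.2.2 * Complex.I)) * this
    - Complex.cos x.2.2 * Complex.I_sq

theorem vel_mul_conj_normal_re (x : Phase) :
    (T.vel x * conj (T.normal x.1 x.2.1)).re = Real.cos x.2.2 := by
  rw [vel_mul_conj_normal, Complex.sub_re, Complex.re_ofReal_mul]; simp [-Complex.ofReal_cos]

theorem cos_pos_of_mem {x : Phase} (hx : x ∈ T.phaseSpace) : 0 < Real.cos x.2.2 :=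
  Real.cos_pos_of_mem_Ioo hx.2

theorem Admissible.outgoing_phase (hT : T.Admissible) {x : Phase} (hx : x ∈ T.phaseSpace) :
    T.Outgoing (T.pos x) (T.vel x) := by
  have h := hT.arc_inward (P := Unit) (p₀ := ()) (i := x.1) (s := fun _ => x.2.1)
    (u := fun _ => T.vel x) continuousAt_const continuousAt_const hx.1
    (by rw [vel_mul_conj_normal_re]; exact cos_pos_of_mem hx)
  have h2 : Tendsto (fun r : ℝ => ((), r)) (𝓝[>] 0) (𝓝 () ×ˢ 𝓝[>] (0 : ℝ)) :=
    Filter.Tendsto.prodMk tendsto_const_nhds tendsto_id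
  exact h2.eventually h

theorem mul_conj_normal_re (i : Arc) (s : ℝ) (u : ℂ) :
    (u * conj (T.normal i s)).re = (u * conj (T.tangent i s)).im := by
  rw [normal, map_mul, Complex.conj_I]; simp; ring

/-- A unit velocity pointing into a curved component is the incoming velocity of a line element. -/
theorem exists_phase {i : Arc} {s : ℝ} (hs : s ∈ Ioo 0 (T.arcLen i)) {u : ℂ} (hu : ‖u‖ = 1)
    (h : (u * conj (T.normal i s)).re < 0) :
    ∃ α, (i, (s, α)) ∈ T.phaseSpace ∧ reflect (T.tangent i s) u = T.vel (i, (s, α)) := by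
  set v : ℂ := T.tangent i s * conj u with hv
  have hvn : ‖v‖ = 1 := by rw [hv, norm_mul, norm_tangent, RCLike.norm_conj, hu, one_mul]
  have hvi : 0 < v.im := by
    rw [mul_conj_normal_re] at h
    have : v = conj (u * conj (T.tangent i s)) := by rw [hv, map_mul, Complex.conj_conj, mul_comm]
    rw [this, Complex.conj_im]; linarith
  have hsq : v.re ^ 2 + v.im ^ 2 = 1 := by
    have := Complex.normSq_eq_norm_sq v
    rw [hvn, Complex.normSq_apply] at this
    linarith
  have hlt : v.re ∈ Ioo (-1 : ℝ) 1 := by constructor <;> nlinarith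
  have hcos : Real.cos (Real.arcsin v.re) = v.im := by
    rw [Real.cos_arcsin]
    rw [show 1 - v.re ^ 2 = v.im ^ 2 by linarith, Real.sqrt_sq hvi.le]
  refine ⟨Real.arcsin v.re, ⟨hs, Real.neg_pi_div_two_lt_arcsin.2 hlt.1,
    Real.arcsin_lt_pi_div_two.2 hlt.2⟩, ?_⟩
  rw [vel_eq]
  simp only [hcos, Real.sin_arcsin hlt.1.le hlt.2.le, Complex.re_add_im]
  rw [hv, reflect]; ring

/-- Reversal of time on line elements. -/
def rev (x : Phase) : Phase := (x.1, (x.2.1, -x.2.2))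

@[simp] theorem rev_rev (x : Phase) : rev (rev x) = x := by simp [rev]

theorem pos_rev (x : Phase) : T.pos (rev x) = T.pos x := rfl

theorem rev_mem {x : Phase} (hx : x ∈ T.phaseSpace) : rev x ∈ T.phaseSpace :=
  ⟨hx.1, by simp only [rev]; constructor <;> linarith [hx.2.1, hx.2.2]⟩

theorem reflect_neg_vel (x : Phase) :
    reflect (T.tangent x.1 x.2.1) (-T.vel x) = T.vel (rev x) := by
  have := T.tangent_mul_conj x.1 x.2.1
  rw [vel_eq, vel_eq, reflect, rev]
  simp only [map_neg, map_mul, map_add, Complex.conj_ofReal, Complex.conj_I, Real.sin_neg,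
    Real.cos_neg, Complex.ofReal_neg]
  linear_combination (-T.tangent x.1 x.2.1 * (Real.sin x.2.2 - Real.cos x.2.2 * Complex.I)) * this

theorem reflect_reflect {τ : ℂ} (hτ : ‖τ‖ = 1) (u : ℂ) : reflect τ (reflect τ u) = u := by
  have h : τ * conj τ = 1 := by
    rw [Complex.mul_conj, Complex.normSq_eq_norm_sq, hτ]; simp
  simp only [reflect, map_mul, map_pow, Complex.conj_conj]
  linear_combination u * (τ * conj τ + 1) * h

theorem norm_reflect {τ : ℂ} (hτ : ‖τ‖ = 1) (u : ℂ) : ‖reflect τ u‖ = ‖u‖ := by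
  simp [reflect, hτ]

theorem reflect_neg (τ u : ℂ) : reflect τ (-u) = -reflect τ u := by simp [reflect]

/-- The velocity before a collision, from the one after it. -/
theorem eq_neg_vel_rev {u : ℂ} {y : Phase} (h : reflect (T.tangent y.1 y.2.1) u = T.vel y) :
    u = -T.vel (rev y) := by
  rw [← reflect_neg_vel, ← h, reflect_neg, neg_neg, reflect_reflect (norm_tangent _ _)]

/-! ### Unfolding -/

/-- The group generated by the reflections in the sides of the rectangle made of the strips, as the
set of maps `x + iy ↦ (ε₁ x + a) + i (ε₂ y + b)`. The entries are `ε₁`, the translation `a` in units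
of twice the width of the rectangle, `ε₂`, and the translation `b` in units of twice the height; `a`
is counted from `0` if `ε₁ = 1`, and from the reflection in the right side if `ε₁ = -1`. -/
abbrev Fold : Type := ℤˣ × ℤ × ℤˣ × ℤ

/-- A sign, as a real number. -/
def sgn (e : ℤˣ) : ℝ := ((e : ℤ) : ℝ)

theorem sgn_cases (e : ℤˣ) : sgn e = 1 ∨ sgn e = -1 := by
  rcases Int.units_eq_one_or e with rfl | rfl <;> simp [sgn]

theorem sgn_neg (e : ℤˣ) : sgn (-e) = -sgn e := by simp [sgn]

theorem sgn_mul_self (e : ℤˣ) : sgn e * sgn e = 1 := by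
  rcases sgn_cases e with h | h <;> rw [h] <;> norm_num

/-- Linear part of an element of the unfolding group. -/
def Fold.lin (g : Fold) (u : ℂ) : ℂ := ⟨sgn g.1 * u.re, sgn g.2.2.1 * u.im⟩

/-- Action of an element of the unfolding group. -/
def foldAct (T : Table) (g : Fold) (z : ℂ) : ℂ :=
  ⟨sgn g.1 * z.re + (2 * (1 + 2 * T.l) * g.2.1 + (1 - sgn g.1) * (1 + T.l)),
    sgn g.2.2.1 * z.im + 2 * T.h * g.2.2.2⟩

/-- Determinant of the linear part. -/
def Fold.det (g : Fold) : ℝ := sgn g.1 * sgn g.2.2.1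

theorem Fold.det_mul_self (g : Fold) : g.det * g.det = 1 := by
  have h1 := sgn_mul_self g.1
  have h2 := sgn_mul_self g.2.2.1
  unfold Fold.det
  linear_combination sgn g.2.2.1 * sgn g.2.2.1 * h1 + h2

theorem foldAct_add (g : Fold) (z u : ℂ) (r : ℝ) :
    T.foldAct g (z + r * u) = T.foldAct g z + r * g.lin u := by
  apply Complex.ext <;> simp [foldAct, Fold.lin] <;> ring

theorem foldAct_sub (g : Fold) (z z' : ℂ) :
    T.foldAct g z - T.foldAct g z' = g.lin (z - z') := by
  apply Complex.ext <;> simp [foldAct, Fold.lin] <;> ring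

theorem Fold.lin_mul_conj_re (g : Fold) (u v : ℂ) :
    (g.lin u * conj (g.lin v)).re = (u * conj v).re := by
  have h1 := sgn_mul_self g.1
  have h2 := sgn_mul_self g.2.2.1
  simp [Fold.lin]
  linear_combination u.re * v.re * h1 + u.im * v.im * h2

theorem Fold.lin_mul_conj_im (g : Fold) (u v : ℂ) :
    (g.lin u * conj (g.lin v)).im = g.det * (u * conj v).im := by
  simp [Fold.lin, Fold.det]
  ring

theorem Fold.norm_lin (g : Fold) (u : ℂ) : ‖g.lin u‖ = ‖u‖ := by
  have h := g.lin_mul_conj_re u u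
  rw [Complex.mul_conj, Complex.mul_conj, Complex.ofReal_re, Complex.ofReal_re,
    Complex.normSq_eq_norm_sq, Complex.normSq_eq_norm_sq] at h
  exact (pow_left_inj₀ (norm_nonneg _) (norm_nonneg _) two_ne_zero).1 h

theorem foldAct_surjective (T : Table) (g : Fold) : Function.Surjective (T.foldAct g) := by
  intro z
  have h1 := sgn_mul_self g.1
  have h2 := sgn_mul_self g.2.2.1
  refine ⟨⟨sgn g.1 * (z.re - (2 * (1 + 2 * T.l) * g.2.1 + (1 - sgn g.1) * (1 + T.l))),
    sgn g.2.2.1 * (z.im - 2 * T.h * g.2.2.2)⟩, ?_⟩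
  apply Complex.ext <;> simp only [foldAct]
  · linear_combination
      (z.re - (2 * (1 + 2 * T.l) * g.2.1 + (1 - sgn g.1) * (1 + T.l))) * h1
  · linear_combination (z.im - 2 * T.h * g.2.2.2) * h2

theorem foldAct_injective (T : Table) (g : Fold) : Function.Injective (T.foldAct g) := by
  intro z z' h
  have h1 : g.lin (z - z') = 0 := by rw [← T.foldAct_sub, h, sub_self]
  have h2 := g.norm_lin (z - z')
  rw [h1, norm_zero] at h2
  exact sub_eq_zero.1 (norm_eq_zero.1 h2.symm)

/-- Composition of an unfolding with the reflection in a side of the rectangle. -/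
theorem exists_fold_wall (w : Wall) (g : Fold) : ∃ g' : Fold,
    (∀ u, g'.lin u = reflect (wallTangent w) (g.lin u)) ∧
      ∀ z, (T.wallCoord w (T.foldAct g z)).im = 0 → T.foldAct g' z = T.foldAct g z := by
  obtain ⟨e, m, e', n⟩ := g
  cases w
  case rightBottom | leftBottom =>
    all_goals
      refine ⟨(e, m, -e', -n), fun u => ?_, fun z hz => ?_⟩
      · apply Complex.ext <;> simp [Fold.lin, reflect, wallTangent, sgn_neg]
      · rw [wallCoord_im] at hz
        simp only [foldAct] at hz
        apply Complex.ext <;> simp [foldAct, sgn_neg]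
        linarith
  case rightTop | leftTop =>
    all_goals
      refine ⟨(e, m, -e', 1 - n), fun u => ?_, fun z hz => ?_⟩
      · apply Complex.ext <;> simp [Fold.lin, reflect, wallTangent, sgn_neg]
      · rw [wallCoord_im] at hz
        simp only [foldAct] at hz
        apply Complex.ext <;> simp [foldAct, sgn_neg]
        linarith
  case rightEnd =>
    refine ⟨(-e, -m, e', n), fun u => ?_, fun z hz => ?_⟩
    · apply Complex.ext <;> simp [Fold.lin, reflect, wallTangent, sgn_neg]
    · rw [wallCoord_im] at hz
      simp only [foldAct] at hz
      apply Complex.ext <;> simp [foldAct, sgn_neg]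
      linarith
  case leftEnd =>
    refine ⟨(-e, -m - 1, e', n), fun u => ?_, fun z hz => ?_⟩
    · apply Complex.ext <;> simp [Fold.lin, reflect, wallTangent, sgn_neg]
    · rw [wallCoord_im] at hz
      simp only [foldAct] at hz
      apply Complex.ext <;> simp [foldAct, sgn_neg]
      linarith

/-- The unfolding is updated at a collision with a flat component. -/
theorem Admissible.fold_step (hT : T.Admissible) (w : Wall) (g : Fold) :
    ∃ g' : Fold, ∀ {q₀ u₀ q u : ℂ} {t t' : ℝ}, q = T.foldAct g (q₀ + t * u₀) → u = g.lin u₀ →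
      q + t' * u ∈ openSegment ℝ (T.wallStart w) (T.wallStop w) →
      q + t' * u = T.foldAct g' (q₀ + (t + t' : ℝ) * u₀) ∧
        reflect (wallTangent w) u = g'.lin u₀ := by
  obtain ⟨g', hg1, hg2⟩ := T.exists_fold_wall w g
  refine ⟨g', fun {q₀ u₀ q u t t'} hq hu hw => ?_⟩
  have hpos : q + t' * u = T.foldAct g (q₀ + (t + t' : ℝ) * u₀) := by
    rw [hq, hu, ← foldAct_add]; congr 1; push_cast; ring
  refine ⟨?_, ?_⟩
  · rw [hpos] at hw ⊢
    rw [hg2 _ ((hT.mem_openSegment_iff w _).1 hw).1]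
  · rw [hg1, hu]

/-! ### Paths in the strips -/

theorem Admissible.flatBounce_outgoing (hT : T.Admissible) {z z' : ℂ × ℂ}
    (h : T.FlatBounce z z') (ho : T.Outgoing z.1 z.2) :
    T.Outgoing z'.1 z'.2 ∧ ‖z'.2‖ = ‖z.2‖ := by
  obtain ⟨t, w, h1, h2, rfl⟩ := h
  exact ⟨hT.outgoing_reflect ho h1 h2, norm_reflect (norm_wallTangent w) _⟩

theorem Admissible.flatPath_outgoing (hT : T.Admissible) {n : ℕ} {z z' : ℂ × ℂ}
    (h : T.FlatPath n z z') (ho : T.Outgoing z.1 z.2) :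
    T.Outgoing z'.1 z'.2 ∧ ‖z'.2‖ = ‖z.2‖ := by
  induction h with
  | zero z => exact ⟨ho, rfl⟩
  | succ h1 h2 ih =>
    obtain ⟨h3, h4⟩ := ih ho
    obtain ⟨h5, h6⟩ := hT.flatBounce_outgoing h2 h3
    exact ⟨h5, h6.trans h4⟩

/-- The vertices of the table. -/
def vertices (T : Table) : Set ℂ :=
  (⋃ i, {T.arcPoint i 0, T.arcPoint i (T.arcLen i)}) ∪ ⋃ w, {T.wallStart w, T.wallStop w}

theorem finite_vertices (T : Table) : T.vertices.Finite :=
  (finite_iUnion fun _ => by simp).union (finite_iUnion fun _ => by simp)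

theorem boundary_cases {z : ℂ} (hz : z ∈ T.boundary) : z ∈ T.vertices ∨
    (∃ w, z ∈ openSegment ℝ (T.wallStart w) (T.wallStop w)) ∨
      ∃ i, ∃ s ∈ Ioo 0 (T.arcLen i), z = T.arcPoint i s := by
  rw [mem_boundary_iff] at hz
  rcases hz with ⟨i, s, hs, rfl⟩ | ⟨w, hw⟩
  · rcases hs.1.eq_or_lt with h | h
    · exact Or.inl (Or.inl (mem_iUnion.2 ⟨i, by simp [← h]⟩))
    rcases hs.2.eq_or_lt with h' | h'
    · exact Or.inl (Or.inl (mem_iUnion.2 ⟨i, by simp [h']⟩))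
    · exact Or.inr (Or.inr ⟨i, s, ⟨h, h'⟩, rfl⟩)
  · rw [← insert_endpoints_openSegment] at hw
    rcases hw with h | h | h
    · exact Or.inl (Or.inr (mem_iUnion.2 ⟨w, by simp [h]⟩))
    · exact Or.inl (Or.inr (mem_iUnion.2 ⟨w, by simp [h]⟩))
    · exact Or.inr (Or.inl ⟨w, h⟩)

theorem Admissible.openWall_cases (hT : T.Admissible) {w : Wall} {z : ℂ}
    (hz : z ∈ openSegment ℝ (T.wallStart w) (T.wallStop w)) :
    ((z.re < 0 ∨ 1 < z.re) ∧ -T.l < z.re ∧ z.re < 1 + T.l ∧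
      ((z.im = 0 ∧ wallTangent w = 1) ∨ (z.im = T.h ∧ wallTangent w = -1))) ∨
    ((z.re = 1 + T.l ∨ z.re = -T.l) ∧ 0 < z.im ∧ z.im < T.h ∧
      (wallTangent w = Complex.I ∨ wallTangent w = -Complex.I)) := by
  have hl := hT.l_pos
  rw [hT.mem_openSegment_iff, wallCoord_re, wallCoord_im] at hz
  cases w <;> obtain ⟨h1, h2, h3⟩ := hz <;> simp only [wallLen, wallTangent] at h1 h2 h3 ⊢
  · exact Or.inl ⟨Or.inr (by linarith), by linarith, by linarith, by simp [h1]⟩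
  · exact Or.inr ⟨Or.inl (by linarith), by linarith, by linarith, by simp⟩
  · exact Or.inl ⟨Or.inr (by linarith), by linarith, by linarith, Or.inr ⟨by linarith, trivial⟩⟩
  · exact Or.inl ⟨Or.inl (by linarith), by linarith, by linarith, Or.inr ⟨by linarith, trivial⟩⟩
  · exact Or.inr ⟨Or.inr (by linarith), by linarith, by linarith, by simp⟩
  · exact Or.inl ⟨Or.inl (by linarith), by linarith, by linarith, by simp [h1]⟩

/-- Lower bound for the time `t` spent since the last collision with an arc by a particle that has
just bounced off the flat component at `q` and moves in direction `u`: it has gone through a whole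
strip, or it is on its way to or from the end of a strip. -/
def StripTime (T : Table) (q u : ℂ) (t : ℝ) : Prop :=
  2 * T.l ≤ t ∨ (1 ≤ q.re ∧ 0 < u.re ∧ q.re - 1 ≤ t) ∨
    (1 ≤ q.re ∧ u.re < 0 ∧ 2 * T.l + 1 - q.re ≤ t) ∨ (q.re ≤ 0 ∧ u.re < 0 ∧ -q.re ≤ t) ∨
      (q.re ≤ 0 ∧ 0 < u.re ∧ 2 * T.l + q.re ≤ t)

theorem re_ray (q u : ℂ) (t : ℝ) : (q + t * u).re = q.re + t * u.re := by simp

theorem im_ray (q u : ℂ) (t : ℝ) : (q + t * u).im = q.im + t * u.im := by simp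

theorem abs_mul_re_le {u : ℂ} (hu : ‖u‖ = 1) {t : ℝ} (ht : 0 < t) :
    t * u.re ≤ t ∧ -t ≤ t * u.re := by
  have h := abs_le.1 (hu ▸ Complex.abs_re_le_norm u)
  constructor <;> nlinarith [h.1, h.2]

/-- The real part of the velocity changes at the ends of the strips only. -/
theorem Admissible.reflect_re (hT : T.Admissible) {w : Wall} {z : ℂ} (u : ℂ)
    (hz : z ∈ openSegment ℝ (T.wallStart w) (T.wallStop w)) :
    ((z.re < 0 ∨ 1 < z.re) ∧ -T.l < z.re ∧ z.re < 1 + T.l ∧ (reflect (wallTangent w) u).re = u.re) ∨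
    ((z.re = 1 + T.l ∨ z.re = -T.l) ∧ (reflect (wallTangent w) u).re = -u.re) := by
  rcases hT.openWall_cases hz with ⟨h1, h2, h3, h4⟩ | ⟨h1, h2, h3, h4⟩
  · refine Or.inl ⟨h1, h2, h3, ?_⟩
    rcases h4 with ⟨-, h⟩ | ⟨-, h⟩ <;> simp [h, reflect]
  · refine Or.inr ⟨h1, ?_⟩
    rcases h4 with h | h <;> simp [h, reflect]

/-- The first flat collision after one with an arc, which lies over the opening `0 < re q < 1`. -/
theorem Admissible.stripTime_start (hT : T.Admissible) {q u : ℂ} (hq : 0 < q.re) (hq' : q.re < 1)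
    (hu : ‖u‖ = 1) {t : ℝ} (ht : 0 < t) {w : Wall}
    (hw : q + t * u ∈ openSegment ℝ (T.wallStart w) (T.wallStop w)) :
    T.StripTime (q + t * u) (reflect (wallTangent w) u) t := by
  have hl := hT.l_pos
  obtain ⟨h1, h2⟩ := abs_mul_re_le hu ht
  have hpos : 0 < t * u.re → 0 < u.re := fun h => pos_of_mul_pos_right h ht.le
  have hneg : t * u.re < 0 → u.re < 0 := fun h => by by_contra hn; nlinarith
  unfold StripTime
  rcases hT.reflect_re u hw with ⟨h3, h4, h5, h6⟩ | ⟨h3, h6⟩ <;> rw [re_ray] at * <;> rw [h6]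
  · rcases h3 with h3 | h3
    · have := hneg (by linarith)
      exact Or.inr (Or.inr (Or.inr (Or.inl ⟨by linarith, by linarith, by linarith⟩)))
    · have := hpos (by linarith)
      exact Or.inr (Or.inl ⟨by linarith, by linarith, by linarith⟩)
  · rcases h3 with h3 | h3
    · have := hpos (by linarith)
      exact Or.inr (Or.inr (Or.inl ⟨by linarith, by linarith, by linarith⟩))
    · have := hneg (by linarith)
      exact Or.inr (Or.inr (Or.inr (Or.inr ⟨by linarith, by linarith, by linarith⟩)))

theorem Admissible.stripTime_step (hT : T.Admissible) {q u : ℂ} (hu : ‖u‖ = 1) {t t' : ℝ}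
    (ht : 0 < t') (h : T.StripTime q u t) (hq : -T.l ≤ q.re ∧ q.re ≤ 1 + T.l) {w : Wall}
    (hw : q + t' * u ∈ openSegment ℝ (T.wallStart w) (T.wallStop w)) :
    T.StripTime (q + t' * u) (reflect (wallTangent w) u) (t + t') := by
  have hl := hT.l_pos
  obtain ⟨h1, h2⟩ := abs_mul_re_le hu ht
  have hpos : 0 < u.re → 0 < t' * u.re := fun h => mul_pos ht h
  have hneg : u.re < 0 → t' * u.re < 0 := fun h => mul_neg_of_pos_of_neg ht h
  unfold StripTime at *
  rcases hT.reflect_re u hw with ⟨h3, h4, h5, h6⟩ | ⟨h3, h6⟩ <;> rw [re_ray] at * <;> rw [h6] <;>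
    generalize t' * u.re = d at * <;> generalize u.re = v at * <;> generalize q.re = x at * <;>
    clear h6 hw hu
  · rcases h with h | ⟨a, b, c⟩ | ⟨a, b, c⟩ | ⟨a, b, c⟩ | ⟨a, b, c⟩
    · left; linarith
    · have := hpos b
      right; left; exact ⟨by linarith, b, by linarith⟩
    · have := hneg b
      rcases h3 with h3 | h3
      · left; linarith
      · right; right; left; exact ⟨by linarith, b, by linarith⟩
    · have := hneg b
      right; right; right; left; exact ⟨by linarith, b, by linarith⟩
    · have := hpos b
      rcases h3 with h3 | h3
      · right; right; right; right; exact ⟨by linarith, b, by linarith⟩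
      · left; linarith
  · rcases h with h | ⟨a, b, c⟩ | ⟨a, b, c⟩ | ⟨a, b, c⟩ | ⟨a, b, c⟩
    · left; linarith
    · have := hpos b
      right; right; left; rcases h3 with h3 | h3 <;> exact ⟨by linarith, by linarith, by linarith⟩
    · have := hneg b
      rcases h3 with h3 | h3 <;> left <;> linarith
    · have := hneg b
      right; right; right; right
      rcases h3 with h3 | h3 <;> exact ⟨by linarith, by linarith, by linarith⟩
    · have := hpos b
      rcases h3 with h3 | h3 <;> left <;> linarith

/-- Back over the opening, the particle has gone through a strip twice. -/
theorem StripTime.lt {q u : ℂ} (hu : ‖u‖ = 1) {t t' : ℝ}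
    (ht : 0 < t') (h : T.StripTime q u t) (h0 : 0 < (q + t' * u).re) (h1 : (q + t' * u).re < 1) :
    2 * T.l < t + t' := by
  obtain ⟨h1, h2⟩ := abs_mul_re_le hu ht
  rw [re_ray] at *
  rcases h with h | ⟨a, b, c⟩ | ⟨a, b, c⟩ | ⟨a, b, c⟩ | ⟨a, b, c⟩
  · linarith
  · have := mul_pos ht b; linarith
  · linarith
  · have := mul_neg_of_pos_of_neg ht b; linarith
  · linarith

theorem Admissible.pos_bounds (hT : T.Admissible) {x : Phase} (hx : x ∈ T.phaseSpace) :
    0 < (T.pos x).re ∧ (T.pos x).re < 1 ∧ ((x.1 = .bottom ∧ (T.pos x).im < 0) ∨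
      (x.1 ≠ .bottom ∧ T.h < (T.pos x).im ∧ (T.pos x).im < T.h + 1)) := by
  obtain ⟨i, s, α⟩ := x
  by_cases hi : i = .bottom
  · subst hi
    have := hT.bottom_bounds_strict hx.1
    exact ⟨this.2.1, this.2.2, Or.inl ⟨rfl, this.1⟩⟩
  · have := hT.disp_bounds_strict hi hx.1
    exact ⟨this.2.2.1, this.2.2.2, Or.inr ⟨hi, this.1, this.2.1⟩⟩

/-- A moving point meets the points of a lattice finitely often in bounded time. -/
theorem finite_lattice_times (a b c d B : ℝ) (hb : b ≠ 0) (hd : 0 < d) :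
    {r : ℝ | r ∈ Icc 0 B ∧ ∃ m : ℤ, a + r * b = c + d * m}.Finite := by
  set N : ℤ := ⌈(|a| + |c| + B * |b|) / d⌉ with hN
  refine ((finite_Icc (-N) N).image fun m : ℤ => (c + d * m - a) / b).subset ?_
  rintro r ⟨⟨hr0, hrB⟩, m, hm⟩
  refine ⟨m, ?_, ?_⟩
  · have h1 : |(m : ℝ)| ≤ (|a| + |c| + B * |b|) / d := by
      rw [le_div_iff₀ hd]
      have h2 : (m : ℝ) * d = a - c + r * b := by linarith
      have h3 : |(m : ℝ)| * d = |a - c + r * b| := by rw [← h2, abs_mul, abs_of_pos hd]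
      have h4 : |r * b| ≤ B * |b| := by
        rw [abs_mul, abs_of_nonneg hr0]
        exact mul_le_mul_of_nonneg_right hrB (abs_nonneg b)
      rw [h3]
      calc |a - c + r * b| ≤ |a - c| + |r * b| := abs_add_le _ _
        _ ≤ |a| + |c| + B * |b| := add_le_add (abs_sub a c) h4
    have h5 : |(m : ℝ)| ≤ N := h1.trans (Int.le_ceil _)
    have h6 := abs_le.1 h5
    exact ⟨by exact_mod_cast h6.1, by exact_mod_cast h6.2⟩
  · simp only
    rw [div_eq_iff hb]
    linarith

/-- Multiples of `2 h` shifted by `0` or `h` (up to sign) that lie in `[0, h]`. -/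
theorem level_of_mem {h c x : ℝ} (hh : 0 < h) (hc : c = 0 ∨ c = h) {e : ℤˣ} {j : ℤ}
    (hx : x = sgn e * c + 2 * h * j) (h0 : 0 ≤ x) (h1 : x ≤ h) : x = 0 ∨ x = h := by
  have key : ∀ k : ℤ, x = h * k → x = 0 ∨ x = h := by
    intro k hk
    have a0 : (0 : ℝ) ≤ k := by by_contra hn; nlinarith
    have a1 : (k : ℝ) ≤ 1 := by by_contra hn; nlinarith
    have b0 : 0 ≤ k := by exact_mod_cast a0
    have b1 : k ≤ 1 := by exact_mod_cast a1
    interval_cases k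
    · left; simpa using hk
    · right; simpa using hk
  rcases hc with rfl | rfl
  · exact key (2 * j) (by push_cast; linarith)
  · rcases sgn_cases e with he | he
    · exact key (1 + 2 * j) (by push_cast; rw [hx, he]; ring)
    · exact key (-1 + 2 * j) (by push_cast; rw [hx, he]; ring)

/-- The images of the opening under the unfolding group do not meet the strips. -/
theorem not_strip_of_gap {l v : ℝ} (hl : 0 < l) (hv0 : 0 < v) (hv1 : v < 1) {e : ℤˣ} {j m : ℤ}
    (a3 : -l ≤ sgn e * (v + 2 * (1 + 2 * l) * j) + (2 * (1 + 2 * l) * m + (1 - sgn e) * (1 + l)))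
    (a4 : sgn e * (v + 2 * (1 + 2 * l) * j) + (2 * (1 + 2 * l) * m + (1 - sgn e) * (1 + l)) ≤ 1 + l)
    (a5 : sgn e * (v + 2 * (1 + 2 * l) * j) + (2 * (1 + 2 * l) * m + (1 - sgn e) * (1 + l)) ≤ 0 ∨
      1 ≤ sgn e * (v + 2 * (1 + 2 * l) * j) + (2 * (1 + 2 * l) * m + (1 - sgn e) * (1 + l))) :
    False := by
  have mul_le : ∀ k : ℤ, k ≤ -1 → 2 * (1 + 2 * l) * (k : ℝ) ≤ -(2 * (1 + 2 * l)) := fun k hk => by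
    have : (k : ℝ) ≤ -1 := by exact_mod_cast hk
    nlinarith
  have le_mul : ∀ k : ℤ, 1 ≤ k → 2 * (1 + 2 * l) ≤ 2 * (1 + 2 * l) * (k : ℝ) := fun k hk => by
    have : (1 : ℝ) ≤ k := by exact_mod_cast hk
    nlinarith
  rcases sgn_cases e with h | h <;> rw [h] at a3 a4 a5
  · rcases lt_trichotomy (j + m) 0 with hj | hj | hj
    · have := mul_le (j + m) (by omega)
      push_cast at this
      linarith
    · obtain rfl : j = -m := by omega
      push_cast at a5
      rcases a5 with a5 | a5 <;> linarith
    · have := le_mul (j + m) (by omega)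
      push_cast at this
      linarith
  · rcases lt_trichotomy (m - j) 0 with hj | hj | hj
    · have := mul_le (m - j) (by omega)
      push_cast at this
      linarith
    · obtain rfl : j = m := by omega
      linarith
    · have := le_mul (m - j) (by omega)
      push_cast at this
      linarith

set_option maxHeartbeats 1000000 in
/-- A particle leaving an arc cannot bounce off the flat components forever. In the unfolded strip
it would come back, at some of the times when its height is that of the opening through which it
entered, arbitrarily close to the point of entrance, and so it would leave the rectangle. -/
theorem Admissible.no_infinite_path (hT : T.Admissible) {x : Phase} (hx : x ∈ T.phaseSpace)
    (z : ℕ → ℂ × ℂ) (hz0 : z 0 = (T.pos x, T.vel x)) (hz : ∀ k, T.FlatBounce (z k) (z (k + 1))) :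
    False := by
  have hh := hT.h_pos
  have hl := hT.l_pos
  choose τ w hhit hw hnext using hz
  set q₀ := T.pos x with hq₀
  set u₀ := T.vel x with hu₀
  obtain ⟨hre0, hre1, him⟩ := hT.pos_bounds hx
  set t : ℕ → ℝ := fun k => ∑ j ∈ Finset.range k, τ j with ht
  have ht0 : t 0 = 0 := by simp [ht]
  have htS : ∀ k, t (k + 1) = t k + τ k := fun k => Finset.sum_range_succ _ _
  have hτ : ∀ k, 0 < τ k := fun k => (hhit k).1
  have hmono : StrictMono t := strictMono_nat_of_lt_succ fun k => by
    rw [htS]; linarith [hτ k]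
  have hfold : ∀ k, ∃ g : Fold, (z k).1 = T.foldAct g (q₀ + t k * u₀) ∧ (z k).2 = g.lin u₀ := by
    intro k
    induction k with
    | zero =>
      refine ⟨((1 : ℤˣ), (0 : ℤ), (1 : ℤˣ), (0 : ℤ)), ?_, ?_⟩
      · rw [hz0, ht0]; apply Complex.ext <;> simp [foldAct, sgn]
      · rw [hz0]; apply Complex.ext <;> simp [Fold.lin, sgn]
    | succ k ih =>
      obtain ⟨g, hg1, hg2⟩ := ih
      obtain ⟨g', hg'⟩ := hT.fold_step (w k) g
      obtain ⟨h1, h2⟩ := hg' hg1 hg2 (hw k)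
      exact ⟨g', by rw [hnext, htS]; exact h1, by rw [hnext]; exact h2⟩
  choose g hg1 hg2 using hfold
  have hwall : ∀ k, (z (k + 1)).1 ∈ openSegment ℝ (T.wallStart (w k)) (T.wallStop (w k)) := by
    intro k; rw [hnext]; exact hw k
  have hz1 : (z 1).1 = q₀ + τ 0 * u₀ := by rw [hnext 0, hz0]
  have hrange : ∀ k, 0 ≤ (z (k + 1)).1.im ∧ (z (k + 1)).1.im ≤ T.h ∧ -T.l ≤ (z (k + 1)).1.re ∧
      (z (k + 1)).1.re ≤ 1 + T.l ∧ ((z (k + 1)).1.re ≤ 0 ∨ 1 ≤ (z (k + 1)).1.re) ∧ _ :=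
    fun k => hT.wall_bounds (openSegment_subset_segment _ _ _ (hwall k))
  have hre : u₀.re ≠ 0 := by
    intro h0
    obtain ⟨-, -, -, -, h5, -⟩ := hrange 0
    rw [zero_add, hz1, re_ray, h0] at h5
    rcases h5 with h5 | h5 <;> linarith
  have himn : u₀.im ≠ 0 := by
    intro h0
    obtain ⟨h1, h2, -⟩ := hrange 0
    rw [zero_add, hz1, im_ray, h0] at h1 h2
    rcases him with ⟨-, h⟩ | ⟨-, h, -⟩ <;> linarith
  -- each bounce happens at a time when the unfolded ray meets a lattice line, so that only finitely
  -- many of them happen in bounded time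
  have hunb : ∀ B, ∃ k, B < t k := by
    intro B
    by_contra hn
    push Not at hn
    have hfin := (finite_lattice_times q₀.im u₀.im 0 T.h B himn hh).union
      (finite_lattice_times q₀.re u₀.re (1 + T.l) (1 + 2 * T.l) B hre (by linarith))
    refine Set.infinite_of_injective_forall_mem (f := fun k => t (k + 1))
      (fun a b hab => by simpa using hmono.injective hab) (fun k => ?_) hfin
    have htk : t (k + 1) ∈ Icc 0 B :=
      ⟨by rw [← ht0]; exact (hmono.monotone (Nat.zero_le _)), hn _⟩
    have e1 : (z (k + 1)).1.im = sgn (g (k + 1)).2.2.1 * (q₀.im + t (k + 1) * u₀.im) +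
        2 * T.h * (g (k + 1)).2.2.2 := by
      rw [hg1 (k + 1)]; simp [foldAct]
    have e2 : (z (k + 1)).1.re = sgn (g (k + 1)).1 * (q₀.re + t (k + 1) * u₀.re) +
        (2 * (1 + 2 * T.l) * (g (k + 1)).2.1 + (1 - sgn (g (k + 1)).1) * (1 + T.l)) := by
      rw [hg1 (k + 1)]; simp [foldAct]
    generalize (g (k + 1)).2.2.2 = n at e1
    generalize (g (k + 1)).2.1 = m at e2
    have s1 := sgn_cases (g (k + 1)).2.2.1
    have s2 := sgn_cases (g (k + 1)).1
    rcases (hrange k).2.2.2.2.2 with h | h | h | h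
    · left; refine ⟨htk, ?_⟩
      rcases s1 with s | s <;> rw [s, h] at e1
      · exact ⟨-2 * n, by push_cast; linarith⟩
      · exact ⟨2 * n, by push_cast; linarith⟩
    · left; refine ⟨htk, ?_⟩
      rcases s1 with s | s <;> rw [s, h] at e1
      · exact ⟨1 - 2 * n, by push_cast; linarith⟩
      · exact ⟨2 * n - 1, by push_cast; linarith⟩
    · right; refine ⟨htk, ?_⟩
      rcases s2 with s | s <;> rw [s, h] at e2
      · exact ⟨-1 - 2 * m, by push_cast; linarith⟩
      · exact ⟨1 + 2 * m, by push_cast; linarith⟩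
    · right; refine ⟨htk, ?_⟩
      rcases s2 with s | s <;> rw [s, h] at e2
      · exact ⟨-2 * m, by push_cast; linarith⟩
      · exact ⟨2 * m, by push_cast; linarith⟩
  -- the passage through the opening, at the time `t₀` and the height `c`; the ray is in the strip
  -- `0 ≤ im ≤ h` for at most the time `h / |u₀.im|` after it
  have hentry : ∃ (c t₀ : ℝ) (e : ℤˣ), (c = 0 ∨ c = T.h) ∧ t₀ ∈ Ioo 0 (τ 0) ∧
      q₀.im + t₀ * u₀.im = c ∧ 0 < q₀.re + t₀ * u₀.re ∧ q₀.re + t₀ * u₀.re < 1 ∧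
      |u₀.im| = sgn e * u₀.im ∧ ∀ r, τ 0 ≥ r → q₀.im + r * u₀.im ∈ Icc 0 T.h →
        r ≤ t₀ + T.h / |u₀.im| := by
    have hout : T.Outgoing q₀ u₀ := hT.outgoing_phase hx
    have hhit0 : T.FirstHit q₀ u₀ (τ 0) := by have := hhit 0; rwa [hz0] at this
    have hw0 := hw 0
    rw [hz0] at hw0
    have htr := hT.wall_hit hout hhit0 hw0
    have hoc := hT.openWall_cases hw0
    have hst := hT.stays hout hhit0
    obtain ⟨r1, r2, -⟩ := hrange 0
    rw [zero_add, hz1, im_ray] at r1 r2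
    have hτ0 := hτ 0
    rcases him with ⟨-, h⟩ | ⟨-, h, -⟩
    · have hu : 0 < u₀.im := by by_contra hn; nlinarith
      have hlev : q₀.im + (-q₀.im / u₀.im) * u₀.im = 0 := by field_simp; ring
      have hlt : -q₀.im / u₀.im < τ 0 := by
        rw [div_lt_iff₀ hu]
        rcases r1.eq_or_lt with r1 | r1
        · rcases hoc with ⟨-, -, -, ⟨-, h4⟩ | ⟨h4, -⟩⟩ | ⟨-, h4, -⟩
          · rw [h4] at htr; simp at htr; linarith
          · rw [im_ray] at h4; linarith
          · rw [im_ray] at h4; linarith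
        · linarith
      have hmem : -q₀.im / u₀.im ∈ Ioo 0 (τ 0) := ⟨div_pos (by linarith) hu, hlt⟩
      have hin := hst _ hmem
      have hle : 0 < (q₀ + (-q₀.im / u₀.im : ℝ) * u₀).re ∧
          (q₀ + (-q₀.im / u₀.im : ℝ) * u₀).re < 1 := by
        rcases hin with ⟨a1, a2⟩ | ⟨a1, -⟩ | ⟨a1, -⟩
        · exact hT.lens_bounds a1 a2
        · rw [im_ray, hlev] at a1; linarith
        · rw [im_ray, hlev] at a1; linarith
      rw [re_ray] at hle
      refine ⟨0, -q₀.im / u₀.im, 1, Or.inl rfl, hmem, hlev, hle.1, hle.2,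
        by rw [abs_of_pos hu]; simp [sgn], fun r _ hr => ?_⟩
      rw [abs_of_pos hu, ← add_div, le_div_iff₀ hu]
      linarith [hr.2]
    · have hu : u₀.im < 0 := by by_contra hn; nlinarith
      have hlev : q₀.im + ((T.h - q₀.im) / u₀.im) * u₀.im = T.h := by field_simp; ring
      have hlt : (T.h - q₀.im) / u₀.im < τ 0 := by
        rw [div_lt_iff_of_neg hu]
        rcases r2.eq_or_lt with r2 | r2
        · rcases hoc with ⟨-, -, -, ⟨h4, -⟩ | ⟨-, h4⟩⟩ | ⟨-, -, h4, -⟩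
          · rw [im_ray] at h4; linarith
          · rw [h4] at htr; simp at htr; linarith
          · rw [im_ray] at h4; linarith
        · linarith
      have hmem : (T.h - q₀.im) / u₀.im ∈ Ioo 0 (τ 0) :=
        ⟨div_pos_of_neg_of_neg (by linarith) hu, hlt⟩
      have hin := hst _ hmem
      have hle : 0 < (q₀ + ((T.h - q₀.im) / u₀.im : ℝ) * u₀).re ∧
          (q₀ + ((T.h - q₀.im) / u₀.im : ℝ) * u₀).re < 1 := by
        rcases hin with ⟨a1, -⟩ | ⟨-, a1, -⟩ | ⟨-, -, a1, a2, -⟩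
        · rw [im_ray, hlev] at a1; linarith
        · rw [im_ray, hlev] at a1; linarith
        · exact ⟨a1, a2⟩
      rw [re_ray] at hle
      refine ⟨T.h, (T.h - q₀.im) / u₀.im, -1, Or.inr rfl, hmem, hlev, hle.1, hle.2,
        by rw [abs_of_neg hu]; simp [sgn], fun r _ hr => ?_⟩
      have hne := hu.ne
      have h3 : (T.h - q₀.im) / u₀.im + T.h / |u₀.im| = (-q₀.im) / u₀.im := by
        rw [abs_of_neg hu]; field_simp; ring
      rw [h3, le_div_iff_of_neg hu]
      linarith [hr.1]
  obtain ⟨c, t₀, e₀, hc, ht₀, hlev, hgap0, hgap1, hsg, hlast⟩ := hentry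
  set v₀ := q₀.re + t₀ * u₀.re with hv₀
  have habs : 0 < |u₀.im| := abs_pos.2 himn
  -- `N` is so large that an error `1 / N` in units of the horizontal period keeps the point in the
  -- opening
  obtain ⟨N, hN⟩ := exists_nat_gt (2 * (1 + 2 * T.l) / min v₀ (1 - v₀))
  have hmin : 0 < min v₀ (1 - v₀) := lt_min hgap0 (by linarith)
  have hNpos : 0 < N := by
    have : (0 : ℝ) < N := lt_trans (by positivity) hN
    exact_mod_cast this
  obtain ⟨j, k, hk0, -, hjk⟩ := Real.exists_int_int_abs_mul_sub_le
    (u₀.re * (2 * T.h / |u₀.im|) / (2 * (1 + 2 * T.l))) hNpos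
  set r := t₀ + 2 * T.h * k / |u₀.im| with hr
  have hk1 : (1 : ℝ) ≤ k := by exact_mod_cast hk0
  have hτr : τ 0 < r := by
    by_contra hn
    obtain ⟨r1, r2, -⟩ := hrange 0
    have h1 := hlast (τ 0) le_rfl (by rw [← im_ray, ← hz1]; exact ⟨r1, r2⟩)
    have h2 : T.h / |u₀.im| < 2 * T.h * k / |u₀.im| := by
      apply div_lt_div_of_pos_right _ habs; nlinarith
    linarith
  have hX : ∃ v : ℝ, 0 < v ∧ v < 1 ∧ q₀.re + r * u₀.re = v + 2 * (1 + 2 * T.l) * j := by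
    refine ⟨q₀.re + r * u₀.re - 2 * (1 + 2 * T.l) * j, ?_⟩
    have hW : 0 < 2 * (1 + 2 * T.l) := by linarith
    have h1 : q₀.re + r * u₀.re - 2 * (1 + 2 * T.l) * j = v₀ + 2 * (1 + 2 * T.l) *
        (k * (u₀.re * (2 * T.h / |u₀.im|) / (2 * (1 + 2 * T.l))) - j) := by
      rw [hr, hv₀]; field_simp; ring
    have h2 : 2 * (1 + 2 * T.l) * (1 / ((N : ℝ) + 1)) < min v₀ (1 - v₀) := by
      rw [mul_one_div, div_lt_iff₀ (by positivity)]
      rw [div_lt_iff₀ hmin] at hN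
      linarith
    have h3 := abs_le.1 hjk
    have h4 := mul_le_mul_of_nonneg_left h3.1 hW.le
    have h5 := mul_le_mul_of_nonneg_left h3.2 hW.le
    rw [h1]
    refine ⟨?_, ?_, by linarith⟩
    · have := min_le_left v₀ (1 - v₀); linarith
    · have := min_le_right v₀ (1 - v₀); linarith
  obtain ⟨v, hv0, hv1, hXv⟩ := hX
  have hY : q₀.im + r * u₀.im = c + sgn e₀ * (2 * T.h * k) := by
    have h0 := sgn_mul_self e₀
    have h1 : 2 * T.h * k / |u₀.im| * u₀.im = sgn e₀ * (2 * T.h * k) := by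
      rw [hsg]
      have h2 : sgn e₀ ≠ 0 := by intro h; rw [h] at h0; norm_num at h0
      field_simp
      linear_combination (-1 : ℝ) * h0
    rw [hr, add_mul, h1, ← hlev]; ring
  -- between the flat collisions `K` and `K + 1` the time is `r`; folded back, the particle is then at
  -- the height of a horizontal side, but over the opening
  classical
  have hexK : ∃ K, r < t K := hunb r
  obtain ⟨K, hK1, hK2⟩ : ∃ K, t (K + 1) ≤ r ∧ r < t (K + 2) := by
    have h1 := Nat.find_spec hexK
    have h2 : 2 ≤ Nat.find hexK := by
      rw [Nat.le_find_iff]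
      intro m hm
      interval_cases m
      · rw [ht0]; linarith [hτ 0]
      · have : t 1 = τ 0 := by rw [htS, ht0, zero_add]
        rw [this]; linarith
    obtain ⟨K, hK⟩ := Nat.exists_eq_add_of_le h2
    refine ⟨K, ?_, by rw [show K + 2 = Nat.find hexK by omega]; exact h1⟩
    exact not_lt.1 (Nat.find_min hexK (by omega))
  set p := T.foldAct (g (K + 1)) (q₀ + r * u₀) with hp
  have hp' : p = (z (K + 1)).1 + (r - t (K + 1) : ℝ) * (z (K + 1)).2 := by
    rw [hg1 (K + 1), hg2, ← foldAct_add, hp]; congr 1; push_cast; ring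
  have hnx : (z (K + 2)).1 = (z (K + 1)).1 + (τ (K + 1) : ℝ) * (z (K + 1)).2 := by
    rw [hnext (K + 1)]
  have hτK : r - t (K + 1) < τ (K + 1) := by
    have := htS (K + 1); linarith
  obtain ⟨a1, a2, a3, a4, a5, -⟩ := hrange K
  obtain ⟨b1, b2, -⟩ := hrange (K + 1)
  have hV : (z (K + 1)).2.im ≠ 0 := by
    rw [hg2]; simp only [Fold.lin]
    rcases sgn_cases (g (K + 1)).2.2.1 with h | h <;> rw [h] <;> simpa using himn
  have pim : p.im = sgn (g (K + 1)).2.2.1 * (q₀.im + r * u₀.im) + 2 * T.h * (g (K + 1)).2.2.2 := by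
    simp [hp, foldAct]
  have pre : p.re = sgn (g (K + 1)).1 * (q₀.re + r * u₀.re) +
        (2 * (1 + 2 * T.l) * (g (K + 1)).2.1 + (1 - sgn (g (K + 1)).1) * (1 + T.l)) := by
    simp [hp, foldAct]
  have hp1 : p.im = (z (K + 1)).1.im + (r - t (K + 1)) * (z (K + 1)).2.im := by
    rw [hp', im_ray]
  have hn1 : (z (K + 1 + 1)).1.im = (z (K + 1)).1.im + τ (K + 1) * (z (K + 1)).2.im := by
    rw [show K + 1 + 1 = K + 2 by rfl, hnx, im_ray]
  rw [hn1] at b1 b2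
  have hr0 : 0 ≤ r - t (K + 1) := by linarith
  have hbd : 0 ≤ p.im ∧ p.im ≤ T.h := by
    rw [hp1]; constructor <;> rcases lt_or_gt_of_ne hV with h | h <;> nlinarith
  have hlevel : p.im = 0 ∨ p.im = T.h := by
    rcases sgn_cases (g (K + 1)).2.2.1 with h | h <;> rcases sgn_cases e₀ with h' | h'
    · exact level_of_mem (e := (g (K + 1)).2.2.1) (j := k + (g (K + 1)).2.2.2) hh hc
        (by rw [pim, hY, h, h']; push_cast; ring) hbd.1 hbd.2
    · exact level_of_mem (e := (g (K + 1)).2.2.1) (j := -k + (g (K + 1)).2.2.2) hh hc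
        (by rw [pim, hY, h, h']; push_cast; ring) hbd.1 hbd.2
    · exact level_of_mem (e := (g (K + 1)).2.2.1) (j := -k + (g (K + 1)).2.2.2) hh hc
        (by rw [pim, hY, h, h']; push_cast; ring) hbd.1 hbd.2
    · exact level_of_mem (e := (g (K + 1)).2.2.1) (j := k + (g (K + 1)).2.2.2) hh hc
        (by rw [pim, hY, h, h']; push_cast; ring) hbd.1 hbd.2
  rcases hr0.eq_or_lt with hr0 | hr0
  · have hpz : p = (z (K + 1)).1 := by rw [hp', ← hr0]; simp
    rw [← hpz, pre, hXv] at a3 a4 a5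
    exact not_strip_of_gap hl hv0 hv1 a3 a4 a5
  · rcases lt_or_gt_of_ne hV with h | h
    · have c1 := mul_neg_of_pos_of_neg hr0 h
      have c2 := mul_lt_mul_of_neg_right hτK h
      rcases hlevel with hl' | hl' <;> linarith
    · have c1 := mul_pos hr0 h
      have c2 := mul_lt_mul_of_pos_right hτK h
      rcases hlevel with hl' | hl' <;> linarith

/-! ### Existence of the next collision with an arc -/

/-- Line elements whose trajectory hits a vertex or an arc tangentially, before or at its next
collision with the curved boundary. -/
def Singular (T : Table) (x : Phase) : Prop :=
  ∃ (n : ℕ) (q u : ℂ) (t : ℝ), T.FlatPath n (T.pos x, T.vel x) (q, u) ∧ T.FirstHit q u t ∧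
    (q + t * u ∈ T.vertices ∨ ∃ i, ∃ s ∈ Ioo 0 (T.arcLen i), q + t * u = T.arcPoint i s ∧
      (u * conj (T.normal i s)).re = 0)

/-- A nonsingular trajectory returns: as long as it does not, it continues with a flat collision,
which cannot go on forever. -/
theorem Admissible.mem_returnDomain (hT : T.Admissible) {x : Phase} (hx : x ∈ T.phaseSpace)
    (hs : ¬ T.Singular x) : x ∈ T.returnDomain := by
  by_contra hn
  have step : ∀ z : {z : ℂ × ℂ // ∃ n, T.FlatPath n (T.pos x, T.vel x) z},
      ∃ z' : {z : ℂ × ℂ // ∃ n, T.FlatPath n (T.pos x, T.vel x) z}, T.FlatBounce z z' := by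
    rintro ⟨⟨q, u⟩, n, hz⟩
    obtain ⟨ho, hu⟩ := hT.flatPath_outgoing hz (hT.outgoing_phase hx)
    simp only [norm_vel] at ho hu
    obtain ⟨t, ht⟩ := hT.exists_firstHit ho (by intro h; rw [h] at hu; simp at hu)
    rcases boundary_cases ht.2.1 with h | ⟨w, h⟩ | ⟨i, s, hsi, h⟩
    · exact absurd ⟨n, q, u, t, hz, ht, Or.inl h⟩ hs
    · have hb : T.FlatBounce (q, u) (q + t * u, reflect (wallTangent w) u) := ⟨t, w, ht, h, rfl⟩
      exact ⟨⟨_, n + 1, FlatPath.succ hz hb⟩, hb⟩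
    · rcases (hT.arc_hit ho ht hsi h).eq_or_lt with h' | h'
      · exact absurd ⟨n, q, u, t, hz, ht, Or.inr ⟨i, s, hsi, h, h'⟩⟩ hs
      · obtain ⟨α, hα, hv⟩ := exists_phase hsi hu h'
        exact absurd ⟨n, (i, (s, α)), hx, hα, q, u, t, hz, ht, h, hv⟩ hn
  choose f hf using step
  let z : ℕ → {z : ℂ × ℂ // ∃ n, T.FlatPath n (T.pos x, T.vel x) z} :=
    fun k => Nat.rec ⟨(T.pos x, T.vel x), 0, FlatPath.zero _⟩ (fun _ y => f y) k
  exact hT.no_infinite_path hx (fun k => (z k).1) rfl fun k => hf (z k)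

/-! ### Determinism and time reversal -/

theorem Admissible.flatBounce_unique (hT : T.Admissible) {z z' z'' : ℂ × ℂ}
    (h : T.FlatBounce z z') (h' : T.FlatBounce z z'') : z' = z'' := by
  obtain ⟨t, w, h1, h2, rfl⟩ := h
  obtain ⟨t', w', h1', h2', rfl⟩ := h'
  obtain rfl := h1.unique h1'
  have hh := hT.h_pos
  have : wallTangent w ^ 2 = wallTangent w' ^ 2 := by
    rcases hT.openWall_cases h2 with ⟨-, -, -, a⟩ | ⟨-, a1, a2, a3⟩ <;>
      rcases hT.openWall_cases h2' with ⟨-, -, -, b⟩ | ⟨-, b1, b2, b3⟩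
    · rcases a with ⟨-, a⟩ | ⟨-, a⟩ <;> rcases b with ⟨-, b⟩ | ⟨-, b⟩ <;> rw [a, b] <;> norm_num
    · rcases a with ⟨a, -⟩ | ⟨a, -⟩ <;> linarith
    · rcases b with ⟨b, -⟩ | ⟨b, -⟩ <;> linarith
    · rcases a3 with a | a <;> rcases b3 with b | b <;> rw [a, b] <;> norm_num
  simp only [reflect, this]

theorem Admissible.flatPath_unique (hT : T.Admissible) {n : ℕ} {z z' z'' : ℂ × ℂ}
    (h : T.FlatPath n z z') (h' : T.FlatPath n z z'') : z' = z'' := by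
  induction h generalizing z'' with
  | zero z => cases h'; rfl
  | succ h1 h2 ih =>
    cases h' with
    | succ h3 h4 =>
      obtain rfl := ih h3
      exact hT.flatBounce_unique h2 h4

theorem FlatPath.exists_prefix {n m : ℕ} {z z' : ℂ × ℂ} (h : T.FlatPath m z z') (hn : n < m) :
    ∃ a b, T.FlatPath n z a ∧ T.FlatBounce a b := by
  induction h with
  | zero z => omega
  | succ h1 h2 ih =>
    rcases Nat.lt_succ_iff_lt_or_eq.1 hn with h | rfl
    · exact ih h
    · exact ⟨_, _, h1, h2⟩

theorem FlatPath.cons {n : ℕ} {z z' z'' : ℂ × ℂ} (h : T.FlatBounce z z')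
    (h' : T.FlatPath n z' z'') : T.FlatPath (n + 1) z z'' := by
  induction h' with
  | zero z => exact .succ (.zero _) h
  | succ _ h2 ih => exact .succ (ih h) h2

theorem Admissible.arcPoint_not_wall (hT : T.Admissible) {y : Phase} (hy : y ∈ T.phaseSpace)
    (w : Wall) : T.pos y ∉ openSegment ℝ (T.wallStart w) (T.wallStop w) := by
  intro h
  obtain ⟨h0, h1, -⟩ := hT.pos_bounds hy
  obtain ⟨-, -, -, -, h5, -⟩ := hT.wall_bounds (openSegment_subset_segment _ _ _ h)
  rcases h5 with h5 | h5 <;> linarith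

theorem Admissible.arcPoint_injOn (hT : T.Admissible) (i : Arc) :
    InjOn (T.arcPoint i) (Ioo 0 (T.arcLen i)) := by
  intro s hs s' hs' h
  have hk := hT.curv_ne i
  have h1 := (hT.chordCoord_arcPoint i s).1
  have h2 := (hT.chordCoord_arcPoint i s').1
  rw [h, h2, add_right_inj, div_left_inj' hk] at h1
  have hb : ∀ {s}, s ∈ Ioo 0 (T.arcLen i) → T.turn i s ∈ Icc (-(Real.pi / 2)) (Real.pi / 2) := by
    intro s hs
    rw [← hT.abs_turn_lt_iff, abs_lt] at hs
    have := hT.halfAngle_lt i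
    constructor <;> linarith [hs.1, hs.2]
  have h3 := Real.injOn_sin (hb hs') (hb hs) h1
  unfold turn at h3
  have := mul_left_cancel₀ hk h3
  linarith

theorem Admissible.pos_inj (hT : T.Admissible) {x y : Phase} (hx : x ∈ T.phaseSpace)
    (hy : y ∈ T.phaseSpace) (h : T.pos x = T.pos y) : x.1 = y.1 ∧ x.2.1 = y.2.1 := by
  have hh := hT.h_pos
  have h1 : x.1 = y.1 := by
    by_contra hne
    obtain ⟨-, -, hx'⟩ := hT.pos_bounds hx
    obtain ⟨-, -, hy'⟩ := hT.pos_bounds hy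
    rw [← h] at hy'
    rcases hx' with ⟨a, a'⟩ | ⟨a, a', -⟩ <;> rcases hy' with ⟨b, b'⟩ | ⟨b, b', -⟩
    · exact hne (a.trans b.symm)
    · linarith
    · linarith
    · have h2 := hT.circlePow_other a b (Ne.symm hne) hx.1
      have h3 := hT.circlePow_arcPoint y.1 y.2.1
      change T.arcPoint x.1 x.2.1 = T.arcPoint y.1 y.2.1 at h
      rw [h, h3] at h2
      exact lt_irrefl _ h2
  refine ⟨h1, ?_⟩
  have hy1 := hy.1
  rw [← h1] at hy1
  refine hT.arcPoint_injOn x.1 hx.1 hy1 ?_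
  change T.arcPoint x.1 x.2.1 = T.arcPoint y.1 y.2.1 at h
  rwa [← h1] at h

theorem Admissible.phase_ext (hT : T.Admissible) {x y : Phase} (hx : x ∈ T.phaseSpace)
    (hy : y ∈ T.phaseSpace) (h : T.pos x = T.pos y) (hv : T.vel x = T.vel y) : x = y := by
  obtain ⟨h1, h2⟩ := hT.pos_inj hx hy h
  obtain ⟨i, s, α⟩ := x
  obtain ⟨j, s', α'⟩ := y
  obtain rfl : i = j := h1
  obtain rfl : s = s' := h2
  have h3 := vel_mul_conj_normal (T := T) (i, (s, α))
  rw [hv, vel_mul_conj_normal (T := T) (i, (s, α'))] at h3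
  have h4 := congrArg Complex.im h3
  rw [Complex.sub_im, Complex.sub_im, Complex.im_ofReal_mul, Complex.im_ofReal_mul,
    Complex.ofReal_im, Complex.ofReal_im, Complex.I_im] at h4
  have h5 := Real.injOn_sin ⟨hx.2.1.le, hx.2.2.le⟩ ⟨hy.2.1.le, hy.2.2.le⟩
    (show Real.sin α = Real.sin α' by simp only at h4; linarith)
  simp only at h5
  rw [h5]

/-- The next collision with the curved boundary is unique. -/
theorem Admissible.returns_unique (hT : T.Admissible) {x y y' : Phase} {n n' : ℕ}
    (h : T.Returns x n y) (h' : T.Returns x n' y') : n = n' ∧ y = y' := by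
  have key : ∀ {n n' : ℕ} {y y' : Phase}, T.Returns x n y → T.Returns x n' y' → ¬ n < n' := by
    rintro n n' y y' ⟨-, hy, q, u, t, h1, h2, h3, -⟩ ⟨-, -, q', u', t', h1', -⟩ hlt
    obtain ⟨a, b, ha, t₁, w, hb, hw, -⟩ := h1'.exists_prefix hlt
    obtain rfl := hT.flatPath_unique ha h1
    obtain rfl := hb.unique h2
    rw [h3] at hw
    exact hT.arcPoint_not_wall hy w hw
  obtain rfl : n = n' := le_antisymm (not_lt.1 (key h' h)) (not_lt.1 (key h h'))
  refine ⟨rfl, ?_⟩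
  obtain ⟨-, hy, q, u, t, h1, h2, h3, h4⟩ := h
  obtain ⟨-, hy', q', u', t', h1', h2', h3', h4'⟩ := h'
  obtain ⟨rfl, rfl⟩ := Prod.mk.inj (hT.flatPath_unique h1 h1')
  obtain rfl := h2.unique h2'
  have hp : T.pos y = T.pos y' := h3.symm.trans h3'
  obtain ⟨e1, e2⟩ := hT.pos_inj hy hy' hp
  rw [e1, e2, h4'] at h4
  exact hT.phase_ext hy hy' hp h4.symm

theorem FirstHit.reverse {q u : ℂ} {t : ℝ} (hq : q ∈ T.boundary) (h : T.FirstHit q u t) :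
    T.FirstHit (q + t * u) (-u) t := by
  refine ⟨h.1, ?_, fun r hr hb => h.2.2 (t - r) ⟨by linarith [hr.2], by linarith [hr.1]⟩ ?_⟩
  · convert hq using 1; ring
  · convert hb using 1; push_cast; ring

theorem FlatPath.reverse {n : ℕ} {z z' : ℂ × ℂ} (h : T.FlatPath n z z') (hz : z.1 ∈ T.boundary)
    {t : ℝ} (ht : T.FirstHit z'.1 z'.2 t) :
    z'.1 ∈ T.boundary ∧ ∃ q₁ t₁, T.FlatPath n (z'.1 + t * z'.2, -z'.2) (q₁, -z.2) ∧
      T.FirstHit q₁ (-z.2) t₁ ∧ q₁ + t₁ * (-z.2) = z.1 := by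
  induction h generalizing t with
  | zero z =>
    exact ⟨hz, z.1 + t * z.2, t, .zero _, ht.reverse hz, by ring⟩
  | succ h1 h2 ih =>
    rename_i n z z' z''
    obtain ⟨t', w, hb, hw, rfl⟩ := h2
    obtain ⟨hz', q₁, t₁, h3, h4, h5⟩ := ih hz hb
    refine ⟨hb.2.1, q₁, t₁, ?_, h4, h5⟩
    refine FlatPath.cons ⟨t, w, ht.reverse hb.2.1, ?_, ?_⟩ h3
    · convert hw using 1; ring
    · rw [reflect_neg, reflect_reflect (norm_wallTangent w)]
      congr 1; ring

theorem pos_mem_boundary {x : Phase} (hx : x ∈ T.phaseSpace) : T.pos x ∈ T.boundary :=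
  (mem_boundary_iff _).2 (Or.inl ⟨x.1, x.2.1, Ioo_subset_Icc_self hx.1, rfl⟩)

/-- Time reversal conjugates the first-return map to its inverse. -/
theorem Returns.reverse {x y : Phase} {n : ℕ} (h : T.Returns x n y) :
    T.Returns (rev y) n (rev x) := by
  obtain ⟨hx, hy, q, u, t, h1, h2, h3, h4⟩ := h
  obtain ⟨-, q₁, t₁, a1, a2, a3⟩ := h1.reverse (pos_mem_boundary hx) h2
  refine ⟨rev_mem hy, rev_mem hx, q₁, -T.vel x, t₁, ?_, a2, a3, reflect_neg_vel x⟩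
  have hu := eq_neg_vel_rev h4
  rw [pos_rev, ← h3]
  convert a1 using 2
  rw [hu, neg_neg]

theorem Admissible.returnMap_eq (hT : T.Admissible) {x y : Phase} {n : ℕ} (h : T.Returns x n y) :
    T.returnMap x = y := by
  have hex : ∃ y, ∃ n, T.Returns x n y := ⟨y, n, h⟩
  rw [returnMap, dif_pos hex]
  exact (hT.returns_unique hex.choose_spec.choose_spec h).2

/-- The future of a line element determines its past. -/
theorem Admissible.returns_unique_left (hT : T.Admissible) {x x' y : Phase} {n n' : ℕ}
    (h : T.Returns x n y) (h' : T.Returns x' n' y) : n = n' ∧ x = x' := by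
  obtain ⟨h1, h2⟩ := hT.returns_unique h.reverse h'.reverse
  refine ⟨h1, ?_⟩
  rw [← rev_rev x, h2, rev_rev]

/-! ### Stability of trajectories -/

/-- Continuity of the first hit: perturbed rays stay in the interior near the start and near the
end by the assumptions there, and in between by compactness. -/
theorem Admissible.firstHit_stable (hT : T.Admissible) {P : Type*} [TopologicalSpace P] {p₀ : P}
    {q u : P → ℂ} {t : P → ℝ} (hq : ContinuousAt q p₀) (hu : ContinuousAt u p₀)
    (ht : ContinuousAt t p₀) (h0 : 0 < t p₀)
    (hstart : ∀ᶠ y : P × ℝ in 𝓝 p₀ ×ˢ 𝓝[>] 0, q y.1 + y.2 * u y.1 ∈ T.inside)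
    (hend : ∀ᶠ y : P × ℝ in 𝓝 p₀ ×ˢ 𝓝[>] 0,
      q y.1 + t y.1 * u y.1 + y.2 * (-u y.1) ∈ T.inside)
    (hmid : ∀ r ∈ Ioo 0 (t p₀), q p₀ + r * u p₀ ∈ T.inside)
    (hb : ∀ᶠ p in 𝓝 p₀, q p + t p * u p ∈ T.boundary) :
    ∀ᶠ p in 𝓝 p₀, T.FirstHit (q p) (u p) (t p) := by
  obtain ⟨A₁, hA₁, B₁, hB₁, h1⟩ := eventually_prod_iff.1 hstart
  obtain ⟨A₂, hA₂, B₂, hB₂, h2⟩ := eventually_prod_iff.1 hend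
  obtain ⟨ε₁, hε₁, hB₁⟩ := mem_nhdsGT_iff_exists_Ioo_subset.1 hB₁
  obtain ⟨ε₂, hε₂, hB₂⟩ := mem_nhdsGT_iff_exists_Ioo_subset.1 hB₂
  rw [mem_Ioi] at hε₁ hε₂
  have hcomp : ∀ᶠ p in 𝓝 p₀, ∀ r ∈ Icc ε₁ (t p₀ - ε₂ / 2), q p + (r : ℝ) * u p ∈ T.inside := by
    refine isCompact_Icc.eventually_forall_of_forall_eventually (fun r hr => ?_)
    have hc : ContinuousAt (fun z : P × ℝ => q z.1 + z.2 * u z.1) (p₀, r) :=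
      (ContinuousAt.comp (f := Prod.fst) (x := (p₀, r)) hq continuousAt_fst).add
        ((Complex.continuous_ofReal.comp continuous_snd).continuousAt.mul
          (ContinuousAt.comp (f := Prod.fst) (x := (p₀, r)) hu continuousAt_fst))
    exact hc.eventually (hT.isOpen_inside.mem_nhds
      (hmid r ⟨by linarith [hr.1], by linarith [hr.2]⟩))
  filter_upwards [hA₁, hA₂, hcomp, hb, ht.eventually_const_lt h0,
    ht.eventually_lt_const (show t p₀ < t p₀ + ε₂ / 2 by linarith)] with p a1 a2 a3 a4 a5 a6
  refine ⟨a5, a4, fun r hr => hT.inside_disjoint ?_⟩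
  rcases lt_or_ge r ε₁ with h | h
  · exact h1 a1 (hB₁ ⟨hr.1, h⟩)
  rcases lt_or_ge (t p - r) ε₂ with h' | h'
  · have := h2 a2 (hB₂ (show t p - r ∈ Ioo 0 ε₂ from ⟨by linarith [hr.2], h'⟩))
    convert this using 1
    push_cast
    ring
  · exact a3 r ⟨h, by linarith⟩

/-- The identity of the unfolding group. -/
def Fold.id : Fold := ((1 : ℤˣ), (0 : ℤ), (1 : ℤˣ), (0 : ℤ))

theorem foldAct_id (z : ℂ) : T.foldAct Fold.id z = z := by
  apply Complex.ext <;> simp [foldAct, sgn, Fold.id]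

theorem Fold.lin_id (u : ℂ) : Fold.id.lin u = u := by
  apply Complex.ext <;> simp [Fold.lin, sgn, Fold.id]

theorem continuous_pos (i : Arc) : Continuous fun p : ℝ × ℝ => T.pos (i, p) :=
  (T.continuous_arcPoint i).comp continuous_fst

theorem continuous_vel (i : Arc) : Continuous fun p : ℝ × ℝ => T.vel (i, p) := by
  have h : (fun p : ℝ × ℝ => T.vel (i, p)) = fun p =>
    T.normal i p.1 * Complex.exp (((-p.2 : ℝ) : ℂ) * Complex.I) := rfl
  have := (T.continuous_normal i).comp (continuous_fst (X := ℝ) (Y := ℝ))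
  rw [h]
  exact this.mul (by fun_prop)

theorem Fold.continuous_lin (g : Fold) : Continuous g.lin := by
  have : g.lin = fun u => ((sgn g.1 * u.re : ℝ) : ℂ) + ((sgn g.2.2.1 * u.im : ℝ) : ℂ) * Complex.I := by
    funext u; apply Complex.ext <;> simp [Fold.lin]
  rw [this]; fun_prop

theorem continuous_foldAct (g : Fold) : Continuous (T.foldAct g) := by
  have : T.foldAct g = fun z => T.foldAct g 0 + g.lin z := by
    funext z
    have := T.foldAct_add g 0 z 1
    simpa using this
  rw [this]; exact continuous_const.add g.continuous_lin

/-- Unfolded form of a path along flat components, together with the length of the path and its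
stability under perturbations of the initial line element. -/
theorem Admissible.flatPath_stable (hT : T.Admissible) {x : Phase} (hx : x ∈ T.phaseSpace) {n : ℕ}
    {q u : ℂ} (h : T.FlatPath n (T.pos x, T.vel x) (q, u)) :
    ∃ (g : Fold) (τ : ℝ × ℝ → ℝ), ContinuousAt τ x.2 ∧ 0 ≤ τ x.2 ∧
      (n = 0 → g = Fold.id ∧ τ x.2 = 0) ∧
      q = T.foldAct g (T.pos x + τ x.2 * T.vel x) ∧ u = g.lin (T.vel x) ∧
      (0 < n → T.StripTime q u (τ x.2) ∧ -T.l ≤ q.re ∧ q.re ≤ 1 + T.l) ∧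
      (∀ᶠ p in 𝓝 x.2, T.FlatPath n (T.pos (x.1, p), T.vel (x.1, p))
        (T.foldAct g (T.pos (x.1, p) + τ p * T.vel (x.1, p)), g.lin (T.vel (x.1, p)))) ∧
      ∀ᶠ y : (ℝ × ℝ) × ℝ in 𝓝 x.2 ×ˢ 𝓝[>] 0,
        T.foldAct g (T.pos (x.1, y.1) + τ y.1 * T.vel (x.1, y.1)) +
          y.2 * g.lin (T.vel (x.1, y.1)) ∈ T.inside := by
  generalize hz : (T.pos x, T.vel x) = z at h
  generalize hz' : (q, u) = z' at h
  have hpc : ContinuousAt (fun p => T.pos (x.1, p)) x.2 := (T.continuous_pos x.1).continuousAt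
  have hvc : ContinuousAt (fun p => T.vel (x.1, p)) x.2 := (T.continuous_vel x.1).continuousAt
  induction h generalizing q u with
  | zero z =>
    subst hz
    obtain ⟨rfl, rfl⟩ := Prod.mk.inj hz'
    refine ⟨Fold.id, fun _ => 0, continuousAt_const, le_rfl, fun _ => ⟨rfl, rfl⟩, ?_, ?_, ?_, ?_, ?_⟩
    · rw [foldAct_id]; simp
    · rw [Fold.lin_id]
    · intro h; omega
    · refine Eventually.of_forall fun p => ?_
      rw [foldAct_id, Fold.lin_id, Complex.ofReal_zero, zero_mul, add_zero]
      exact .zero _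
    · have h := hT.arc_inward (P := ℝ × ℝ) (p₀ := x.2) (i := x.1) (s := fun p => p.1)
        (u := fun p => T.vel (x.1, p)) continuousAt_fst hvc hx.1
        (by rw [vel_mul_conj_normal_re (T := T) (x.1, x.2)]; exact cos_pos_of_mem hx)
      filter_upwards [h] with y hy
      rw [foldAct_id, Fold.lin_id, Complex.ofReal_zero, zero_mul, add_zero]
      exact hy
  | succ h1 h2 ih =>
    rename_i n z z₁ z₂
    subst hz
    obtain ⟨q₁, u₁⟩ := z₁
    obtain ⟨ho, hu1⟩ := hT.flatPath_outgoing h1 (hT.outgoing_phase hx)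
    simp only [norm_vel] at ho hu1
    obtain ⟨g, τ, hτc, hτ0, hn0, hq, hu, hst, hpath, hstart⟩ := ih rfl rfl
    obtain ⟨t', w, hhit, hw, hz₂⟩ := h2
    simp only at hhit hw hz₂
    rw [hz₂] at hz'
    obtain ⟨rfl, rfl⟩ := Prod.mk.inj hz'
    obtain ⟨g', hg'⟩ := hT.fold_step w g
    obtain ⟨hg1, hg2⟩ := hg' hq hu hw
    have htr := hT.wall_hit ho hhit hw
    -- position and velocity of perturbed rays, and the time of their collision with the wall
    set Q : ℝ × ℝ → ℂ := fun p => T.foldAct g (T.pos (x.1, p) + τ p * T.vel (x.1, p)) with hQ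
    set U : ℝ × ℝ → ℂ := fun p => g.lin (T.vel (x.1, p)) with hU
    have hU0 : U x.2 = u₁ := hu.symm
    have hQ0 : Q x.2 = q₁ := hq.symm
    have hUc : ContinuousAt U x.2 := g.continuous_lin.continuousAt.comp hvc
    have hQc : ContinuousAt Q x.2 := (T.continuous_foldAct g).continuousAt.comp
      (hpc.add ((Complex.continuous_ofReal.continuousAt.comp hτc).mul hvc))
    set den : ℝ × ℝ → ℝ := fun p => (U p * conj (wallTangent w)).im with hden
    have hdenc : ContinuousAt den x.2 :=
      Complex.continuous_im.continuousAt.comp (hUc.mul continuousAt_const)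
    have hden0 : den x.2 < 0 := by rw [hden]; simp only [hU0]; exact htr
    set t : ℝ × ℝ → ℝ := fun p => -(T.wallCoord w (Q p)).im / den p with ht
    have htc : ContinuousAt t x.2 :=
      (Complex.continuous_im.continuousAt.comp
        ((T.continuous_wallCoord w).continuousAt.comp hQc)).neg.div hdenc hden0.ne
    have ht0 : t x.2 = t' := by
      have h3 := ((hT.mem_openSegment_iff w _).1 hw).1
      rw [wallCoord_ray] at h3
      simp only [ht, hden, hU0, hQ0]
      rw [div_eq_iff htr.ne]
      linarith
    have hZc : ContinuousAt (fun p => Q p + t p * U p) x.2 :=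
      hQc.add ((Complex.continuous_ofReal.continuousAt.comp htc).mul hUc)
    have hseg : ∀ᶠ p in 𝓝 x.2,
        Q p + t p * U p ∈ openSegment ℝ (T.wallStart w) (T.wallStop w) := by
      have hcr : ContinuousAt (fun p => (T.wallCoord w (Q p + t p * U p)).re) x.2 :=
        Complex.continuous_re.continuousAt.comp
          ((T.continuous_wallCoord w).continuousAt.comp hZc)
      have hre := ((hT.mem_openSegment_iff w _).1 hw).2
      rw [← hQ0, ← hU0, ← ht0] at hre
      filter_upwards [hdenc.eventually_lt_const hden0, hcr.eventually_const_lt hre.1,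
        hcr.eventually_lt_const hre.2] with p b1 b2 b3
      rw [hT.mem_openSegment_iff]
      refine ⟨?_, b2, b3⟩
      rw [wallCoord_ray]
      change (T.wallCoord w (Q p)).im + -(T.wallCoord w (Q p)).im / den p * den p = 0
      rw [div_mul_cancel₀ _ b1.ne]
      ring
    have hfirst : ∀ᶠ p in 𝓝 x.2, T.FirstHit (Q p) (U p) (t p) := by
      refine hT.firstHit_stable hQc hUc htc (by rw [ht0]; exact hhit.1) hstart ?_ ?_ ?_
      · refine hT.wall_inward hZc (u := fun p => -U p) hUc.neg hseg ?_
        show 0 < (-U x.2 * conj (wallTangent w)).im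
        rw [hU0, neg_mul, Complex.neg_im]; linarith
      · rw [ht0, hQ0, hU0]; exact hT.stays ho hhit
      · filter_upwards [hseg] with p hp
        exact (mem_boundary_iff _).2 (Or.inr ⟨w, openSegment_subset_segment _ _ _ hp⟩)
    have hfold : ∀ p, Q p + t p * U p ∈ openSegment ℝ (T.wallStart w) (T.wallStop w) →
        Q p + t p * U p = T.foldAct g' (T.pos (x.1, p) + (τ p + t p : ℝ) * T.vel (x.1, p)) ∧
          reflect (wallTangent w) (U p) = g'.lin (T.vel (x.1, p)) :=
      fun p hp => hg' rfl rfl hp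
    refine ⟨g', fun p => τ p + t p, hτc.add htc, ?_, ?_, ?_, hg2, ?_, ?_, ?_⟩
    · simp only; rw [ht0]; linarith [hhit.1]
    · intro h; omega
    · simp only; rw [ht0]; exact hg1
    · intro _
      simp only
      rw [ht0]
      have hb := hT.wall_bounds (openSegment_subset_segment _ _ _ hw)
      refine ⟨?_, hb.2.2.1, hb.2.2.2.1⟩
      rcases Nat.eq_zero_or_pos n with h0 | h0
      · obtain ⟨rfl, hτ0⟩ := hn0 h0
        rw [hτ0, zero_add]
        rw [hτ0, foldAct_id, Complex.ofReal_zero, zero_mul, add_zero] at hq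
        rw [hq] at hw ⊢
        obtain ⟨c1, c2, -⟩ := hT.pos_bounds hx
        exact hT.stripTime_start c1 c2 hu1 hhit.1 hw
      · obtain ⟨c1, c2⟩ := hst h0
        exact hT.stripTime_step hu1 hhit.1 c1 c2 hw
    · filter_upwards [hpath, hseg, hfirst] with p b1 b2 b3
      obtain ⟨c1, c2⟩ := hfold p b2
      rw [← c1, ← c2]
      exact .succ b1 ⟨t p, w, b3, b2, rfl⟩
    · have h := hT.wall_inward hZc (u := fun p => g'.lin (T.vel (x.1, p)))
        (g'.continuous_lin.continuousAt.comp hvc) hseg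
        (by
          change 0 < (g'.lin (T.vel x) * conj (wallTangent w)).im
          rw [← hg2, reflect_mul_conj]; linarith)
      filter_upwards [h, tendsto_fst.eventually hseg] with y b1 b2
      rw [← (hfold y.1 b2).1]
      exact b1

/-! ### The differential of the first-return map -/

theorem normal_mul_conj_vel (x : Phase) :
    T.normal x.1 x.2.1 * conj (T.vel x) = Real.cos x.2.2 + Real.sin x.2.2 * Complex.I := by
  have h := congrArg conj (vel_mul_conj_normal (T := T) x)
  simp only [map_mul, map_sub, Complex.conj_conj, Complex.conj_ofReal, Complex.conj_I] at h
  rw [mul_comm, h]; ring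

/-- Components of the inner normal along and across the incoming velocity. -/
theorem normal_mul_conj_incoming (y : Phase) :
    T.normal y.1 y.2.1 * conj (-T.vel (rev y)) = -Real.cos y.2.2 + Real.sin y.2.2 * Complex.I := by
  have h := normal_mul_conj_vel (T := T) (rev y)
  simp only [rev, Real.cos_neg, Real.sin_neg] at h ⊢
  rw [map_neg, mul_neg, h]; push_cast; ring

/-- Direction angle of the velocity, up to a constant depending on the component. -/
def angle (T : Table) (i : Arc) (p : ℝ × ℝ) : ℝ := T.curv i * p.1 - p.2

theorem tangent_shift (i : Arc) (s s' : ℝ) : T.tangent i s' =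
    T.tangent i s * Complex.exp ((T.curv i * (s' - s) : ℝ) * Complex.I) := by
  rw [tangent_eq, tangent_eq, mul_assoc, ← Complex.exp_add]
  congr 2
  unfold turn
  push_cast; ring

theorem vel_eq_exp (i : Arc) (p : ℝ × ℝ) : T.vel (i, p) =
    Complex.I * T.tangent i p.1 * Complex.exp (((-p.2 : ℝ) : ℂ) * Complex.I) := rfl

theorem vel_shift (i : Arc) (p p' : ℝ × ℝ) : T.vel (i, p') =
    T.vel (i, p) * Complex.exp ((T.angle i p' - T.angle i p : ℝ) * Complex.I) := by
  rw [vel_eq_exp, vel_eq_exp, T.tangent_shift i p.1 p'.1]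
  simp only [mul_assoc, ← Complex.exp_add]
  congr 3
  unfold angle
  push_cast; ring_nf

theorem Fold.lin_mul_exp (g : Fold) (v : ℂ) (a : ℝ) : g.lin (v * Complex.exp (a * Complex.I)) =
    g.lin v * Complex.exp ((g.det * a : ℝ) * Complex.I) := by
  have h1 : ∀ e : ℤˣ, sgn e * sgn e = 1 := sgn_mul_self
  have hc : Real.cos (g.det * a) = Real.cos a := by
    unfold Fold.det
    rcases sgn_cases g.1 with h | h <;> rcases sgn_cases g.2.2.1 with h' | h' <;> rw [h, h'] <;>
      simp
  have hs : Real.sin (g.det * a) = g.det * Real.sin a := by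
    unfold Fold.det
    rcases sgn_cases g.1 with h | h <;> rcases sgn_cases g.2.2.1 with h' | h' <;> rw [h, h'] <;>
      simp
  have hexp : ∀ b : ℝ, Complex.exp (b * Complex.I) = ⟨Real.cos b, Real.sin b⟩ := by
    intro b
    apply Complex.ext
    · rw [Complex.exp_ofReal_mul_I_re]
    · rw [Complex.exp_ofReal_mul_I_im]
  rw [hexp, hexp, hc, hs]
  apply Complex.ext <;> simp only [Fold.lin, Complex.mul_re, Complex.mul_im, Fold.det]
  · linear_combination (-sgn g.1 * v.im * Real.sin a) * (-h1 g.2.2.1)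
  · linear_combination (sgn g.2.2.1 * v.re * Real.sin a) * (-h1 g.1)

theorem reflect_mul_exp (τ u : ℂ) (a b : ℝ) :
    reflect (τ * Complex.exp (a * Complex.I)) (u * Complex.exp (b * Complex.I)) =
      reflect τ u * Complex.exp ((2 * a - b : ℝ) * Complex.I) := by
  have h : conj (Complex.exp (b * Complex.I)) = Complex.exp (-b * Complex.I) := by
    rw [← Complex.exp_conj]; simp
  have h2 : Complex.exp ((2 * a - b : ℝ) * Complex.I) =
      Complex.exp (a * Complex.I) ^ 2 * Complex.exp (-b * Complex.I) := by
    rw [← Complex.exp_nat_mul, ← Complex.exp_add]; congr 1; push_cast; ring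
  rw [reflect, reflect, map_mul, h, h2]; ring

/-- Data of a flight from `x` to `y`: the unfolding `g` along it and its length `d`. -/
structure IsFlight (T : Table) (x : Phase) (n : ℕ) (y : Phase) (g : Fold) (d : ℝ) : Prop where
  pos_len : 0 < d
  id_of_zero : n = 0 → g = Fold.id
  len_of_pos : 0 < n → 2 * T.l < d
  pos_eq : T.pos y = T.foldAct g (T.pos x + d * T.vel x)
  vel_eq : reflect (T.tangent y.1 y.2.1) (g.lin (T.vel x)) = T.vel y

/-- The differential of the first-return map, in terms of the length `d` of the flight and of its
parity `σ`: with `ξ = cos α ds` and `η = k ds - dα` before the flight, a family of rays has width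
`σ (d η - ξ)` and angular width `σ η` at its end. -/
def IsFlightDifferential (T : Table) (x y : Phase) (σ d : ℝ) (A : ℝ × ℝ →L[ℝ] ℝ × ℝ) : Prop :=
  ∀ v, Real.cos y.2.2 * (A v).1 =
      σ * (d * (T.curv x.1 * v.1 - v.2) - Real.cos x.2.2 * v.1) ∧
    T.curv y.1 * (A v).1 + (A v).2 = σ * (T.curv x.1 * v.1 - v.2)

theorem Admissible.pos_eq_center (hT : T.Admissible) (x : Phase) :
    T.pos x = T.center x.1 - T.normal x.1 x.2.1 / T.curv x.1 := hT.arcPoint_eq _ _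

/-- The flight from `x` to `y` survives perturbations of `x`, and depends differentiably on it. -/
theorem Admissible.returns_stable (hT : T.Admissible) {x y : Phase} {n : ℕ}
    (h : T.Returns x n y) : ∃ (g : Fold) (d : ℝ) (G : ℝ × ℝ → ℝ × ℝ) (A : ℝ × ℝ →L[ℝ] ℝ × ℝ),
      T.IsFlight x n y g d ∧ G x.2 = y.2 ∧ HasFDerivAt G A x.2 ∧
      T.IsFlightDifferential x y g.det d A ∧
      ∀ᶠ p in 𝓝 x.2, T.Returns (x.1, p) n (y.1, G p) := by
  obtain ⟨hx, hy, q, u, t₁, hpath, hhit, hpos, hvel⟩ := h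
  obtain ⟨ho, hu1⟩ := hT.flatPath_outgoing hpath (hT.outgoing_phase hx)
  simp only [norm_vel] at ho hu1
  obtain ⟨g, τ, hτc, hτ0, hn0, hq, hu, hst, hpaths, hstart⟩ := hT.flatPath_stable hx hpath
  set d := τ x.2 + t₁ with hd
  set k := T.curv x.1 with hk
  set k₁ := T.curv y.1 with hk₁
  have hkne : k ≠ 0 := hT.curv_ne _
  have hk₁ne : k₁ ≠ 0 := hT.curv_ne _
  have hpy : T.pos y = T.foldAct g (T.pos x + d * T.vel x) := by
    rw [← hpos, hq, hu, ← foldAct_add]; congr 1; rw [hd]; push_cast; ring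
  have hflight : T.IsFlight x n y g d := by
    refine ⟨by linarith [hhit.1], fun h => (hn0 h).1, fun h => ?_, hpy, by rw [← hu]; exact hvel⟩
    obtain ⟨b1, b2, -⟩ := hT.pos_bounds hy
    rw [← hpos] at b1 b2
    exact (hst h).1.lt hu1 hhit.1 b1 b2
  have hinc : u = -T.vel (rev y) := eq_neg_vel_rev hvel
  set σ := g.det with hσ
  have hσσ : σ * σ = 1 := g.det_mul_self
  obtain ⟨c', hc'⟩ := T.foldAct_surjective g (T.center y.1)
  -- the impact parameter of perturbed rays with respect to the circle carrying the arc of `y`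
  set W : ℂ := (c' - T.center x.1) * conj (T.vel x) with hW
  set φ : ℝ × ℝ → ℝ := fun p => T.angle x.1 p - T.angle x.1 x.2 with hφ
  set b : ℝ × ℝ → ℝ := fun p =>
    σ * (W.im * Real.cos (φ p) - W.re * Real.sin (φ p) + Real.sin p.2 / k) with hb
  have hvelp : ∀ p, T.vel (x.1, p) = T.vel x * Complex.exp (φ p * Complex.I) := fun p =>
    T.vel_shift x.1 x.2 p
  have hWp : ∀ p, (c' - T.pos (x.1, p)) * conj (T.vel (x.1, p)) =
      W * Complex.exp (((-φ p : ℝ) : ℂ) * Complex.I) +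
        (Real.cos p.2 + Real.sin p.2 * Complex.I) / k := by
    intro p
    have h1 := normal_mul_conj_vel (T := T) (x.1, p)
    have h2 : conj (Complex.exp (φ p * Complex.I)) =
        Complex.exp (((-φ p : ℝ) : ℂ) * Complex.I) := by
      rw [← Complex.exp_conj]; simp
    rw [hT.pos_eq_center, ← h1]
    simp only
    have h3 : (c' - T.center x.1) * conj (T.vel (x.1, p)) =
        W * Complex.exp (((-φ p : ℝ) : ℂ) * Complex.I) := by
      rw [hvelp, map_mul, h2, hW]; ring
    rw [← h3, ← hk]
    ring
  have hbp : ∀ p, ((T.center y.1 - T.foldAct g (T.pos (x.1, p))) *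
      conj (g.lin (T.vel (x.1, p)))).im = b p := by
    intro p
    rw [← hc', foldAct_sub, g.lin_mul_conj_im, hWp, Complex.add_im, Complex.div_ofReal_im,
      Complex.mul_im, Complex.exp_ofReal_mul_I_re, Complex.exp_ofReal_mul_I_im, hb]
    simp only [Real.cos_neg, Real.sin_neg, Complex.add_im, Complex.ofReal_im, Complex.mul_im,
      Complex.I_re, Complex.I_im, Complex.ofReal_re]
    ring
  have hφ0 : φ x.2 = 0 := sub_self _
  have hqu : T.pos y = T.foldAct g (T.pos x) + d * u := by rw [hpy, foldAct_add, hu]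
  have hcy : (T.center y.1 - T.foldAct g (T.pos x)) * conj u =
      d + (-Real.cos y.2.2 + Real.sin y.2.2 * Complex.I) / k₁ := by
    have h1 := normal_mul_conj_incoming (T := T) y
    rw [← hinc] at h1
    have h2 := hT.pos_eq_center y
    rw [hqu] at h2
    have h3 : u * conj u = 1 := by
      rw [Complex.mul_conj, Complex.normSq_eq_norm_sq, hu1]; simp
    rw [← h1]
    linear_combination (-conj u) * h2 + (d : ℂ) * h3
  have hre0 : W.re + Real.cos x.2.2 / k = d - Real.cos y.2.2 / k₁ := by
    have h1 := congrArg Complex.re hcy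
    have h2 := congrArg Complex.re (hWp x.2)
    rw [← hc', foldAct_sub, hu, g.lin_mul_conj_re] at h1
    rw [hφ0] at h2
    change ((c' - T.pos x) * conj (T.vel x)).re = _ at h2
    rw [h2] at h1
    simp only [Complex.add_re, Complex.div_ofReal_re, Complex.mul_re, Complex.ofReal_re,
      Complex.ofReal_im, Complex.I_re, Complex.I_im, Complex.neg_re, neg_zero, zero_mul,
      Complex.exp_zero, mul_one, mul_zero, sub_zero,
      Complex.ofReal_zero, add_zero] at h1
    rw [h1]; ring
  have hb0 : k₁ * b x.2 = Real.sin y.2.2 := by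
    have h1 := hbp x.2
    change ((T.center y.1 - T.foldAct g (T.pos x)) * conj (g.lin (T.vel x))).im = b x.2 at h1
    rw [← hu, hcy] at h1
    rw [← h1]
    simp only [Complex.add_im, Complex.div_ofReal_im, Complex.ofReal_im, Complex.mul_im,
      Complex.I_re, Complex.I_im, Complex.neg_im, neg_zero, Complex.ofReal_re]
    field_simp
    ring
  -- collision coordinates of perturbed rays: the angle comes from the impact parameter, and the
  -- arclength from the direction of the velocity, which changes by `σ φ`
  set α₁ : ℝ × ℝ → ℝ := fun p => Real.arcsin (k₁ * b p) with hα₁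
  set s₁ : ℝ × ℝ → ℝ := fun p => y.2.1 + (σ * φ p - (α₁ p - y.2.2)) / k₁ with hs₁
  have hα0 : α₁ x.2 = y.2.2 := by
    simp only [hα₁, hb0]
    exact Real.arcsin_sin hy.2.1.le hy.2.2.le
  have hs0 : s₁ x.2 = y.2.1 := by
    simp only [hs₁, hφ0, hα0]; simp
  have hcosy := cos_pos_of_mem hy
  have hsin : Real.sin y.2.2 ∈ Ioo (-1 : ℝ) 1 := by
    have := Real.sin_sq_add_cos_sq y.2.2
    constructor <;> nlinarith
  have hDφ : HasFDerivAt φ (k • ContinuousLinearMap.fst ℝ ℝ ℝ - ContinuousLinearMap.snd ℝ ℝ ℝ)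
      x.2 := by
    have h1 : HasFDerivAt (fun p : ℝ × ℝ => k * p.1 - p.2)
        (k • ContinuousLinearMap.fst ℝ ℝ ℝ - ContinuousLinearMap.snd ℝ ℝ ℝ) x.2 :=
      (hasFDerivAt_fst.const_mul k).sub hasFDerivAt_snd
    exact h1.sub_const _
  have hDb := (((hDφ.cos.const_mul W.im).sub (hDφ.sin.const_mul W.re)).add
    ((hasFDerivAt_snd (𝕜 := ℝ) (E := ℝ) (F := ℝ) (p := x.2)).sin.mul_const k⁻¹)).const_mul σ
  have hDb' : HasFDerivAt b _ x.2 := hDb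
  have hDα := (Real.hasDerivAt_arcsin (x := k₁ * b x.2) (by rw [hb0]; exact hsin.1.ne')
    (by rw [hb0]; exact hsin.2.ne)).comp_hasFDerivAt x.2 (hDb'.const_mul k₁)
  have hDα' : HasFDerivAt α₁ _ x.2 := hDα
  have hDs : HasFDerivAt s₁ _ x.2 :=
    (((hDφ.const_mul σ).sub (hDα'.sub_const y.2.2)).mul_const k₁⁻¹).const_add y.2.1
  have hsqrt : Real.sqrt (1 - Real.sin y.2.2 ^ 2) = Real.cos y.2.2 := by
    rw [← Real.cos_sq', Real.sqrt_sq hcosy.le]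
  refine ⟨g, d, fun p => (s₁ p, α₁ p), _, hflight, by simp only [hs0, hα0],
    hDs.prodMk hDα', ?_, ?_⟩
  · intro v
    simp only [ContinuousLinearMap.prod_apply, smul_apply,
      sub_apply, add_apply, ContinuousLinearMap.coe_fst',
      ContinuousLinearMap.coe_snd', smul_eq_mul, hφ0, Real.sin_zero, Real.cos_zero, hb0, hsqrt]
    have hcne := hcosy.ne'
    have hre1 : W.re = d - Real.cos y.2.2 / k₁ - Real.cos x.2.2 / k := by linarith
    rw [hre1]
    constructor
    · field_simp
      ring
    · field_simp
      ring
  · have hsc : ContinuousAt s₁ x.2 := hDs.continuousAt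
    have hαc : ContinuousAt α₁ x.2 := hDα'.continuousAt
    have hbc : ContinuousAt (fun p => k₁ * b p) x.2 := (hDb'.const_mul k₁).continuousAt
    have hpc : ContinuousAt (fun p => T.pos (x.1, p)) x.2 := (T.continuous_pos x.1).continuousAt
    have hvc : ContinuousAt (fun p => T.vel (x.1, p)) x.2 := (T.continuous_vel x.1).continuousAt
    set Y : ℝ × ℝ → Phase := fun p => (y.1, (s₁ p, α₁ p)) with hY
    have hY0 : Y x.2 = y := by simp only [hY, hs0, hα0]
    have hYmem : ∀ᶠ p in 𝓝 x.2, Y p ∈ T.phaseSpace := by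
      filter_upwards [hsc.eventually_const_lt (show 0 < s₁ x.2 by rw [hs0]; exact hy.1.1),
        hsc.eventually_lt_const (show s₁ x.2 < T.arcLen y.1 by rw [hs0]; exact hy.1.2),
        hαc.eventually_const_lt (show -(Real.pi / 2) < α₁ x.2 by rw [hα0]; exact hy.2.1),
        hαc.eventually_lt_const (show α₁ x.2 < Real.pi / 2 by rw [hα0]; exact hy.2.2)]
        with p a1 a2 a3 a4
      exact ⟨⟨a1, a2⟩, ⟨a3, a4⟩⟩
    have hXmem : ∀ᶠ p in 𝓝 x.2, (x.1, p) ∈ T.phaseSpace := by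
      have c1 : ContinuousAt (fun p : ℝ × ℝ => p.1) x.2 := continuousAt_fst
      have c2 : ContinuousAt (fun p : ℝ × ℝ => p.2) x.2 := continuousAt_snd
      filter_upwards [c1.eventually_const_lt hx.1.1, c1.eventually_lt_const hx.1.2,
        c2.eventually_const_lt hx.2.1, c2.eventually_lt_const hx.2.2] with p a1 a2 a3 a4
      exact ⟨⟨a1, a2⟩, ⟨a3, a4⟩⟩
    set U : ℝ × ℝ → ℂ := fun p => g.lin (T.vel (x.1, p)) with hU
    set Q : ℝ × ℝ → ℂ := fun p => T.foldAct g (T.pos (x.1, p) + τ p * T.vel (x.1, p)) with hQ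
    have hU0 : U x.2 = u := hu.symm
    have hQ0 : Q x.2 = q := hq.symm
    have hUc : ContinuousAt U x.2 := g.continuous_lin.continuousAt.comp hvc
    have hQc : ContinuousAt Q x.2 := (T.continuous_foldAct g).continuousAt.comp
      (hpc.add ((Complex.continuous_ofReal.continuousAt.comp hτc).mul hvc))
    have hk₁s : ∀ p, k₁ * (s₁ p - y.2.1) = σ * φ p - (α₁ p - y.2.2) := by
      intro p; simp only [hs₁]; field_simp; ring
    have hvelY : ∀ p, reflect (T.tangent y.1 (s₁ p)) (U p) = T.vel (Y p) := by
      intro p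
      have h1 : U p = g.lin (T.vel x) * Complex.exp ((σ * φ p : ℝ) * Complex.I) := by
        simp only [hU]; rw [hvelp, g.lin_mul_exp]
      have h2 := T.vel_shift y.1 y.2 (s₁ p, α₁ p)
      rw [h1, T.tangent_shift y.1 y.2.1 (s₁ p), reflect_mul_exp, hflight.vel_eq]
      change _ = T.vel (y.1, (s₁ p, α₁ p))
      rw [h2]
      congr 4
      rw [← hk₁, hk₁s]
      unfold angle
      simp only [← hk₁]
      linarith [hk₁s p]
    set Tp : ℝ × ℝ → ℝ := fun p =>
      ((T.pos (Y p) - T.foldAct g (T.pos (x.1, p))) * conj (U p)).re with hTp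
    have hU1 : ∀ p, U p * conj (U p) = 1 := by
      intro p
      rw [Complex.mul_conj, Complex.normSq_eq_norm_sq, hU]
      simp only [g.norm_lin, norm_vel]
      simp
    have hposY : ∀ᶠ p in 𝓝 x.2, T.pos (Y p) = T.foldAct g (T.pos (x.1, p)) + Tp p * U p := by
      filter_upwards [hbc.eventually_const_lt (show -1 < k₁ * b x.2 by rw [hb0]; exact hsin.1),
        hbc.eventually_lt_const (show k₁ * b x.2 < 1 by rw [hb0]; exact hsin.2)] with p a1 a2
      have h1 : U p = -T.vel (rev (Y p)) := eq_neg_vel_rev (hvelY p)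
      have h2 := normal_mul_conj_incoming (T := T) (Y p)
      rw [← h1] at h2
      have h3 := hbp p
      have h4 := hT.pos_eq_center (Y p)
      have h5 : Real.sin (α₁ p) = k₁ * b p := Real.sin_arcsin a1.le a2.le
      have h6 : ((T.pos (Y p) - T.foldAct g (T.pos (x.1, p))) * conj (U p)).im = 0 := by
        have h7 : (T.pos (Y p) - T.foldAct g (T.pos (x.1, p))) * conj (U p) =
            (T.center y.1 - T.foldAct g (T.pos (x.1, p))) * conj (U p) -
              (-Real.cos (α₁ p) + Real.sin (α₁ p) * Complex.I) / k₁ := by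
          rw [h4]
          linear_combination (-1 / (k₁ : ℂ)) * h2
        rw [h7, Complex.sub_im, h3, Complex.div_ofReal_im, h5]
        simp only [Complex.add_im, Complex.ofReal_im, Complex.mul_im,
          Complex.I_re, Complex.I_im, Complex.neg_im, neg_zero, Complex.ofReal_re]
        field_simp
        ring
      have h8 : ((Tp p : ℝ) : ℂ) =
          (T.pos (Y p) - T.foldAct g (T.pos (x.1, p))) * conj (U p) := by
        apply Complex.ext
        · simp [hTp]
        · rw [h6]; simp
      rw [h8]
      linear_combination (T.foldAct g (T.pos (x.1, p)) - T.pos (Y p)) * hU1 p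
    have hTpc : ContinuousAt Tp x.2 := by
      have hYc : ContinuousAt (fun p => T.pos (Y p)) x.2 :=
        (T.continuous_arcPoint y.1).continuousAt.comp hsc
      exact Complex.continuous_re.continuousAt.comp
        ((hYc.sub ((T.continuous_foldAct g).continuousAt.comp hpc)).mul
          (Complex.continuous_conj.continuousAt.comp hUc))
    have hTp0 : Tp x.2 = d := by
      have h1 : T.pos y - T.foldAct g (T.pos x) = d * u := by rw [hqu]; ring
      have h2 := hU1 x.2
      rw [hU0] at h2
      simp only [hTp]
      rw [hY0, hU0]
      change ((T.pos y - T.foldAct g (T.pos x)) * conj u).re = d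
      rw [h1, mul_assoc, h2]; simp
    have hQT : ∀ᶠ p in 𝓝 x.2, Q p + (Tp p - τ p : ℝ) * U p = T.pos (Y p) := by
      filter_upwards [hposY] with p hp
      rw [hp, hQ, hU]
      simp only
      rw [foldAct_add]; push_cast; ring
    have hhit0 : Tp x.2 - τ x.2 = t₁ := by rw [hTp0, hd]; ring
    have hfirst : ∀ᶠ p in 𝓝 x.2, T.FirstHit (Q p) (U p) (Tp p - τ p) := by
      refine hT.firstHit_stable hQc hUc (hTpc.sub hτc) (by rw [hhit0]; exact hhit.1) hstart ?_ ?_ ?_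
      · have h := hT.arc_inward (P := ℝ × ℝ) (p₀ := x.2) (i := y.1) (s := s₁)
          (u := fun p => -U p) hsc hUc.neg (by rw [hs0]; exact hy.1)
          (by
            rw [hU0, hinc, neg_neg, hs0]
            change 0 < (T.vel (rev y) * conj (T.normal (rev y).1 (rev y).2.1)).re
            rw [vel_mul_conj_normal_re (T := T) (rev y)]
            exact cos_pos_of_mem (rev_mem hy))
        filter_upwards [h, tendsto_fst.eventually hQT] with z b1 b2
        rw [b2]; exact b1
      · rw [hhit0, hQ0, hU0]; exact hT.stays ho hhit
      · filter_upwards [hQT, hYmem] with p b1 b2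
        rw [b1]; exact pos_mem_boundary b2
    filter_upwards [hXmem, hYmem, hpaths, hfirst, hQT] with p a1 a2 a3 a4 a5
    exact ⟨a1, a2, Q p, U p, _, a3, a4, a5, hvelY p⟩

/-! ### Flights without flat collisions -/

theorem normSq_normal (i : Arc) (s : ℝ) : Complex.normSq (T.normal i s) = 1 := by
  rw [Complex.normSq_eq_norm_sq, norm_normal]; norm_num

theorem normSq_smul_sub (a b : ℝ) {w n : ℂ} (hw : Complex.normSq w = 1)
    (hn : Complex.normSq n = 1) :
    Complex.normSq (a * w - b * n) = a ^ 2 + b ^ 2 - 2 * a * b * (w * conj n).re := by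
  rw [Complex.normSq_sub, Complex.normSq_mul, Complex.normSq_mul, hw, hn, Complex.normSq_ofReal,
    Complex.normSq_ofReal, map_mul, Complex.conj_ofReal]
  have : (a : ℂ) * w * (b * conj n) = ((a * b : ℝ) : ℂ) * (w * conj n) := by push_cast; ring
  rw [this, Complex.re_ofReal_mul]
  ring

theorem normSq_sq_le {z : ℂ} {r : ℝ} (h : ‖z‖ ≤ r) : Complex.normSq z ≤ r ^ 2 := by
  rw [Complex.normSq_eq_norm_sq]
  exact pow_le_pow_left₀ (norm_nonneg _) h 2

theorem norm_le_of_normSq {z : ℂ} {r : ℝ} (hr : 0 ≤ r) (h : Complex.normSq z ≤ r ^ 2) : ‖z‖ ≤ r := by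
  rw [Complex.normSq_eq_norm_sq] at h
  exact (pow_le_pow_iff_left₀ (norm_nonneg _) hr two_ne_zero).1 h

/-- A line through a point of a dispersing arc and a point of the focusing arc, pointing in the
direction `w` from the latter to the former, leaves `D₋₂` before `D₄`. -/
theorem Admissible.c1_bound (hT : T.Admissible) {i : Arc} (hi : i ≠ .bottom) {s s' : ℝ}
    (hs : s ∈ Icc 0 (T.arcLen i)) (hs' : s' ∈ Icc 0 (T.arcLen .bottom)) {w : ℂ} {d : ℝ}
    (hd : 0 < d) (hw : ‖w‖ = 1) (h : T.arcPoint i s = T.arcPoint .bottom s' + d * w)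
    (hc : (w * conj (T.normal i s)).re < 0) :
    d + -(w * conj (T.normal i s)).re / |T.curv i| ≤
      (w * conj (T.normal .bottom s')).re / (2 * T.kf) := by
  have hk : 0 < |T.curv i| := abs_pos.2 (hT.curv_ne i)
  have hkf := hT.kf_pos
  have hw1 : Complex.normSq w = 1 := by rw [Complex.normSq_eq_norm_sq, hw]; norm_num
  set c := -(w * conj (T.normal i s)).re with hcdef
  have hcpos : 0 < c := by rw [hcdef]; linarith
  set D := d + c / |T.curv i| with hD
  have hDpos : 0 < D := by positivity
  have hmem : T.arcPoint .bottom s' + D * w ∈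
      lineInter (T.arcPoint i s) (T.arcPoint .bottom s') (T.disc (-2) i s) := by
    constructor
    · have h1 := AffineMap.lineMap_mem_affineSpan_pair (-(c / |T.curv i|) / d) (T.arcPoint i s)
        (T.arcPoint .bottom s')
      have hd' : (d : ℂ) ≠ 0 := by exact_mod_cast hd.ne'
      have h2 : T.arcPoint .bottom s' + D * w = AffineMap.lineMap (T.arcPoint i s)
          (T.arcPoint .bottom s') (-(c / |T.curv i|) / d) := by
        rw [AffineMap.lineMap_apply_module', h, Complex.real_smul, hD]
        push_cast
        field_simp
        ring
      rw [h2]; exact h1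
    · rw [disc, mem_closedBall_iff_norm]
      have h1 : T.arcPoint .bottom s' + D * w - (T.arcPoint i s +
          ((1 / (-2 * |T.curv i|) : ℝ) : ℂ) * T.normal i s) =
          ((c / |T.curv i| : ℝ) : ℂ) * w - ((1 / (-2 * |T.curv i|) : ℝ) : ℂ) * T.normal i s := by
        rw [h, hD]; push_cast; ring
      rw [h1]
      apply norm_le_of_normSq (by positivity)
      rw [normSq_smul_sub _ _ hw1 (T.normSq_normal i s), show (w * conj (T.normal i s)).re = -c by
        rw [hcdef]; ring, show |-2 * T.curv i| = 2 * |T.curv i| by rw [abs_mul]; norm_num]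
      apply le_of_eq
      field_simp
      ring
  have h2 := hT.c1 i hi s hs s' hs' hmem
  rw [disc, mem_closedBall_iff_norm] at h2
  have hb : |T.curv .bottom| = T.kf := abs_of_pos hkf
  have h3 : T.arcPoint .bottom s' + D * w - (T.arcPoint .bottom s' +
          ((1 / (4 * |T.curv .bottom|) : ℝ) : ℂ) * T.normal .bottom s') =
          (D : ℂ) * w - ((1 / (4 * |T.curv .bottom|) : ℝ) : ℂ) * T.normal .bottom s' := by
    ring
  rw [h3] at h2
  have h4 := normSq_sq_le h2
  rw [normSq_smul_sub _ _ hw1 (T.normSq_normal _ s'), abs_mul, hb, abs_of_pos (by norm_num : (0:ℝ) < 4)]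
    at h4
  rw [le_div_iff₀ (by positivity)]
  have h5 : D * (D * (2 * T.kf)) ≤ D * (w * conj (T.normal .bottom s')).re := by
    have h6 : D ^ 2 ≤ 2 * D * (1 / (4 * T.kf)) * (w * conj (T.normal .bottom s')).re := by linarith
    have h7 := mul_le_mul_of_nonneg_right h6 (show 0 ≤ 2 * T.kf by positivity)
    have h8 : 2 * D * (1 / (4 * T.kf)) * (w * conj (T.normal .bottom s')).re * (2 * T.kf) =
        D * (w * conj (T.normal .bottom s')).re := by field_simp; ring
    rw [h8] at h7
    linarith
  exact le_of_mul_le_mul_left h5 hDpos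

theorem IsFlight.direct {x y : Phase} {g : Fold} {d : ℝ} (h : T.IsFlight x 0 y g d) :
    T.pos y = T.pos x + d * T.vel x ∧ T.vel x = -T.vel (rev y) := by
  have hg := h.id_of_zero rfl
  have h1 := h.pos_eq
  have h2 := h.vel_eq
  rw [hg, foldAct_id] at h1
  rw [hg, Fold.lin_id] at h2
  exact ⟨h1, eq_neg_vel_rev h2⟩

theorem vel_rev_mul_conj_normal_re (y : Phase) :
    (T.vel (rev y) * conj (T.normal y.1 y.2.1)).re = Real.cos y.2.2 := by
  have := vel_mul_conj_normal_re (T := T) (rev y)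
  simpa [rev] using this

/-- The consequence of the condition on `D₋₂` and `D₄` for flights from a dispersing arc to the
focusing arc. -/
theorem Admissible.c1_down (hT : T.Admissible) {x y : Phase} (hx : x ∈ T.phaseSpace)
    (hy : y ∈ T.phaseSpace) (hxi : x.1 ≠ .bottom) (hyi : y.1 = .bottom) {g : Fold} {d : ℝ}
    (h : T.IsFlight x 0 y g d) :
    d + Real.cos x.2.2 / |T.curv x.1| ≤ Real.cos y.2.2 / (2 * T.kf) := by
  obtain ⟨h1, h2⟩ := h.direct
  have hb := hT.c1_bound hxi (s := x.2.1) (s' := y.2.1) (Ioo_subset_Icc_self hx.1)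
    (by rw [← hyi]; exact Ioo_subset_Icc_self hy.1) (w := -T.vel x) h.pos_len
    (by rw [norm_neg, norm_vel])
    (by
      rw [← hyi]
      change T.pos x = T.pos y + _
      rw [h1]; ring)
    (by
      rw [neg_mul, Complex.neg_re, vel_mul_conj_normal_re]
      linarith [cos_pos_of_mem hx])
  rw [neg_mul, Complex.neg_re, vel_mul_conj_normal_re, neg_neg, h2, neg_neg, ← hyi,
    vel_rev_mul_conj_normal_re] at hb
  exact hb

theorem Admissible.c1_up (hT : T.Admissible) {x y : Phase} (hx : x ∈ T.phaseSpace)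
    (hy : y ∈ T.phaseSpace) (hxi : x.1 = .bottom) (hyi : y.1 ≠ .bottom) {g : Fold} {d : ℝ}
    (h : T.IsFlight x 0 y g d) :
    d + Real.cos y.2.2 / |T.curv y.1| ≤ Real.cos x.2.2 / (2 * T.kf) := by
  obtain ⟨h1, h2⟩ := h.direct
  have hv : (T.vel x * conj (T.normal y.1 y.2.1)).re = -Real.cos y.2.2 := by
    rw [h2, neg_mul, Complex.neg_re, vel_rev_mul_conj_normal_re]
  have hb := hT.c1_bound hyi (s := y.2.1) (s' := x.2.1) (Ioo_subset_Icc_self hy.1)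
    (by rw [← hxi]; exact Ioo_subset_Icc_self hx.1) (w := T.vel x) h.pos_len
    (norm_vel _)
    (by
      rw [← hxi]
      exact h1)
    (by rw [hv]; linarith [cos_pos_of_mem hy])
  rw [hv, neg_neg, ← hxi, vel_mul_conj_normal_re] at hb
  exact hb

/-- A direct flight on the focusing arc is a chord: the angle is preserved, and it determines the
length of the chord and the angle subtended by it. -/
theorem Admissible.chord (hT : T.Admissible) {x y : Phase} (hx : x ∈ T.phaseSpace)
    (hy : y ∈ T.phaseSpace) (hxi : x.1 = .bottom) (hyi : y.1 = .bottom) {g : Fold} {d : ℝ}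
    (h : T.IsFlight x 0 y g d) :
    T.kf * d = 2 * Real.cos x.2.2 ∧ y.2.2 = x.2.2 ∧
      Complex.exp ((T.kf * (y.2.1 - x.2.1) : ℝ) * Complex.I) =
        -Complex.exp (((-2 * x.2.2 : ℝ) : ℂ) * Complex.I) := by
  obtain ⟨h1, h2⟩ := h.direct
  obtain ⟨i, s, α⟩ := x
  obtain ⟨j, s', α'⟩ := y
  obtain rfl : i = .bottom := hxi
  obtain rfl : j = .bottom := hyi
  have hkf := hT.kf_pos
  have hkc : (T.kf : ℂ) ≠ 0 := by exact_mod_cast hkf.ne'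
  have hkd : T.kf * d = 2 * Real.cos α := by
    have h3 := hT.circlePow_ray .bottom s d (T.vel (.bottom, (s, α)))
    change T.curv .bottom * T.circlePow .bottom (T.pos (.bottom, (s, α)) + _) = _ at h3
    rw [← h1, pos, hT.circlePow_arcPoint, Complex.normSq_eq_norm_sq, norm_vel,
      vel_mul_conj_normal_re (T := T) (.bottom, (s, α))] at h3
    simp only [curv, mul_zero, one_pow, mul_one] at h3
    have h4 := (mul_eq_zero.1 h3.symm).resolve_left h.pos_len.ne'
    linarith
  have e1 := normal_mul_conj_vel (T := T) (.bottom, (s, α))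
  have e2 := normal_mul_conj_incoming (T := T) (.bottom, (s', α'))
  rw [← h2] at e2
  have e3 := hT.pos_eq_center (.bottom, (s, α))
  have e4 := hT.pos_eq_center (.bottom, (s', α'))
  simp only [curv] at e1 e2 e3 e4
  have huu : T.vel (.bottom, (s, α)) * conj (T.vel (.bottom, (s, α))) = 1 := by
    rw [Complex.mul_conj, Complex.normSq_eq_norm_sq, norm_vel]; simp
  have hn : T.normal .bottom s' = T.normal .bottom s - T.kf * d * T.vel (.bottom, (s, α)) := by
    rw [e3, e4] at h1
    field_simp at h1
    linear_combination -h1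
  have hsin : Real.sin α' = Real.sin α := by
    have h5 : (-Real.cos α' + Real.sin α' * Complex.I : ℂ) =
        Real.cos α + Real.sin α * Complex.I - T.kf * d := by
      rw [← e2, ← e1, hn]
      linear_combination (-(T.kf : ℂ) * d) * huu
    have h6 := congrArg Complex.im h5
    simpa [-Complex.ofReal_sin, -Complex.ofReal_cos] using h6
  refine ⟨hkd, Real.injOn_sin ⟨hy.2.1.le, hy.2.2.le⟩ ⟨hx.2.1.le, hx.2.2.le⟩ hsin, ?_⟩
  have hts := T.tangent_shift .bottom s s'
  have htt := T.tangent_mul_conj .bottom s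
  have ht0 : T.tangent .bottom s ≠ 0 := by
    intro h0; rw [h0, zero_mul] at htt; exact zero_ne_one htt
  have hv := vel_eq (T := T) (.bottom, (s, α))
  simp only [curv] at hts
  have hkd' : (T.kf : ℂ) * d = 2 * Real.cos α := by exact_mod_cast hkd
  rw [normal, normal, hv, hkd', hts] at hn
  have hcs : (Real.sin α : ℂ) ^ 2 + (Real.cos α : ℂ) ^ 2 = 1 := by
    exact_mod_cast Real.sin_sq_add_cos_sq α
  have hexp : Complex.exp (((-2 * α : ℝ) : ℂ) * Complex.I) =
      (Real.cos α - Real.sin α * Complex.I) ^ 2 := by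
    have : (((-2 * α : ℝ) : ℂ) * Complex.I) = ((2 : ℕ) : ℂ) * (((-α : ℝ) : ℂ) * Complex.I) := by
      push_cast; ring
    rw [this, Complex.exp_nat_mul, Complex.exp_mul_I, ← Complex.ofReal_cos, ← Complex.ofReal_sin,
      Real.cos_neg, Real.sin_neg]
    push_cast; ring
  rw [hexp]
  apply mul_left_cancel₀ (mul_ne_zero Complex.I_ne_zero ht0)
  simp only at hn
  have hI := Complex.I_sq
  linear_combination hn - Complex.I * T.tangent .bottom s * hcs +
    (Complex.I * T.tangent .bottom s * (Real.sin α : ℂ) ^ 2 -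
      2 * (Real.cos α : ℂ) * Real.sin α * T.tangent .bottom s) * hI

/-! ### The cones in coordinates -/

theorem div_le_div_left_neg {c a b : ℝ} (hc : 0 < c) (ha : a < 0) (hb : b < 0) :
    c / a ≤ c / b ↔ b ≤ a := by
  rw [div_eq_mul_one_div, div_eq_mul_one_div c b, mul_le_mul_iff_right₀ hc]
  exact one_div_le_one_div_of_neg ha hb

/-- The cones `C₀`, `C₁` and `C₂` are given by quadratic forms. -/
theorem mem_cone0_iff {x : Phase} (hc : 0 < Real.cos x.2.2) (hk : T.curv x.1 < 0) (v : ℝ × ℝ) :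
    v ∈ T.cone0 x ↔ 0 ≤ v.1 * v.2 := by
  obtain ⟨a, b⟩ := v
  simp only [cone0, focal, mem_ofPred_eq, abs_of_neg hk]
  by_cases ha : a = 0
  · subst ha
    simp only [if_true, zero_mul, le_refl, iff_true]
    refine Or.inr ⟨0, rfl, ?_, le_rfl⟩
    rw [neg_nonpos]; exact div_nonneg hc.le (by linarith)
  have ha2 : 0 < a ^ 2 := by positivity
  have hab : a * b = a ^ 2 * (b / a) := by field_simp
  have hv : ((a, b) : ℝ × ℝ) ≠ 0 := by simp [ha]
  rw [hab, mul_nonneg_iff_of_pos_left ha2]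
  simp only [ha, if_false, hv, false_or]
  by_cases hD : T.curv x.1 - b / a = 0
  · simp only [hD, if_true]
    constructor
    · rintro ⟨f, hf, -⟩; exact absurd hf (OnePoint.infty_ne_coe f)
    · intro h; linarith
  · simp only [hD, if_false]
    constructor
    · rintro ⟨f, hf, h1, h2⟩
      rw [OnePoint.coe_eq_coe] at hf
      subst hf
      have hDneg : T.curv x.1 - b / a < 0 := by
        by_contra hn
        have : 0 < T.curv x.1 - b / a := lt_of_le_of_ne (not_lt.1 hn) (Ne.symm hD)
        have := div_pos hc this
        linarith
      rw [div_neg, neg_neg, div_le_div_left_neg hc hk hDneg] at h1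
      nlinarith
    · intro h
      have hDneg : T.curv x.1 - b / a < 0 := by linarith
      refine ⟨_, rfl, ?_, (div_neg_of_pos_of_neg hc hDneg).le⟩
      rw [div_neg, neg_neg, div_le_div_left_neg hc hk hDneg]
      nlinarith

theorem mem_cone1_iff {x : Phase} (hc : 0 < Real.cos x.2.2) (v : ℝ × ℝ) :
    v ∈ T.cone1 x ↔ v.1 * (T.curv x.1 * v.1 - v.2) ≤ 0 := by
  obtain ⟨a, b⟩ := v
  simp only [cone1, focal, mem_ofPred_eq]
  by_cases ha : a = 0
  · subst ha
    simp only [if_true, zero_mul, le_refl, iff_true]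
    exact Or.inr (Or.inr ⟨0, rfl, le_rfl⟩)
  have ha2 : 0 < a ^ 2 := by positivity
  have hab : a * (T.curv x.1 * a - b) = a ^ 2 * (T.curv x.1 - b / a) := by field_simp
  have hv : ((a, b) : ℝ × ℝ) ≠ 0 := by simp [ha]
  rw [hab, mul_nonpos_iff_pos_imp_nonpos]
  simp only [ha, if_false, hv, false_or]
  by_cases hD : T.curv x.1 - b / a = 0
  · simp [hD]
  · simp only [hD, if_false]
    constructor
    · rintro (h | ⟨f, hf, h1⟩)
      · exact absurd h.symm (OnePoint.infty_ne_coe _)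
      rw [OnePoint.coe_eq_coe] at hf
      subst hf
      have hDneg : T.curv x.1 - b / a ≤ 0 := by
        by_contra hn
        have := div_pos hc (not_le.1 hn)
        linarith
      exact ⟨fun _ => hDneg, fun h => by linarith⟩
    · rintro ⟨h, -⟩
      exact Or.inr ⟨_, rfl, div_nonpos_of_nonneg_of_nonpos hc.le (h ha2)⟩

theorem mem_cone2_iff {x : Phase} (hc : 0 < Real.cos x.2.2) (hk : 0 < T.curv x.1) (v : ℝ × ℝ) :
    v ∈ T.cone2 x ↔ v.2 * (T.curv x.1 * v.1 + v.2) ≤ 0 := by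
  obtain ⟨a, b⟩ := v
  simp only [cone2, focal, mem_ofPred_eq, abs_of_pos hk]
  by_cases ha : a = 0
  · subst ha
    simp only [if_true, mul_zero, zero_add]
    constructor
    · rintro (h | ⟨f, hf, h1, -⟩)
      · simp [(Prod.mk.inj h).2]
      · rw [OnePoint.coe_eq_coe] at hf
        subst hf
        have : 0 < Real.cos x.2.2 / (2 * T.curv x.1) := by positivity
        linarith
    · intro h
      have : b = 0 := by nlinarith
      simp [this]
  have ha2 : 0 < a ^ 2 := by positivity
  have hab : b * (T.curv x.1 * a + b) = a ^ 2 * (b / a * (T.curv x.1 + b / a)) := by field_simp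
  have hv : ((a, b) : ℝ × ℝ) ≠ 0 := by simp [ha]
  have hpos : a ^ 2 * (b / a * (T.curv x.1 + b / a)) ≤ 0 ↔ b / a * (T.curv x.1 + b / a) ≤ 0 :=
    ⟨fun h => by by_contra hn; nlinarith [mul_pos ha2 (not_le.1 hn)],
      fun h => mul_nonpos_of_nonneg_of_nonpos ha2.le h⟩
  rw [hab, hpos]
  simp only [ha, if_false, hv, false_or]
  by_cases hD : T.curv x.1 - b / a = 0
  · simp only [hD, if_true]
    constructor
    · rintro ⟨f, hf, -⟩; exact absurd hf (OnePoint.infty_ne_coe f)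
    · intro h
      have : b / a = T.curv x.1 := by linarith
      rw [this] at h; nlinarith
  · simp only [hD, if_false]
    constructor
    · rintro ⟨f, hf, h1, h2⟩
      rw [OnePoint.coe_eq_coe] at hf
      subst hf
      have hDpos : 0 < T.curv x.1 - b / a := by
        by_contra hn
        have h3 := div_nonpos_of_nonneg_of_nonpos hc.le (not_lt.1 hn)
        have : 0 < Real.cos x.2.2 / (2 * T.curv x.1) := by positivity
        linarith
      rw [div_le_div_iff_of_pos_left hc (by positivity) hDpos] at h1
      rw [div_le_div_iff_of_pos_left hc hDpos hk] at h2
      nlinarith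
    · intro h
      have h1 : b / a ≤ 0 := by by_contra hn; nlinarith
      have h2 : -T.curv x.1 ≤ b / a := by by_contra hn; nlinarith
      have hDpos : 0 < T.curv x.1 - b / a := by linarith
      refine ⟨_, rfl, ?_, ?_⟩
      · rw [div_le_div_iff_of_pos_left hc (by positivity) hDpos]; linarith
      · rw [div_le_div_iff_of_pos_left hc hDpos hk]; linarith

/-! ### Invariance of the cones -/

theorem form_nonneg {p q p' q' a b : ℝ} (hab : 0 ≤ a * b) (hp : 0 ≤ p) (hq : 0 ≤ q) (hp' : 0 ≤ p')
    (hq' : 0 ≤ q') : 0 ≤ (p * a + q * b) * (p' * a + q' * b) := by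
  have h : (p * a + q * b) * (p' * a + q' * b) =
      p * p' * a ^ 2 + (p * q' + q * p') * (a * b) + q * q' * b ^ 2 := by ring
  rw [h]; positivity

theorem form_pos {p q p' q' a b : ℝ} (hab : 0 ≤ a * b) (h0 : a ≠ 0 ∨ b ≠ 0) (hp : 0 < p)
    (hq : 0 < q) (hp' : 0 < p') (hq' : 0 < q') : 0 < (p * a + q * b) * (p' * a + q' * b) := by
  have h : (p * a + q * b) * (p' * a + q' * b) =
      p * p' * a ^ 2 + (p * q' + q * p') * (a * b) + q * q' * b ^ 2 := by ring
  rw [h]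
  rcases h0 with h0 | h0 <;> positivity

theorem mem_interior_cone0 {x : Phase} (hc : 0 < Real.cos x.2.2) (hk : T.curv x.1 < 0) {v : ℝ × ℝ}
    (h : 0 < v.1 * v.2) : v ∈ interior (T.cone0 x) := by
  have ho : IsOpen {v : ℝ × ℝ | 0 < v.1 * v.2} := isOpen_lt (by fun_prop) (by fun_prop)
  exact interior_maximal (fun w hw => (mem_cone0_iff hc hk w).2 (le_of_lt hw)) ho h

theorem mem_interior_cone1 {x : Phase} (hc : 0 < Real.cos x.2.2) {v : ℝ × ℝ}
    (h : v.1 * (T.curv x.1 * v.1 - v.2) < 0) : v ∈ interior (T.cone1 x) := by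
  have ho : IsOpen {v : ℝ × ℝ | v.1 * (T.curv x.1 * v.1 - v.2) < 0} :=
    isOpen_lt (by fun_prop) (by fun_prop)
  exact interior_maximal (fun w hw => (mem_cone1_iff hc w).2 (le_of_lt hw)) ho h

theorem mem_interior_cone2 {x : Phase} (hc : 0 < Real.cos x.2.2) (hk : 0 < T.curv x.1) {v : ℝ × ℝ}
    (h : v.2 * (T.curv x.1 * v.1 + v.2) < 0) : v ∈ interior (T.cone2 x) := by
  have ho : IsOpen {v : ℝ × ℝ | v.2 * (T.curv x.1 * v.1 + v.2) < 0} :=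
    isOpen_lt (by fun_prop) (by fun_prop)
  exact interior_maximal (fun w hw => (mem_cone2_iff hc hk w).2 (le_of_lt hw)) ho h

/-- The forms defining the cones at the end of a flight, in terms of the angular width `η` of the
family of rays and of its final width `J`, up to sign. -/
theorem IsFlightDifferential.forms {x y : Phase} {g : Fold} {d : ℝ} {A : ℝ × ℝ →L[ℝ] ℝ × ℝ}
    (h : T.IsFlightDifferential x y g.det d A) (v : ℝ × ℝ) {η J : ℝ}
    (hη : η = T.curv x.1 * v.1 - v.2) (hJ : J = d * η - Real.cos x.2.2 * v.1) :
    Real.cos y.2.2 ^ 2 * ((A v).1 * (A v).2) = J * (Real.cos y.2.2 * η - T.curv y.1 * J) ∧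
      Real.cos y.2.2 ^ 2 * ((A v).1 * (T.curv y.1 * (A v).1 - (A v).2)) =
        J * (2 * T.curv y.1 * J - Real.cos y.2.2 * η) ∧
      Real.cos y.2.2 * ((A v).2 * (T.curv y.1 * (A v).1 + (A v).2)) =
        (Real.cos y.2.2 * η - T.curv y.1 * J) * η := by
  obtain ⟨h1, h2⟩ := h v
  have hs := g.det_mul_self
  rw [← hη] at h1 h2
  rw [← hJ] at h1
  set c := Real.cos y.2.2
  set p := (A v).1
  set r := (A v).2
  set σ := g.det
  set k := T.curv y.1
  have h3 : c * r = σ * (c * η - k * J) := by linear_combination c * h2 - k * h1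
  refine ⟨?_, ?_, ?_⟩
  · linear_combination c * r * h1 + σ * J * h3 + J * (c * η - k * J) * hs
  · linear_combination (c * (k * p - r) + k * σ * J) * h1 - σ * J * h3 +
      J * (2 * k * J - c * η) * hs
  · rw [h2]; linear_combination σ * η * h3 + η * (c * η - k * J) * hs

theorem curv_bottom {x : Phase} (h : x.1 = .bottom) : T.curv x.1 = T.kf := by rw [h]; rfl

theorem curv_disp {x : Phase} (h : x.1 ≠ .bottom) : T.curv x.1 = T.kd := by
  obtain ⟨i, p⟩ := x
  cases i
  · exact absurd rfl h
  all_goals rfl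

theorem coneBundle_disp {x : Phase} (h : x.1 ≠ .bottom) : T.coneBundle x = T.cone0 x := by
  simp [coneBundle, h]

theorem coneBundle_bottom {x : Phase} (h : x.1 = .bottom) :
    T.coneBundle x = T.cone1 x ∨ T.coneBundle x = T.cone2 x := by
  simp only [coneBundle, h, ne_eq, not_true_eq_false, if_false]
  split_ifs
  · exact Or.inl rfl
  · exact Or.inr rfl

theorem coneBundle_of_direct {x y : Phase} (hx : x.1 ≠ .bottom)
    (hy : y.1 = .bottom) (h : T.Returns x 0 y) : T.coneBundle y = T.cone1 y := by
  have : ∃ x : Phase, x.1 ≠ .bottom ∧ T.Returns x 0 y := ⟨x, hx, h⟩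
  simp [coneBundle, hy, this]

theorem Admissible.coneBundle_of_not_direct (hT : T.Admissible) {x y : Phase} {n : ℕ}
    (hy : y.1 = .bottom) (h : T.Returns x n y) (hn : x.1 = .bottom ∨ 0 < n) :
    T.coneBundle y = T.cone2 y := by
  have : ¬ ∃ x : Phase, x.1 ≠ .bottom ∧ T.Returns x 0 y := by
    rintro ⟨x', hx', h'⟩
    obtain ⟨e1, e2⟩ := hT.returns_unique_left h h'
    subst e1 e2
    rcases hn with hn | hn
    · exact hx' hn
    · exact lt_irrefl _ hn
  simp [coneBundle, hy, this]

/-- Direct flights from the focusing arc at `x` to a dispersing arc for which `D₋₂` and `D₄` end at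
the same point of the ray. -/
def tight (T : Table) : Set Phase :=
  {x | x ∈ T.phaseSpace ∧ x.1 = .bottom ∧ ∃ (y : Phase) (d : ℝ), y ∈ T.phaseSpace ∧
    y.1 ≠ .bottom ∧ 0 < d ∧ T.pos y = T.pos x + d * T.vel x ∧ T.vel x = -T.vel (rev y) ∧
    d + Real.cos y.2.2 / |T.curv y.1| = Real.cos x.2.2 / (2 * T.kf)}

theorem Admissible.c1_up_lt (hT : T.Admissible) {x y : Phase} (hx : x ∈ T.phaseSpace)
    (hy : y ∈ T.phaseSpace) (hxi : x.1 = .bottom) (hyi : y.1 ≠ .bottom) {g : Fold} {d : ℝ}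
    (h : T.IsFlight x 0 y g d) (ht : x ∉ T.tight) :
    d + Real.cos y.2.2 / |T.curv y.1| < Real.cos x.2.2 / (2 * T.kf) := by
  refine lt_of_le_of_ne (hT.c1_up hx hy hxi hyi h) fun he => ht ?_
  exact ⟨hx, hxi, y, d, hy, hyi, h.pos_len, h.direct.1, h.direct.2, he⟩

theorem Admissible.c1_down_lt (hT : T.Admissible) {x y : Phase} (hx : x ∈ T.phaseSpace)
    (hy : y ∈ T.phaseSpace) (hxi : x.1 ≠ .bottom) (hyi : y.1 = .bottom) {g : Fold} {d : ℝ}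
    (h : T.IsFlight x 0 y g d) (ht : rev y ∉ T.tight) :
    d + Real.cos x.2.2 / |T.curv x.1| < Real.cos y.2.2 / (2 * T.kf) := by
  refine lt_of_le_of_ne (hT.c1_down hx hy hxi hyi h) fun he => ht ?_
  obtain ⟨h1, h2⟩ := h.direct
  refine ⟨rev_mem hy, hyi, rev x, d, rev_mem hx, hxi, h.pos_len, ?_, ?_, ?_⟩
  · rw [pos_rev, pos_rev, h1, h2]; ring
  · rw [rev_rev, h2, neg_neg]
  · simpa [rev] using he

/-- Angular and final width of a family of rays leaving the focusing arc, in coordinates `a`, `b` such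
that `C₂` is given by `a b ≥ 0`. -/
theorem IsFlightDifferential.forms_cone2 {k c d η J a b v₁ v₂ : ℝ} (hk : 0 < k) (ha : a = -v₂)
    (hb : b = k * v₁ + v₂) (hη : η = k * v₁ - v₂) (hJ : J = d * η - c * v₁) :
    η = 2 * a + b ∧ J = (2 * d - c / k) * a + (d - c / k) * b := by
  have h1 : η = 2 * a + b := by rw [ha, hb, hη]; ring
  refine ⟨h1, ?_⟩
  have h2 : v₁ = (a + b) / k := by rw [ha, hb]; field_simp; ring
  rw [hJ, h1, h2]; field_simp; ring

/-- The cone bundle is invariant, and strictly so for flights which leave or reach a dispersing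
arc, and for those which leave `C₂` and hit the flat boundary. -/
theorem Admissible.map_cone (hT : T.Admissible) {x y : Phase} {n : ℕ} {g : Fold} {d : ℝ}
    {A : ℝ × ℝ →L[ℝ] ℝ × ℝ} (hr : T.Returns x n y) (hf : T.IsFlight x n y g d)
    (hA : T.IsFlightDifferential x y g.det d A) {v : ℝ × ℝ} (hv : v ∈ T.coneBundle x) :
    A v ∈ T.coneBundle y ∧
      (v ≠ 0 → x ∉ T.tight → rev y ∉ T.tight →
        (x.1 ≠ .bottom ∨ y.1 ≠ .bottom ∨ (0 < n ∧ T.coneBundle x = T.cone2 x)) →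
        A v ∈ interior (T.coneBundle y)) := by
  have hx := hr.1
  have hy := hr.2.1
  have hc : 0 < Real.cos x.2.2 := cos_pos_of_mem hx
  have hc₁ : 0 < Real.cos y.2.2 := cos_pos_of_mem hy
  have hkf := hT.kf_pos
  have hkd := hT.kd_neg
  have hkd0 : T.kd ≠ 0 := hkd.ne
  have hd := hf.pos_len
  have hlen : 0 < n → 2 < T.kf * d := fun h => by
    have h1 := hf.len_of_pos h
    have h2 : 1 / T.kf ≤ T.l := hT.c2
    rw [div_le_iff₀ hkf] at h2
    nlinarith
  obtain ⟨f0, f1, f2⟩ := hA.forms v rfl rfl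
  have hc2 : 0 < Real.cos y.2.2 ^ 2 := by positivity
  have hcle := Real.cos_le_one x.2.2
  have hc₁le := Real.cos_le_one y.2.2
  generalize hη : T.curv x.1 * v.1 - v.2 = η at f0 f1 f2
  generalize hJ : d * η - Real.cos x.2.2 * v.1 = J at f0 f1 f2
  set c := Real.cos x.2.2 with hcdef
  set c₁ := Real.cos y.2.2 with hc₁def
  have hv0 : v ≠ 0 → v.1 ≠ 0 ∨ v.2 ≠ 0 := by
    intro h
    by_contra hn
    push Not at hn
    exact h (Prod.ext hn.1 hn.2)
  by_cases hyb : y.1 = .bottom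
  · have hky : 0 < T.curv y.1 := by rw [curv_bottom hyb]; exact hkf
    by_cases hxb : x.1 = .bottom
    · rw [hT.coneBundle_of_not_direct hyb hr (Or.inl hxb), mem_cone2_iff hc₁ hky]
      suffices h : (c₁ * η - T.curv y.1 * J) * η ≤ 0 ∧
          (v ≠ 0 → 0 < n → T.coneBundle x = T.cone2 x → (c₁ * η - T.curv y.1 * J) * η < 0) by
        constructor
        · rw [← f2] at h
          exact nonpos_of_mul_nonpos_right h.1 hc₁
        · rintro h1 - - (h2 | h2 | h2)
          · exact absurd hxb h2
          · exact absurd hyb h2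
          · have h3 := h.2 h1 h2.1 h2.2
            rw [← f2] at h3
            exact mem_interior_cone2 hc₁ hky (neg_of_mul_neg_right h3 hc₁.le)
      rw [curv_bottom hyb]
      rw [curv_bottom hxb] at hη
      have hcase : T.kf * d = 2 * c ∧ c₁ = c ∨ 2 < T.kf * d ∧ 0 < n := by
        rcases Nat.eq_zero_or_pos n with h0 | h0
        · subst h0
          obtain ⟨b1, b2, -⟩ := hT.chord hx hy hxb hyb hf
          exact Or.inl ⟨b1, by rw [hc₁def, b2]⟩
        · exact Or.inr ⟨hlen h0, h0⟩
      have hweak : 0 ≤ T.kf * d - c₁ := by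
        rcases hcase with ⟨b1, b2⟩ | ⟨b1, -⟩ <;> linarith
      -- the form of `C₂` at `y` on `C₂` at `x`; for chords one of its coefficients vanishes
      have h2 : v ∈ T.cone2 x → (c₁ * η - T.kf * J) * η ≤ 0 ∧
          (v ≠ 0 → 0 < n → (c₁ * η - T.kf * J) * η < 0) := by
        intro h
        rw [mem_cone2_iff hc (by rw [curv_bottom hxb]; exact hkf), curv_bottom hxb] at h
        obtain ⟨e1, e2⟩ := IsFlightDifferential.forms_cone2 (k := T.kf) (c := c) hkf rfl rfl hη.symm hJ.symm
        have hab : 0 ≤ (-v.2) * (T.kf * v.1 + v.2) := by linarith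
        generalize ha : -v.2 = a at e1 e2 hab
        generalize hb : T.kf * v.1 + v.2 = b at e1 e2 hab
        have e3 : (c₁ * η - T.kf * J) * η =
            -(((2 * (T.kf * d) - 2 * c₁ - c) * a + (T.kf * d - c₁ - c) * b) * (2 * a + 1 * b)) := by
          rw [e1, e2]; field_simp; ring
        rw [e3]
        have w1 : 0 ≤ 2 * (T.kf * d) - 2 * c₁ - c := by
          rcases hcase with ⟨b1, b2⟩ | ⟨b1, -⟩ <;> linarith
        have w2 : 0 ≤ T.kf * d - c₁ - c := by
          rcases hcase with ⟨b1, b2⟩ | ⟨b1, -⟩ <;> linarith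
        refine ⟨neg_nonpos.2 (form_nonneg hab w1 w2 zero_le_two zero_le_one), fun hv hn => ?_⟩
        have hl := hlen hn
        refine neg_neg_of_pos (form_pos hab ?_ (by linarith) (by linarith) zero_lt_two zero_lt_one)
        by_contra h0
        push Not at h0
        have z2 : v.2 = 0 := by linarith [h0.1]
        have z1 : v.1 = 0 := by
          have : T.kf * v.1 = 0 := by linarith [h0.2]
          exact (mul_eq_zero.1 this).resolve_left hkf.ne'
        exact hv (Prod.ext z1 z2)
      rcases coneBundle_bottom (T := T) hxb with hC | hC
      · rw [hC, mem_cone1_iff hc, curv_bottom hxb, hη] at hv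
        constructor
        · have e3 : (c₁ * η - T.kf * J) * η =
              -((T.kf * d - c₁) * η ^ 2) + T.kf * c * (v.1 * η) := by
            rw [← hJ]; ring
          have z1 : 0 ≤ (T.kf * d - c₁) * η ^ 2 := mul_nonneg hweak (sq_nonneg _)
          have z2 : T.kf * c * (v.1 * η) ≤ 0 :=
            mul_nonpos_of_nonneg_of_nonpos (by positivity) hv
          linarith
        · intro z1 z2 z3
          rw [← z3, hC, mem_cone1_iff hc, curv_bottom hxb, hη] at h2
          exact (h2 hv).2 z1 z2
      · rw [hC] at hv
        exact ⟨(h2 hv).1, fun z1 z2 _ => (h2 hv).2 z1 z2⟩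
    · have hkx : T.curv x.1 < 0 := by rw [curv_disp hxb]; exact hkd
      rw [coneBundle_disp hxb, mem_cone0_iff hc hkx] at hv
      rw [curv_disp hxb] at hη hkx
      rcases Nat.eq_zero_or_pos n with h0 | h0
      · subst h0
        rw [coneBundle_of_direct hxb hyb hr, mem_cone1_iff hc₁]
        have hb1 := hT.c1_down hx hy hxb hyb hf
        have hb2 := hT.c1_down_lt hx hy hxb hyb hf
        rw [curv_disp hxb, abs_of_neg hkd] at hb1 hb2
        have e : 0 < -T.kd := by linarith
        have conv : (d + c / -T.kd) * (2 * T.kf * -T.kd) = 2 * T.kf * (c - d * T.kd) := by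
          field_simp; ring
        have conv2 : c₁ / (2 * T.kf) * (2 * T.kf * -T.kd) = -c₁ * T.kd := by
          field_simp
        have hm : 0 < 2 * T.kf * -T.kd := by positivity
        have w1 : 0 ≤ -c₁ * T.kd - 2 * T.kf * (c - d * T.kd) := by
          have := mul_le_mul_of_nonneg_right hb1 hm.le
          rw [conv, conv2] at this; linarith
        have w2 : 0 < c₁ - 2 * T.kf * d := by
          have : 0 < -T.kd * (c₁ - 2 * T.kf * d) := by
            have : 0 < 2 * T.kf * c := by positivity
            linarith
          exact (mul_pos_iff_of_pos_left e).1 this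
        have w3 : 0 < c - d * T.kd := by nlinarith
        have e3 : J * (2 * T.kf * J - c₁ * η) =
            -(((c - d * T.kd) * v.1 + d * v.2) *
              ((-c₁ * T.kd - 2 * T.kf * (c - d * T.kd)) * v.1 + (c₁ - 2 * T.kf * d) * v.2)) := by
          rw [← hJ, ← hη]; ring
        rw [curv_bottom hyb, e3] at f1
        refine ⟨?_, fun z1 z2 z3 _ => ?_⟩
        · have := form_nonneg hv w3.le hd.le w1 w2.le
          rw [← neg_eq_iff_eq_neg.2 f1, neg_nonneg] at this
          rw [curv_bottom hyb]
          exact nonpos_of_mul_nonpos_right this hc2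
        · have w1' : 0 < -c₁ * T.kd - 2 * T.kf * (c - d * T.kd) := by
            have := mul_lt_mul_of_pos_right (hb2 z3) hm
            rw [conv, conv2] at this; linarith
          have := form_pos hv (hv0 z1) w3 hd w1' w2
          rw [← neg_eq_iff_eq_neg.2 f1, neg_pos] at this
          apply mem_interior_cone1 hc₁
          rw [curv_bottom hyb]
          exact neg_of_mul_neg_right this hc2.le
      · rw [hT.coneBundle_of_not_direct hyb hr (Or.inr h0), mem_cone2_iff hc₁ hky]
        have hl := hlen h0
        have w1 : 0 < T.kf * c - (T.kf * d - c₁) * T.kd := by nlinarith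
        have w2 : 0 < T.kf * d - c₁ := by linarith
        have e3 : (c₁ * η - T.kf * J) * η =
            -((-T.kd * v.1 + 1 * v.2) *
              ((T.kf * c - (T.kf * d - c₁) * T.kd) * v.1 + (T.kf * d - c₁) * v.2)) := by
          rw [← hJ, ← hη]; ring
        rw [curv_bottom hyb, e3] at f2
        have e : 0 < -T.kd := by linarith
        refine ⟨?_, fun z1 _ _ _ => ?_⟩
        · have := form_nonneg hv e.le zero_le_one w1.le w2.le
          rw [← neg_eq_iff_eq_neg.2 f2, neg_nonneg] at this
          rw [curv_bottom hyb]
          exact nonpos_of_mul_nonpos_right this hc₁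
        · have := form_pos hv (hv0 z1) e zero_lt_one w1 w2
          rw [← neg_eq_iff_eq_neg.2 f2, neg_pos] at this
          apply mem_interior_cone2 hc₁ hky
          rw [curv_bottom hyb]
          exact neg_of_mul_neg_right this hc₁.le
  · have hky : T.curv y.1 < 0 := by rw [curv_disp hyb]; exact hkd
    have e : 0 < -T.kd := by linarith
    rw [coneBundle_disp hyb, mem_cone0_iff hc₁ hky]
    suffices h : 0 ≤ J * (c₁ * η - T.kd * J) ∧
        (v ≠ 0 → x ∉ T.tight → 0 < J * (c₁ * η - T.kd * J)) by
      rw [curv_disp hyb] at f0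
      rw [← f0] at h
      refine ⟨nonneg_of_mul_nonneg_right h.1 hc2, fun z1 z2 _ _ => ?_⟩
      exact mem_interior_cone0 hc₁ hky ((mul_pos_iff_of_pos_left hc2).1 (h.2 z1 z2))
    by_cases hxb : x.1 = .bottom
    · rw [curv_bottom hxb] at hη
      rcases coneBundle_bottom (T := T) hxb with hC | hC
      · rw [hC, mem_cone1_iff hc, curv_bottom hxb, hη] at hv
        have hab : 0 ≤ v.1 * (-η) := by linarith
        have e3 : J * (c₁ * η - T.kd * J) =
            (c * v.1 + d * (-η)) * (-T.kd * c * v.1 + (c₁ - T.kd * d) * (-η)) := by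
          rw [← hJ]; ring
        rw [e3]
        have w1 : 0 < c₁ - T.kd * d := by nlinarith
        have w2 : 0 < -T.kd * c := by positivity
        refine ⟨form_nonneg hab hc.le hd.le w2.le w1.le, fun z1 _ => form_pos hab ?_ hc hd w2 w1⟩
        by_contra h0
        push Not at h0
        rw [h0.1] at hη
        exact z1 (Prod.ext h0.1 (by simp only [Prod.snd_zero]; linarith [h0.2]))
      · rw [hC, mem_cone2_iff hc (by rw [curv_bottom hxb]; exact hkf), curv_bottom hxb] at hv
        obtain ⟨e1, e2⟩ := IsFlightDifferential.forms_cone2 (k := T.kf) (c := c) hkf rfl rfl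
          hη.symm hJ.symm
        have hab : 0 ≤ (-v.2) * (T.kf * v.1 + v.2) := by linarith
        have hab0 : v ≠ 0 → -v.2 ≠ 0 ∨ T.kf * v.1 + v.2 ≠ 0 := by
          intro hv
          by_contra h0
          push Not at h0
          have z2 : v.2 = 0 := by linarith [h0.1]
          have z1 : v.1 = 0 := by
            have : T.kf * v.1 = 0 := by linarith [h0.2]
            exact (mul_eq_zero.1 this).resolve_left hkf.ne'
          exact hv (Prod.ext z1 z2)
        generalize -v.2 = a at e1 e2 hab hab0
        generalize T.kf * v.1 + v.2 = b at e1 e2 hab hab0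
        have hck : 0 < c / T.kf := by positivity
        rcases Nat.eq_zero_or_pos n with h0 | h0
        · subst h0
          have hb1 := hT.c1_up hx hy hxb hyb hf
          have hb2 := hT.c1_up_lt hx hy hxb hyb hf
          rw [curv_disp hyb, abs_of_neg hkd] at hb1 hb2
          have conv : c / (2 * T.kf) = c / T.kf / 2 := by field_simp
          rw [conv] at hb1 hb2
          have hq : 0 < c₁ / -T.kd := by positivity
          have hq2 : c₁ / -T.kd * -T.kd = c₁ := by field_simp
          have e3 : J * (c₁ * η - T.kd * J) =
              ((c / T.kf - 2 * d) * a + (c / T.kf - d) * b) *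
                ((-T.kd * (c / T.kf - 2 * d - 2 * (c₁ / -T.kd))) * a +
                  (-T.kd * (c / T.kf - d - c₁ / -T.kd)) * b) := by
            rw [e2, e1]
            linear_combination (-((2 * d - c / T.kf) * a + (d - c / T.kf) * b)) *
              (2 * a + b) * hq2
          rw [e3]
          have w1 : 0 < c / T.kf - 2 * d := by linarith
          have w2 : 0 < c / T.kf - d := by linarith
          have w4 : 0 < c / T.kf - d - c₁ / -T.kd := by linarith
          have w3 : 0 ≤ c / T.kf - 2 * d - 2 * (c₁ / -T.kd) := by linarith
          refine ⟨form_nonneg hab w1.le w2.le (mul_nonneg e.le w3) (mul_nonneg e.le w4.le),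
            fun z1 z2 => form_pos hab (hab0 z1) w1 w2 (mul_pos e ?_) (mul_pos e w4)⟩
          linarith [hb2 z2]
        · have hl := hlen h0
          have hdc : c / T.kf < d := by rw [div_lt_iff₀ hkf]; linarith
          have e3 : J * (c₁ * η - T.kd * J) =
              ((2 * d - c / T.kf) * a + (d - c / T.kf) * b) *
                ((2 * c₁ + -T.kd * (2 * d - c / T.kf)) * a +
                  (c₁ + -T.kd * (d - c / T.kf)) * b) := by
            rw [e2, e1]; ring
          rw [e3]
          have w1 : 0 < 2 * d - c / T.kf := by linarith
          have w2 : 0 < d - c / T.kf := by linarith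
          have w3 : 0 < 2 * c₁ + -T.kd * (2 * d - c / T.kf) := by positivity
          have w4 : 0 < c₁ + -T.kd * (d - c / T.kf) := by positivity
          exact ⟨form_nonneg hab w1.le w2.le w3.le w4.le,
            fun z1 _ => form_pos hab (hab0 z1) w1 w2 w3 w4⟩
    · have hkx : T.curv x.1 < 0 := by rw [curv_disp hxb]; exact hkd
      rw [coneBundle_disp hxb, mem_cone0_iff hc hkx] at hv
      rw [curv_disp hxb] at hη
      have w1 : 0 < c + -T.kd * d := by positivity
      have w2 : 0 < -T.kd * c₁ + -T.kd * (c + -T.kd * d) := by positivity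
      have w3 : 0 < c₁ + -T.kd * d := by positivity
      have e3 : J * (c₁ * η - T.kd * J) = ((c + -T.kd * d) * v.1 + d * v.2) *
          ((-T.kd * c₁ + -T.kd * (c + -T.kd * d)) * v.1 + (c₁ + -T.kd * d) * v.2) := by
        rw [← hJ, ← hη]; ring
      rw [e3]
      exact ⟨form_nonneg hv w1.le hd.le w2.le w3.le,
        fun z1 _ => form_pos hv (hv0 z1) w1 hd w2 w3⟩

theorem IsFlightDifferential.ne_zero {x y : Phase} {g : Fold} {d : ℝ} {A : ℝ × ℝ →L[ℝ] ℝ × ℝ}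
    (h : T.IsFlightDifferential x y g.det d A) (hc : 0 < Real.cos x.2.2) {v : ℝ × ℝ}
    (hv : v ≠ 0) : A v ≠ 0 := by
  intro h0
  obtain ⟨h1, h2⟩ := h v
  have hs := g.det_mul_self
  simp only [h0, Prod.fst_zero, Prod.snd_zero, mul_zero, add_zero] at h1 h2
  have hη : T.curv x.1 * v.1 - v.2 = 0 := by linear_combination (-g.det) * h2 - (T.curv x.1 * v.1 - v.2) * hs
  rw [hη, mul_zero, zero_sub] at h1
  have h3 : Real.cos x.2.2 * v.1 = 0 := by
    linear_combination g.det * h1 - Real.cos x.2.2 * v.1 * hs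
  have h4 := (mul_eq_zero.1 h3).resolve_left hc.ne'
  rw [h4] at hη
  exact hv (Prod.ext h4 (by simp only [Prod.snd_zero]; linarith))

theorem _root_.Billiard.HasDifferential.comp {F G : Phase → Phase} {x : Phase} {A B : ℝ × ℝ →L[ℝ] ℝ × ℝ}
    (hG : HasDifferential G (F x) B) (hF : HasDifferential F x A) :
    HasDifferential (G ∘ F) x (B.comp A) := by
  obtain ⟨f1, f2⟩ := hF
  obtain ⟨g1, g2⟩ := hG
  have hF' : ∀ᶠ p in 𝓝 x.2, F (x.1, p) = ((F x).1, (F (x.1, p)).2) := by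
    filter_upwards [f1] with p hp
    exact Prod.ext hp rfl
  constructor
  · have h : Tendsto (fun p => (F (x.1, p)).2) (𝓝 x.2) (𝓝 (F x).2) := f2.continuousAt
    filter_upwards [hF', h.eventually g1] with p h1 h2
    rw [Function.comp_apply, h1]; exact h2
  · have h : HasFDerivAt ((fun q => (G ((F x).1, q)).2) ∘ fun p => (F (x.1, p)).2)
        (B.comp A) x.2 := HasFDerivAt.comp x.2 g2 f2
    refine h.congr_of_eventuallyEq ?_
    filter_upwards [hF'] with p h1
    rw [Function.comp_apply, Function.comp_apply, h1]

/-! ### Eventual strictness along an orbit -/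

theorem Admissible.hasDifferential (hT : T.Admissible) {x y : Phase} {n : ℕ}
    (h : T.Returns x n y) : ∃ (g : Fold) (d : ℝ) (A : ℝ × ℝ →L[ℝ] ℝ × ℝ),
      T.IsFlight x n y g d ∧ T.IsFlightDifferential x y g.det d A ∧
      HasDifferential T.returnMap x A := by
  obtain ⟨g, d, G, A, h1, h2, h3, h4, h5⟩ := hT.returns_stable h
  refine ⟨g, d, A, h1, h4, ?_, ?_⟩
  · filter_upwards [h5] with p hp
    rw [hT.returnMap_eq hp, hT.returnMap_eq h]
  · refine h3.congr_of_eventuallyEq ?_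
    filter_upwards [h5] with p hp
    rw [hT.returnMap_eq hp]

theorem Admissible.returns_returnMap (hT : T.Admissible) {x : Phase} (h : x ∈ T.returnDomain) :
    ∃ n, T.Returns x n (T.returnMap x) := by
  obtain ⟨n, y, h⟩ := h
  exact ⟨n, by rwa [hT.returnMap_eq h]⟩

/-- The one-step statement: invariance holds wherever the return map is defined. -/
theorem Admissible.invariant_of_mem (hT : T.Admissible) {x : Phase} (h : x ∈ T.returnDomain) :
    ∃ A : ℝ × ℝ →L[ℝ] ℝ × ℝ, HasDifferential T.returnMap x A ∧
      ∀ v ∈ T.coneBundle x, A v ∈ T.coneBundle (T.returnMap x) := by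
  obtain ⟨n, hr⟩ := hT.returns_returnMap h
  obtain ⟨g, d, A, h1, h2, h3⟩ := hT.hasDifferential hr
  exact ⟨A, h3, fun v hv => (hT.map_cone hr h1 h2 hv).1⟩

/-- Points all of whose forward images lie in the domain of the return map, and whose orbits
contain no direct flight, in either direction, along which `D₋₂` and `D₄` end at the same point. -/
def regularPoints (T : Table) : Set Phase :=
  {x | ∀ m, T.returnMap^[m] x ∈ T.returnDomain ∧ T.returnMap^[m] x ∉ T.tight ∧
    rev (T.returnMap^[m] x) ∉ T.tight}

/-- A trajectory cannot run forever along chords of the focusing arc: all of them have the same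
angle with the arc, so that the positions form an arithmetic progression. -/
theorem Admissible.no_infinite_chords (hT : T.Admissible) {z : ℕ → Phase}
    (hz : ∀ m, T.Returns (z m) 0 (z (m + 1)) ∧ (z m).1 = .bottom) : False := by
  have hkf := hT.kf_pos
  have hmem : ∀ m, (z m) ∈ T.phaseSpace := fun m => (hz m).1.1
  have hchord : ∀ m, (z (m + 1)).2.2 = (z m).2.2 ∧
      Complex.exp ((T.kf * ((z (m + 1)).2.1 - (z m).2.1) : ℝ) * Complex.I) =
        -Complex.exp (((-2 * (z m).2.2 : ℝ) : ℂ) * Complex.I) := by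
    intro m
    obtain ⟨g, d, A, h1, -, -⟩ := hT.hasDifferential (hz m).1
    exact (hT.chord (hmem m) (hmem (m + 1)) (hz m).2 (hz (m + 1)).2 h1).2
  have hα : ∀ m, (z m).2.2 = (z 0).2.2 := by
    intro m
    induction m with
    | zero => rfl
    | succ m ih => rw [(hchord m).1, ih]
  have hL : T.kf * T.arcLen .bottom < Real.pi := by
    have h1 := hT.abs_curv_mul_arcLen .bottom
    have h2 := hT.halfAngle_lt .bottom
    have h3 : |T.curv .bottom| = T.kf := abs_of_pos hkf
    rw [h3] at h1
    linarith
  have hs : ∀ m, 0 < T.kf * (z m).2.1 ∧ T.kf * (z m).2.1 < Real.pi := by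
    intro m
    have h := (hmem m).1
    rw [(hz m).2] at h
    exact ⟨mul_pos hkf h.1, lt_trans (mul_lt_mul_of_pos_left h.2 hkf) hL⟩
  set δ := T.kf * ((z 1).2.1 - (z 0).2.1) with hδ
  have hδm : ∀ m, T.kf * ((z (m + 1)).2.1 - (z m).2.1) = δ := by
    intro m
    have h1 : Complex.exp ((T.kf * ((z (m + 1)).2.1 - (z m).2.1) : ℝ) * Complex.I) =
        Complex.exp ((δ : ℝ) * Complex.I) := by
      rw [(hchord m).2, hα m, hδ, (hchord 0).2]
    have hb : ∀ j, -Real.pi < T.kf * ((z (j + 1)).2.1 - (z j).2.1) ∧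
        T.kf * ((z (j + 1)).2.1 - (z j).2.1) ≤ Real.pi := by
      intro j
      have := hs j
      have := hs (j + 1)
      rw [mul_sub]
      constructor <;> linarith
    have h2 := Complex.exp_inj_of_neg_pi_lt_of_le_pi (by simpa using (hb m).1)
      (by simpa using (hb m).2) (by simpa using (hb 0).1) (by simpa using (hb 0).2) h1
    have h3 := mul_right_cancel₀ Complex.I_ne_zero h2
    exact_mod_cast h3
  have hsum : ∀ m : ℕ, T.kf * (z m).2.1 = T.kf * (z 0).2.1 + m * δ := by
    intro m
    induction m with
    | zero => simp
    | succ m ih => push_cast; linarith [hδm m]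
  have hδ0 : δ = 0 := by
    by_contra h0
    obtain ⟨m, hm⟩ := exists_nat_gt (Real.pi / |δ|)
    rw [div_lt_iff₀ (abs_pos.2 h0)] at hm
    have h1 := hsum m
    have h2 := hs m
    have h3 := hs 0
    have h4 : |(m : ℝ) * δ| < Real.pi := abs_lt.2 ⟨by linarith, by linarith⟩
    rw [abs_mul, Nat.abs_cast] at h4
    linarith
  have h := (hchord 0).2
  rw [← hδ, hδ0] at h
  have h1 := congrArg Complex.re h
  rw [Complex.neg_re, Complex.exp_ofReal_mul_I_re, Complex.exp_ofReal_mul_I_re, Real.cos_zero,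
    neg_mul, Real.cos_neg, Real.cos_two_mul] at h1
  have := cos_pos_of_mem (hmem 0)
  nlinarith

/-- The first strict step of the orbit makes the whole iterate strict, the others being weak. -/
theorem Admissible.eventually_strict_of_regular (hT : T.Admissible) {x : Phase}
    (hx : x ∈ T.regularPoints) : ∃ n : ℕ, 1 ≤ n ∧ x ∈ T.iterDomain n ∧
      ∃ A : ℝ × ℝ →L[ℝ] ℝ × ℝ, HasDifferential (T.returnMap^[n]) x A ∧
        ∀ v ∈ T.coneBundle x, v ≠ 0 → A v ∈ interior (T.coneBundle (T.returnMap^[n] x)) := by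
  set z : ℕ → Phase := fun m => T.returnMap^[m] x with hz
  have hsucc : ∀ m, z (m + 1) = T.returnMap (z m) := fun m => Function.iterate_succ_apply' _ _ _
  have hret : ∀ m, ∃ n, T.Returns (z m) n (z (m + 1)) := by
    intro m
    rw [hsucc]
    exact hT.returns_returnMap (hx m).1
  choose N hN using hret
  choose g d A hf hA hD using fun m => hT.hasDifferential (hN m)
  have hcomp : ∀ m, ∃ B : ℝ × ℝ →L[ℝ] ℝ × ℝ, HasDifferential (T.returnMap^[m]) x B ∧
      ∀ v ∈ T.coneBundle x, v ≠ 0 → B v ∈ T.coneBundle (z m) ∧ B v ≠ 0 := by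
    intro m
    induction m with
    | zero =>
      refine ⟨ContinuousLinearMap.id ℝ _, ⟨Eventually.of_forall fun p => rfl, ?_⟩,
        fun v hv h0 => ⟨hv, h0⟩⟩
      exact hasFDerivAt_id x.2
    | succ m ih =>
      obtain ⟨B, h1, h2⟩ := ih
      refine ⟨(A m).comp B, ?_, fun v hv h0 => ?_⟩
      · rw [Function.iterate_succ']
        exact (hD m).comp h1
      · obtain ⟨h3, h4⟩ := h2 v hv h0
        exact ⟨(hT.map_cone (hN m) (hf m) (hA m) h3).1,
          (hA m).ne_zero (cos_pos_of_mem (hN m).1) h4⟩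
  by_cases hstrict : ∃ m, (z m).1 ≠ .bottom ∨ (z (m + 1)).1 ≠ .bottom ∨
      (0 < N m ∧ T.coneBundle (z m) = T.cone2 (z m))
  · obtain ⟨m, hm⟩ := hstrict
    obtain ⟨B, h1, h2⟩ := hcomp m
    refine ⟨m + 1, by omega, fun j _ => (hx j).1, (A m).comp B, ?_, fun v hv h0 => ?_⟩
    · rw [Function.iterate_succ']
      exact (hD m).comp h1
    · obtain ⟨h3, h4⟩ := h2 v hv h0
      exact (hT.map_cone (hN m) (hf m) (hA m) h3).2 h4 (hx m).2.1 (hx (m + 1)).2.2 hm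
  · exfalso
    push Not at hstrict
    have hb : ∀ m, (z m).1 = .bottom := fun m => (hstrict m).1
    -- the cone at the first point may be `C₁`, those at its images are `C₂`
    refine hT.no_infinite_chords (z := fun m => z (m + 1)) fun m => ⟨?_, hb _⟩
    have hC : T.coneBundle (z (m + 1)) = T.cone2 (z (m + 1)) :=
      hT.coneBundle_of_not_direct (hb _) (hN m) (Or.inl (hb m))
    have h0 : N (m + 1) = 0 := by
      by_contra hne
      exact (hstrict (m + 1)).2.2 (Nat.pos_of_ne_zero hne) hC
    have h := hN (m + 1)
    rwa [h0] at h

/-! ### Null sets of the phase space -/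

/-- Sets which are null on each component, in the coordinates `(s, α)`. -/
def Negligible (T : Table) (S : Set Phase) : Prop :=
  ∀ i, volume {p : ℝ × ℝ | (i, p) ∈ T.phaseSpace ∧ (i, p) ∈ S} = 0

theorem Negligible.mono {S S' : Set Phase} (h : T.Negligible S)
    (hs : ∀ x ∈ S', x ∈ T.phaseSpace → x ∈ S) : T.Negligible S' := fun i =>
  measure_mono_null (fun p hp => (⟨hp.1, hs _ hp.2 hp.1⟩ :
    (i, p) ∈ T.phaseSpace ∧ (i, p) ∈ S)) (h i)

theorem Negligible.iUnion {ι : Type*} [Countable ι] {S : ι → Set Phase}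
    (h : ∀ j, T.Negligible (S j)) : T.Negligible (⋃ j, S j) := fun i => by
  refine measure_mono_null (t := ⋃ j, {p : ℝ × ℝ | (i, p) ∈ T.phaseSpace ∧ (i, p) ∈ S j}) ?_
    (measure_iUnion_null fun j => h j i)
  rintro p ⟨hp, hp'⟩
  obtain ⟨j, hj⟩ := mem_iUnion.1 hp'
  exact mem_iUnion.2 ⟨j, hp, hj⟩

theorem Negligible.union {S S' : Set Phase} (h : T.Negligible S) (h' : T.Negligible S') :
    T.Negligible (S ∪ S') := by
  rw [union_eq_iUnion]
  exact Negligible.iUnion fun b => by cases b <;> assumption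

theorem measurableSet_phaseSpace : MeasurableSet T.phaseSpace := by
  have h1 : Measurable fun x : Phase => T.arcLen x.1 :=
    (measurable_from_top (f := T.arcLen)).comp measurable_fst
  have h2 : Measurable fun x : Phase => x.2.1 := by fun_prop
  have h3 : Measurable fun x : Phase => x.2.2 := by fun_prop
  exact ((measurableSet_lt measurable_const h2).inter (measurableSet_lt h2 h1)).inter
    ((measurableSet_lt measurable_const h3).inter (measurableSet_lt h3 measurable_const))

instance : MeasurableSingletonClass Arc := ⟨fun _ => trivial⟩

theorem ae_of_restrict {P : Phase → Prop} (h : ∀ᵐ x ∂((Measure.count : Measure Arc).prod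
    (volume : Measure (ℝ × ℝ))).restrict T.phaseSpace, P x) : ∀ᵐ x ∂T.measure, P x :=
  (Measure.smul_absolutelyContinuous.trans (withDensity_absolutelyContinuous _ _)).ae_le h

theorem ae_mem_phaseSpace : ∀ᵐ x ∂T.measure, x ∈ T.phaseSpace :=
  ae_of_restrict (ae_restrict_mem measurableSet_phaseSpace)

theorem Negligible.ae_notMem {S : Set Phase} (h : T.Negligible S) : ∀ᵐ x ∂T.measure, x ∉ S := by
  apply ae_of_restrict
  rw [ae_iff, Measure.restrict_apply' measurableSet_phaseSpace]
  refine measure_mono_null (t := ⋃ i : Arc,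
    ({i} : Set Arc) ×ˢ {p : ℝ × ℝ | (i, p) ∈ T.phaseSpace ∧ (i, p) ∈ S}) ?_
    (measure_iUnion_null fun i => ?_)
  · rintro ⟨i, p⟩ ⟨h1, h2⟩
    exact mem_iUnion.2 ⟨i, rfl, h2, not_not.1 h1⟩
  · rw [Measure.prod_prod, h i, mul_zero]

/-- Images under a differentiable map of the phase space are null if their sources are. -/
theorem Negligible.of_differentiable {S E : Set Phase} (h : T.Negligible S) (F : Phase → Phase)
    (hF : ∀ x ∈ S, x ∈ T.phaseSpace → DifferentiableAt ℝ (fun p => (F (x.1, p)).2) x.2)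
    (hE : ∀ x ∈ E, x ∈ T.phaseSpace → ∃ y ∈ S, y ∈ T.phaseSpace ∧ F y = x) :
    T.Negligible E := fun i => by
  refine measure_mono_null (t := ⋃ j : Arc, (fun p => (F (j, p)).2) ''
    {p : ℝ × ℝ | (j, p) ∈ T.phaseSpace ∧ (j, p) ∈ S}) ?_ (measure_iUnion_null fun j => ?_)
  · rintro p ⟨hp, hp'⟩
    obtain ⟨y, hy, hy', hF⟩ := hE _ hp' hp
    exact mem_iUnion.2 ⟨y.1, y.2, ⟨hy', hy⟩, by simp only [Prod.mk.eta, hF]⟩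
  · refine addHaar_image_eq_zero_of_differentiableOn_of_addHaar_eq_zero volume (fun p hp => ?_)
      (h j)
    exact (hF (j, p) hp.2 hp.1).differentiableWithinAt

theorem Negligible.rev {S : Set Phase} (h : T.Negligible S) :
    T.Negligible {x | Table.rev x ∈ S} := by
  refine h.of_differentiable Table.rev (fun x _ _ => ?_)
    fun x hx hx' => ⟨Table.rev x, hx, rev_mem hx', rev_rev x⟩
  simp only [Table.rev]
  fun_prop

/-- The first-return map is nonsingular: by time reversal, its inverse is differentiable. -/
theorem Admissible.negligible_preimage (hT : T.Admissible) {S : Set Phase} (h : T.Negligible S) :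
    T.Negligible {x | x ∈ T.returnDomain ∧ T.returnMap x ∈ S} := by
  have hret : ∀ x ∈ T.returnDomain, ∃ n, T.Returns (rev (T.returnMap x)) n (rev x) :=
    fun x hx => (hT.returns_returnMap hx).imp fun n hn => hn.reverse
  have h' : T.Negligible ({x | rev x ∈ S} ∩ T.returnDomain) :=
    h.rev.mono fun x hx _ => hx.1
  refine Negligible.mono (Negligible.rev (S := {x | rev x ∈ T.returnDomain ∧
    T.returnMap (rev x) ∈ S}) ?_) fun x hx _ => by simpa using hx
  refine h'.of_differentiable T.returnMap (fun x hx _ => ?_) fun x hx hx' => ?_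
  · obtain ⟨n, hn⟩ := hT.returns_returnMap hx.2
    obtain ⟨g, d, A, -, -, h3⟩ := hT.hasDifferential hn
    exact h3.2.differentiableAt
  · obtain ⟨n, hn⟩ := hret _ hx.1
    rw [rev_rev] at hn
    refine ⟨rev (T.returnMap (rev x)), ⟨?_, n, _, hn⟩, hn.1, hT.returnMap_eq hn⟩
    rw [mem_ofPred_eq, rev_rev]; exact hx.2

/-! ### Trigonometric equations -/

/-- In terms of `tan α`, the equation is polynomial, and of degree at most two. -/
theorem finite_trig {a b ρ : ℝ} (h : ¬(a = 0 ∧ b = 0 ∧ ρ = 0)) :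
    {α ∈ Ioo (-(Real.pi / 2)) (Real.pi / 2) |
      (a * Real.sin α + b * Real.cos α) ^ 2 = ρ ^ 2}.Finite := by
  set P : Polynomial ℝ := (Polynomial.C a * Polynomial.X + Polynomial.C b) ^ 2 -
    Polynomial.C (ρ ^ 2) * (Polynomial.X ^ 2 + 1) with hP
  have heval : ∀ t, P.eval t = (a * t + b) ^ 2 - ρ ^ 2 * (t ^ 2 + 1) := by
    intro t; simp [hP]
  have hP0 : P ≠ 0 := by
    intro h0
    have e : ∀ t, (a * t + b) ^ 2 - ρ ^ 2 * (t ^ 2 + 1) = 0 := fun t => by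
      rw [← heval, h0, Polynomial.eval_zero]
    have e0 := e 0
    have e1 := e 1
    have e2 := e (-1)
    have hab : a * b = 0 := by linarith
    have ha : a ^ 2 = ρ ^ 2 := by linarith
    have hb : b ^ 2 = ρ ^ 2 := by linarith
    have hρ : ρ ^ 2 * ρ ^ 2 = 0 := by
      calc ρ ^ 2 * ρ ^ 2 = (a * b) ^ 2 := by rw [mul_pow, ha, hb]
        _ = 0 := by rw [hab]; norm_num
    have hρ0 : ρ = 0 := by simpa using hρ
    rw [hρ0] at ha hb
    exact h ⟨by simpa using ha, by simpa using hb, hρ0⟩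
  refine Finite.of_finite_image (f := Real.tan) ?_ (Real.injOn_tan.mono fun α hα => hα.1)
  refine (Polynomial.finite_setOfPred_isRoot hP0).subset ?_
  rintro _ ⟨α, ⟨hα, h1⟩, rfl⟩
  have hc := Real.cos_pos_of_mem_Ioo hα
  rw [mem_ofPred_eq, Polynomial.IsRoot.def, heval, Real.tan_eq_sin_div_cos]
  have hs := Real.sin_sq_add_cos_sq α
  field_simp
  linear_combination h1 - ρ ^ 2 * hs

/-- By Fubini's theorem, it is enough that the equation in `α` is nontrivial for all but countably
many `s`. -/
theorem null_trig {a b : ℝ → ℝ} (ha : Continuous a) (hb : Continuous b) (ρ : ℝ) (I : Set ℝ)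
    (h : {s ∈ I | a s = 0 ∧ b s = 0 ∧ ρ = 0}.Countable) :
    volume {p : ℝ × ℝ | p.1 ∈ I ∧ p.2 ∈ Ioo (-(Real.pi / 2)) (Real.pi / 2) ∧
      (a p.1 * Real.sin p.2 + b p.1 * Real.cos p.2) ^ 2 = ρ ^ 2} = 0 := by
  set Z : Set (ℝ × ℝ) := {p | ¬(a p.1 = 0 ∧ b p.1 = 0 ∧ ρ = 0) ∧
    p.2 ∈ Ioo (-(Real.pi / 2)) (Real.pi / 2) ∧
    (a p.1 * Real.sin p.2 + b p.1 * Real.cos p.2) ^ 2 = ρ ^ 2} with hZ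
  have hZm : MeasurableSet Z := by
    have c1 : Continuous fun p : ℝ × ℝ => a p.1 := ha.comp continuous_fst
    have c2 : Continuous fun p : ℝ × ℝ => b p.1 := hb.comp continuous_fst
    have m1 : MeasurableSet {p : ℝ × ℝ | a p.1 = 0 ∧ b p.1 = 0 ∧ ρ = 0} :=
      ((isClosed_eq c1 continuous_const).inter
        ((isClosed_eq c2 continuous_const).inter isClosed_const)).measurableSet
    have m2 : MeasurableSet {p : ℝ × ℝ | p.2 ∈ Ioo (-(Real.pi / 2)) (Real.pi / 2)} :=
      measurable_snd measurableSet_Ioo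
    have m3 : MeasurableSet {p : ℝ × ℝ |
        (a p.1 * Real.sin p.2 + b p.1 * Real.cos p.2) ^ 2 = ρ ^ 2} :=
      (isClosed_eq (by fun_prop) continuous_const).measurableSet
    exact m1.compl.inter (m2.inter m3)
  have hZ0 : volume Z = 0 := by
    rw [Measure.volume_eq_prod, Measure.measure_prod_null hZm]
    refine Eventually.of_forall fun s => ?_
    by_cases h0 : a s = 0 ∧ b s = 0 ∧ ρ = 0
    · have : Prod.mk s ⁻¹' Z = ∅ := by
        ext α
        simp [hZ, h0]
      simp [this]
    · refine (finite_trig h0).measure_zero volume |> measure_mono_null ?_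
      rintro α ⟨-, h2, h3⟩
      exact ⟨h2, h3⟩
  have hC : volume ({s ∈ I | a s = 0 ∧ b s = 0 ∧ ρ = 0} ×ˢ (univ : Set ℝ)) = 0 := by
    rw [Measure.volume_eq_prod, Measure.prod_prod, h.measure_zero, zero_mul]
  refine measure_mono_null (fun p hp => ?_) (measure_union_null hZ0 hC)
  by_cases h0 : a p.1 = 0 ∧ b p.1 = 0 ∧ ρ = 0
  · exact Or.inr ⟨⟨hp.1, h0⟩, mem_univ _⟩
  · exact Or.inl ⟨h0, hp.2⟩

/-! ### Exceptional rays -/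

/-- The point `c` in the frame at the coordinate `s` whose real axis is the inner normal. -/
def frame (T : Table) (c : ℂ) (i : Arc) (s : ℝ) : ℂ :=
  (c - T.arcPoint i s) * conj (T.normal i s)

theorem continuous_frame (c : ℂ) (i : Arc) : Continuous (T.frame c i) :=
  (continuous_const.sub (T.continuous_arcPoint i)).mul
    (Complex.continuous_conj.comp (T.continuous_normal i))

theorem normal_mul_conj_self (i : Arc) (s : ℝ) :
    T.normal i s * conj (T.normal i s) = 1 := by
  rw [Complex.mul_conj, T.normSq_normal]; simp

theorem frame_eq_iff {c : ℂ} {i : Arc} {s : ℝ} {z : ℂ} :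
    T.frame c i s = z ↔ c = T.arcPoint i s + z * T.normal i s := by
  have h := T.normal_mul_conj_self i s
  unfold frame
  constructor
  · intro h1
    rw [← h1]
    linear_combination (-(c - T.arcPoint i s)) * h
  · intro h1
    rw [h1]
    linear_combination z * h

theorem sub_pos_mul_conj_vel (c : ℂ) (x : Phase) : (c - T.pos x) * conj (T.vel x) =
    T.frame c x.1 x.2.1 * (Real.cos x.2.2 + Real.sin x.2.2 * Complex.I) := by
  have h := T.normal_mul_conj_self x.1 x.2.1
  rw [← normal_mul_conj_vel (T := T) x, frame, pos]
  linear_combination (-(c - T.arcPoint x.1 x.2.1) * conj (T.vel x)) * h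

theorem sub_pos_mul_conj_vel_im (c : ℂ) (x : Phase) : ((c - T.pos x) * conj (T.vel x)).im =
    (T.frame c x.1 x.2.1).re * Real.sin x.2.2 + (T.frame c x.1 x.2.1).im * Real.cos x.2.2 := by
  rw [sub_pos_mul_conj_vel]
  simp [Complex.mul_im, -Complex.ofReal_sin, -Complex.ofReal_cos]

theorem sub_pos_mul_conj_vel_re (c : ℂ) (x : Phase) : ((c - T.pos x) * conj (T.vel x)).re =
    (T.frame c x.1 x.2.1).re * Real.cos x.2.2 - (T.frame c x.1 x.2.1).im * Real.sin x.2.2 := by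
  rw [sub_pos_mul_conj_vel]
  simp [Complex.mul_re, -Complex.ofReal_sin, -Complex.ofReal_cos]

/-- The rays at a given distance from a given point form a null set: the equation for `α` degenerates
only if the distance is zero and the point is the base point of the ray. -/
theorem Admissible.negligible_rays (hT : T.Admissible) (c : ℂ) (ρ : ℝ) :
    T.Negligible {x | ((c - T.pos x) * conj (T.vel x)).im ^ 2 = ρ ^ 2} := fun i => by
  refine measure_mono_null (fun p hp => ?_) (null_trig
    (Complex.continuous_re.comp (T.continuous_frame c i))
    (Complex.continuous_im.comp (T.continuous_frame c i)) ρ (Ioo 0 (T.arcLen i))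
    (Subsingleton.countable ?_))
  · have h := hp.2
    rw [mem_ofPred_eq, sub_pos_mul_conj_vel_im] at h
    exact ⟨hp.1.1, hp.1.2, h⟩
  · rintro s ⟨hs, h1, h2, -⟩ s' ⟨hs', h1', h2', -⟩
    have e : T.frame c i s = 0 := Complex.ext h1 h2
    have e' : T.frame c i s' = 0 := Complex.ext h1' h2'
    rw [frame_eq_iff, zero_mul, add_zero] at e e'
    exact hT.arcPoint_injOn i hs hs' (e.symm.trans e')

/-- After unfolding, singular rays go through the image of a vertex, or touch the image of a circle
carrying an arc. -/
theorem Admissible.negligible_singular (hT : T.Admissible) : T.Negligible {x | T.Singular x} := by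
  have hcount : Countable T.vertices := T.finite_vertices.countable.to_subtype
  choose inv hinv using fun (g : Fold) (c : ℂ) => T.foldAct_surjective g c
  have h1 : T.Negligible (⋃ w : Fold × T.vertices,
      {x | ((inv w.1 w.2 - T.pos x) * conj (T.vel x)).im ^ 2 = 0 ^ 2}) :=
    Negligible.iUnion fun w => hT.negligible_rays _ _
  have h2 : T.Negligible (⋃ w : Fold × Arc, {x | ((inv w.1 (T.center w.2) - T.pos x) *
      conj (T.vel x)).im ^ 2 = (T.curv w.2)⁻¹ ^ 2}) :=
    Negligible.iUnion fun w => hT.negligible_rays _ _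
  refine (h1.union h2).mono ?_
  rintro x ⟨n, q, u, t, hp, -, hcase⟩ hx
  obtain ⟨g, τ, -, -, -, hq, hu, -⟩ := hT.flatPath_stable hx hp
  have hqt : q + t * u = T.foldAct g (T.pos x + (τ x.2 + t : ℝ) * T.vel x) := by
    have e : T.pos x + (τ x.2 + t : ℝ) * T.vel x = T.pos x + τ x.2 * T.vel x + t * T.vel x := by
      push_cast; ring
    rw [e, foldAct_add, hq, hu]
  have hvv : ∀ r : ℝ, ((r : ℂ) * T.vel x * conj (T.vel x)).im = 0 := by
    intro r
    rw [mul_assoc, Complex.mul_conj, ← Complex.ofReal_mul, Complex.ofReal_im]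
  rcases hcase with hv | ⟨i, s, -, hs, htan⟩
  · refine Or.inl (mem_iUnion.2 ⟨(g, ⟨_, hv⟩), ?_⟩)
    have e : inv g (q + t * u) = T.pos x + (τ x.2 + t : ℝ) * T.vel x :=
      T.foldAct_injective g (by rw [hinv, hqt])
    simp only [mem_ofPred_eq]
    rw [e, add_sub_cancel_left, hvv]
  · refine Or.inr (mem_iUnion.2 ⟨(g, i), ?_⟩)
    simp only [mem_ofPred_eq]
    -- the centre of the circle is at the distance of its radius from the unfolded ray
    have e1 : g.lin (inv g (T.center i) - (T.pos x + (τ x.2 + t : ℝ) * T.vel x)) =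
        T.normal i s / T.curv i := by
      rw [← foldAct_sub, hinv, ← hqt, hs, hT.arcPoint_eq]; ring
    have e2 := Fold.lin_mul_conj_im g
      (inv g (T.center i) - (T.pos x + (τ x.2 + t : ℝ) * T.vel x)) (T.vel x)
    have e3 : ((inv g (T.center i) - (T.pos x + (τ x.2 + t : ℝ) * T.vel x)) *
        conj (T.vel x)).im = ((inv g (T.center i) - T.pos x) * conj (T.vel x)).im := by
      rw [← sub_sub, sub_mul, Complex.sub_im, hvv, sub_zero]
    rw [e3, e1, ← hu] at e2
    have e4 : T.normal i s / T.curv i * conj u =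
        ((T.curv i)⁻¹ : ℝ) * (T.normal i s * conj u) := by push_cast; ring
    rw [e4, Complex.im_ofReal_mul] at e2
    have e5 : (T.normal i s * conj u).re = 0 := by
      rw [← htan]; simp only [Complex.mul_re, Complex.conj_re, Complex.conj_im]; ring
    have hu1 : Complex.normSq u = 1 := by
      rw [hu, Complex.normSq_eq_norm_sq, Fold.norm_lin, norm_vel, one_pow]
    have e6 : (T.normal i s * conj u).im ^ 2 = 1 := by
      have e7 : Complex.normSq (T.normal i s * conj u) = 1 := by
        rw [Complex.normSq_mul, Complex.normSq_conj, hu1, T.normSq_normal, mul_one]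
      rw [Complex.normSq_apply, e5] at e7
      linarith
    have hg := g.det_mul_self
    have e7 := congrArg (· ^ 2) e2
    simp only [mul_pow] at e7
    rw [e6, pow_two g.det, hg] at e7
    linarith

theorem Admissible.negligible_tight (hT : T.Admissible) : T.Negligible T.tight := by
  have hkf := hT.kf_pos
  -- along such a ray, the projection to it of the centre of the dispersing circle lies on the
  -- boundary of `D₄`, which is a linear equation in `cos α` and `sin α`
  refine Negligible.mono (S := ⋃ j : Arc, {x | x.1 = .bottom ∧
    ((T.frame (T.center j) x.1 x.2.1).im * Real.sin x.2.2 +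
      (1 / (2 * T.kf) - (T.frame (T.center j) x.1 x.2.1).re) * Real.cos x.2.2) ^ 2 = 0 ^ 2})
    (Negligible.iUnion fun j i => ?_) ?_
  · by_cases hi : i = .bottom
    · subst hi
      refine measure_mono_null (fun p hp => ?_) (null_trig
        (a := fun s => (T.frame (T.center j) .bottom s).im)
        (b := fun s => 1 / (2 * T.kf) - (T.frame (T.center j) .bottom s).re)
        (Complex.continuous_im.comp (T.continuous_frame _ _))
        (continuous_const.sub (Complex.continuous_re.comp (T.continuous_frame _ _))) 0
        (Ioo 0 (T.arcLen .bottom)) (Subsingleton.countable ?_))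
      · exact ⟨hp.1.1, hp.1.2, hp.2.2⟩
      · rintro s ⟨hs, h1, h2, -⟩ s' ⟨hs', h1', h2', -⟩
        have e : ∀ {s : ℝ}, (T.frame (T.center j) .bottom s).im = 0 →
            1 / (2 * T.kf) - (T.frame (T.center j) .bottom s).re = 0 →
            T.center j = T.center .bottom - (1 / (2 * T.kf) : ℝ) * T.normal .bottom s := by
          intro s h1 h2
          have e1 : T.frame (T.center j) .bottom s = (1 / (2 * T.kf) : ℝ) :=
            Complex.ext (by rw [Complex.ofReal_re]; linarith) (by rw [h1, Complex.ofReal_im])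
          rw [frame_eq_iff, hT.arcPoint_eq] at e1
          rw [e1]
          simp only [curv]
          have : (T.kf : ℂ) ≠ 0 := by exact_mod_cast hkf.ne'
          push_cast
          field_simp
          ring
        have e1 := (e h1 h2).symm.trans (e h1' h2')
        have hne : ((1 / (2 * T.kf) : ℝ) : ℂ) ≠ 0 := by
          have : 1 / (2 * T.kf) ≠ 0 := by positivity
          exact_mod_cast this
        have e2 := mul_left_cancel₀ hne (sub_right_inj.1 e1)
        exact hT.arcPoint_injOn .bottom hs hs' (by rw [hT.arcPoint_eq, hT.arcPoint_eq, e2])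
    · refine measure_mono_null (t := ∅) (fun p hp => hi hp.2.1) measure_empty
  · rintro x ⟨-, hxi, y, d, -, hyi, -, h1, h2, h3⟩ -
    refine mem_iUnion.2 ⟨y.1, hxi, ?_⟩
    have hkd := hT.kd_neg
    have e1 := T.sub_pos_mul_conj_vel_re (T.center y.1) x
    have e2 := normal_mul_conj_incoming (T := T) y
    rw [← h2] at e2
    have e3 : T.center y.1 - T.pos x = d * T.vel x + T.normal y.1 y.2.1 / T.curv y.1 := by
      rw [← sub_eq_iff_eq_add'.2 h1, hT.pos_eq_center y]; ring
    have e4 : (T.center y.1 - T.pos x) * conj (T.vel x) =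
        d + (-Real.cos y.2.2 + Real.sin y.2.2 * Complex.I) / T.curv y.1 := by
      have h : T.vel x * conj (T.vel x) = 1 := by
        rw [Complex.mul_conj, Complex.normSq_eq_norm_sq, norm_vel]; simp
      rw [e3, ← e2]
      linear_combination (d : ℂ) * h
    have e5 : ((T.center y.1 - T.pos x) * conj (T.vel x)).re =
        d + -Real.cos y.2.2 / T.curv y.1 := by
      rw [e4, Complex.add_re, Complex.div_ofReal_re]
      simp [-Complex.ofReal_sin, -Complex.ofReal_cos]
    rw [curv_disp hyi, abs_of_neg hkd, div_neg, ← neg_div] at h3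
    rw [curv_disp hyi, h3] at e5
    rw [e5] at e1
    have e6 : (T.frame (T.center y.1) x.1 x.2.1).im * Real.sin x.2.2 +
      (1 / (2 * T.kf) - (T.frame (T.center y.1) x.1 x.2.1).re) * Real.cos x.2.2 = 0 := by
      rw [sub_mul, one_div_mul_eq_div]; linarith
    rw [e6]

/-- The points that are not regular are the preimages under all iterates of a null set. -/
theorem Admissible.negligible_regular (hT : T.Admissible) : T.Negligible T.regularPointsᶜ := by
  have hdom : T.Negligible T.returnDomainᶜ :=
    hT.negligible_singular.mono fun x hx hx' => by
      by_contra h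
      exact hx (hT.mem_returnDomain hx' h)
  set B := T.returnDomainᶜ ∪ (T.tight ∪ {x | rev x ∈ T.tight}) with hBdef
  have hB : T.Negligible B := hdom.union (hT.negligible_tight.union hT.negligible_tight.rev)
  have hiter : ∀ m, T.Negligible {x | T.returnMap^[m] x ∈ B} := by
    intro m
    induction m with
    | zero => exact hB
    | succ m ih =>
      refine (hdom.union (hT.negligible_preimage ih)).mono fun x hx _ => ?_
      by_cases h : x ∈ T.returnDomain
      · exact Or.inr ⟨h, hx⟩
      · exact Or.inl h
  refine (Negligible.iUnion hiter).mono fun x hx _ => ?_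
  by_contra hn
  refine hx fun m => ?_
  have h : T.returnMap^[m] x ∉ B := fun h => hn (mem_iUnion.2 ⟨m, h⟩)
  simp only [hBdef, mem_union, not_or, mem_compl_iff, not_not] at h
  exact ⟨h.1, h.2.1, h.2.2⟩

/-! ### Measurability of the cone bundle -/

/-- Line elements reached directly from a dispersing arc. -/
def directPoints (T : Table) : Set Phase := {x | ∃ y : Phase, y.1 ≠ .bottom ∧ T.Returns y 0 x}

theorem measurableSet_of_isOpen_slices {S : Set Phase} (h : ∀ i, IsOpen {p : ℝ × ℝ | (i, p) ∈ S}) :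
    MeasurableSet S := by
  have e : S = ⋃ i : Arc, ({i} : Set Arc) ×ˢ {p : ℝ × ℝ | (i, p) ∈ S} := by
    ext ⟨i, p⟩
    simp
  rw [e]
  exact MeasurableSet.iUnion fun i => (measurableSet_singleton i).prod (h i).measurableSet

/-- The set is open: by time reversal, its points are those from which a dispersing arc is reached
directly, and this is stable. -/
theorem Admissible.measurableSet_directPoints (hT : T.Admissible) :
    MeasurableSet T.directPoints := by
  refine measurableSet_of_isOpen_slices fun i => isOpen_iff_mem_nhds.2 ?_
  rintro p ⟨y, hy, hr⟩
  obtain ⟨g, d, G, A, -, -, -, -, h⟩ := hT.returns_stable hr.reverse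
  have hc : Tendsto (fun q : ℝ × ℝ => (q.1, -q.2)) (𝓝 p) (𝓝 (p.1, -p.2)) :=
    Continuous.tendsto (by fun_prop) p
  filter_upwards [hc.eventually h] with q hq
  refine ⟨rev (y.1, G (q.1, -q.2)), hy, ?_⟩
  have h1 := hq.reverse
  simpa [rev] using h1

theorem cone0_eq {x : Phase} (hc : 0 < Real.cos x.2.2) (hk : T.curv x.1 < 0) :
    T.cone0 x = coneOf (1, 0) (0, 1) := by
  ext v
  rw [mem_cone0_iff hc hk]
  constructor
  · exact fun h => ⟨v.1, v.2, h, by simp⟩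
  · rintro ⟨a, b, h, rfl⟩
    simpa using h

theorem cone1_eq {x : Phase} (hc : 0 < Real.cos x.2.2) :
    T.cone1 x = coneOf (0, 1) (1, T.curv x.1) := by
  ext v
  rw [mem_cone1_iff hc]
  constructor
  · refine fun h => ⟨v.2 - T.curv x.1 * v.1, v.1, by linarith, ?_⟩
    apply Prod.ext <;> simp
    ring
  · rintro ⟨a, b, h, rfl⟩
    simp only [Prod.smul_mk, smul_eq_mul, Prod.mk_add_mk]
    linarith

theorem cone2_eq {x : Phase} (hc : 0 < Real.cos x.2.2) (hk : 0 < T.curv x.1) :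
    T.cone2 x = coneOf (1, 0) (1, -T.curv x.1) := by
  ext v
  rw [mem_cone2_iff hc hk]
  set k := T.curv x.1
  constructor
  · refine fun h => ⟨v.1 + v.2 / k, -(v.2 / k), ?_, ?_⟩
    · have e : (v.1 + v.2 / k) * -(v.2 / k) = -(v.2 * (k * v.1 + v.2)) / k ^ 2 := by
        field_simp
      rw [e]
      exact div_nonneg (by linarith) (sq_nonneg k)
    · apply Prod.ext <;> simp
      field_simp
  · rintro ⟨a, b, h, rfl⟩
    simp only [Prod.smul_mk, smul_eq_mul, Prod.mk_add_mk]
    have := mul_nonneg h (sq_nonneg k)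
    linarith

open Classical in
theorem Admissible.isMeasurableConeBundle (hT : T.Admissible) :
    IsMeasurableConeBundle T.measure T.coneBundle := by
  have hb : MeasurableSet {x : Phase | x.1 = .bottom} :=
    measurable_fst (measurableSet_singleton Arc.bottom)
  have hD := hT.measurableSet_directPoints
  refine ⟨fun x => if x.1 = .bottom then if x ∈ T.directPoints then (0, 1) else (1, 0) else (1, 0),
    fun x => if x.1 = .bottom then if x ∈ T.directPoints then (1, T.kf) else (1, -T.kf) else (0, 1),
    Measurable.ite hb (Measurable.ite hD measurable_const measurable_const) measurable_const,
    Measurable.ite hb (Measurable.ite hD measurable_const measurable_const) measurable_const, ?_⟩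
  filter_upwards [ae_mem_phaseSpace (T := T)] with x hx
  have hc : 0 < Real.cos x.2.2 := cos_pos_of_mem hx
  have hkf := hT.kf_pos
  simp only [LinearIndependent.pair_iff]
  by_cases h1 : x.1 = .bottom
  · by_cases h2 : x ∈ T.directPoints
    · have hC : T.coneBundle x = T.cone1 x := by
        obtain ⟨y, hy, hr⟩ := h2
        exact coneBundle_of_direct hy h1 hr
      simp only [h1, h2, if_true]
      refine ⟨fun a b h => ?_, by rw [hC, cone1_eq hc, curv_bottom h1]⟩
      simp only [Prod.smul_mk, smul_eq_mul, Prod.mk_add_mk, Prod.mk_eq_zero] at h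
      have hb0 : b = 0 := by linarith [h.1]
      subst hb0
      exact ⟨by linarith [h.2], rfl⟩
    · have hC : T.coneBundle x = T.cone2 x := by
        simp only [directPoints, mem_ofPred_eq] at h2
        simp [coneBundle, h1, h2]
      simp only [h1, h2, if_true, if_false]
      refine ⟨fun a b h => ?_, by
        rw [hC, cone2_eq hc (by rw [curv_bottom h1]; exact hkf), curv_bottom h1]⟩
      simp only [Prod.smul_mk, smul_eq_mul, Prod.mk_add_mk, Prod.mk_eq_zero] at h
      have hb0 : b = 0 := by
        have : b * T.kf = 0 := by linarith [h.2]
        exact (mul_eq_zero.1 this).resolve_right hkf.ne'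
      subst hb0
      exact ⟨by linarith [h.1], rfl⟩
  · simp only [h1, if_false]
    refine ⟨fun a b h => ?_, by
      rw [coneBundle_disp h1, cone0_eq hc (by rw [curv_disp h1]; exact hT.kd_neg)]⟩
    simp only [Prod.smul_mk, smul_eq_mul, Prod.mk_add_mk, Prod.mk_eq_zero] at h
    exact ⟨by linarith [h.1], by linarith [h.2]⟩

end Table

end Billiard

end

theorem theorem4p1 (T : Billiard.Table) (hT : T.Admissible) :
    T.EventuallyStrictlyInvariant T.coneBundle := by
  have h := hT.negligible_regular.ae_notMem
  refine ⟨hT.isMeasurableConeBundle, ?_, ?_⟩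
  · filter_upwards [h] with x hx
    have hx : x ∈ T.returnDomain := (not_not.1 hx 0).1
    exact ⟨hx, hT.invariant_of_mem hx⟩
  · filter_upwards [h] with x hx
    exact hT.eventually_strict_of_regular (not_not.1 hx)
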